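/- **Theorem.** There is a (uniform, deterministic) learning algorithm $\mathcal A$ with the following property. For every $n\ge 1$ and all $\gamma,\epsilon\in(0,1]$, given $n,\gamma,\epsilon$ and access to independent, uniformly random examples $(x,f(x))$ of any submodular function $f:\{0,1\}^n\to\mathbb R_+$ (that is, $f(x\vee y)+f(x\wedge y)\le f(x)+f(y)$ for all $x,y\in\{0,1\}^n$), $\mathcal A$ outputs, with probability at least $2/3$ over the examples, a function $h$ which is a multiplicative $(1+\gamma,\epsilon)$-approximation to $f$ over the uniform distribution, i.e. $$\Pr_{x\sim\{0,1\}^n}\bigl[f(x)\le h(x)\le(1+\gamma)f(x)\bigr]\ \ge\ 1-\epsilon .$$ Further, $\mathcal A$ runs in time $\tilde O(n^2)\cdot 2^{\tilde O(1/(\epsilon\gamma)^2)}$ and uses at most $\log(n)\cdot 2^{\tilde O(1/(\epsilon\gamma)^2)}$ examples. Here time is counted on a random access machine on which an arithmetic operation on, or a comparison of, two real numbers (in particular values of $f$) takes one step and drawing an example takes $n+1$ steps; the output $h$ is represented by the memory contents that $\mathcal A$ leaves, from which a fixed program computes $h(x)$ for any given $x$ within the same time bound. Logarithms are to base $2$ and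 are read as $1$ where they are smaller than $1$; $\tilde O(t)$ stands for a quantity that is at most $C\,t\,(\log t)^{c}$ for absolute constants $C,c$. -/

import Mathlib

/-! ### Submodular functions, uniform probability, multiplicative approximation -/

/-- Submodularity of a function on the cube `{0,1}^n`; the coordinatewise maximum and minimum
of two points are the union and the intersection of the corresponding sets. -/
def SubmodularFun {n : ℕ} (f : (Fin n → Bool) → ℝ) : Prop :=
  ∀ x y, f (x ⊔ y) + f (x ⊓ y) ≤ f x + f y

open Classical in
/-- Probability of the event `E` under the uniform distribution on the finite type `Ω`. -/
noncomputable def uniformProb {Ω : Type} [Fintype Ω] (E : Ω → Prop) : ℝ :=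
  ((Finset.univ.filter E).card : ℝ) / (Fintype.card Ω : ℝ)

/-- `h` multiplicatively `(α, ε)`-approximates `f` over the uniform distribution on the cube. -/
def MultApprox {n : ℕ} (α ε : ℝ) (f h : (Fin n → Bool) → ℝ) : Prop :=
  1 - ε ≤ uniformProb (fun x : Fin n → Bool => f x ≤ h x ∧ h x ≤ α * f x)

/-! ### Growth rates -/

/-- The bound `C · t · (log t)^c`, with `log t` read as `1` where it is smaller than `1`:
a quantity is `Õ(t)` when it is at most `softO C c t` for some constants `C` and `c`. -/
noncomputable def softO (C : ℝ) (c : ℕ) (t : ℝ) : ℝ :=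
  C * t * (max 1 (Real.logb 2 t)) ^ c

/-- `Õ(n²) · 2^{Õ(1/(εγ)²)}` with implied constants `C` and `c`. -/
noncomputable def timeBound (C : ℝ) (c n : ℕ) (γ ε : ℝ) : ℝ :=
  softO C c ((n : ℝ) ^ 2) * (2 : ℝ) ^ softO C c ((1 / (ε * γ)) ^ 2)

/-- `log n · 2^{Õ(1/(εγ)²)}` with implied constants `C` and `c`
(`log n` is read as `1` when `n = 1`). -/
noncomputable def exampleBound (C : ℝ) (c n : ℕ) (γ ε : ℝ) : ℝ :=
  max 1 (Real.logb 2 n) * (2 : ℝ) ^ softO C c ((1 / (ε * γ)) ^ 2)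

/-! ### A real-number random access machine with access to labelled examples

A program is a finite text in a small imperative language. The memory consists of arrays of
natural numbers and arrays of real numbers; the arrays that an instruction refers to are fixed in
the program text, the index into an array is computed. The operations are addition, truncated
subtraction and comparison of naturals, and field operations and comparison of reals, at unit
cost, and reading one array entry also costs one step. Naturals can be converted to reals, but there is no rounding of reals, and the only
constants are natural numbers. -/

namespace RealRAM

/-- Configuration of the machine: its memory, and the examples that have not been drawn yet.
`nat a i` and `real a i` are the entries at index `i` of the arrays with name `a`. -/
structure State (n : ℕ) where
  nat : ℕ → ℕ → ℕ
  real : ℕ → ℕ → ℝ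
  examples : List ((Fin n → Bool) × ℝ)

/-- Expressions with natural values. -/
inductive NExp where
  | const (k : ℕ)
  | get (a : ℕ) (i : NExp)
  | add (e₁ e₂ : NExp)
  | sub (e₁ e₂ : NExp)

/-- Expressions with real values. -/
inductive RExp where
  | ofNat (e : NExp)
  | get (a : ℕ) (i : NExp)
  | add (e₁ e₂ : RExp)
  | sub (e₁ e₂ : RExp)
  | mul (e₁ e₂ : RExp)
  | div (e₁ e₂ : RExp)

/-- Tests. -/
inductive BExp where
  | ltNat (e₁ e₂ : NExp)
  | ltReal (e₁ e₂ : RExp)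
  | neg (b : BExp)
  | conj (b₁ b₂ : BExp)

/-- Programs. `setNat a i e` and `setReal a i e` store the value of `e` at index `i` of array `a`;
`draw a b` requests the next random example, stores its point in the first `n` entries of the
natural array `a` and its label in entry `0` of the real array `b`. -/
inductive Cmd where
  | skip
  | setNat (a : ℕ) (i e : NExp)
  | setReal (a : ℕ) (i : NExp) (e : RExp)
  | draw (a b : ℕ)
  | seq (p q : Cmd)
  | ite (b : BExp) (p q : Cmd)
  | loop (b : BExp) (p : Cmd)

section Semantics

variable {n : ℕ}

/-- Value of a natural expression. -/
def NExp.val (s : State n) : NExp → ℕ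
  | .const k => k
  | .get a i => s.nat a (i.val s)
  | .add e₁ e₂ => e₁.val s + e₂.val s
  | .sub e₁ e₂ => e₁.val s - e₂.val s

/-- Value of a real expression (division by zero returns zero). -/
noncomputable def RExp.val (s : State n) : RExp → ℝ
  | .ofNat e => (e.val s : ℝ)
  | .get a i => s.real a (i.val s)
  | .add e₁ e₂ => e₁.val s + e₂.val s
  | .sub e₁ e₂ => e₁.val s - e₂.val s
  | .mul e₁ e₂ => e₁.val s * e₂.val s
  | .div e₁ e₂ => e₁.val s / e₂.val s

/-- Outcome of a test. -/
def BExp.holds (s : State n) : BExp → Prop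
  | .ltNat e₁ e₂ => e₁.val s < e₂.val s
  | .ltReal e₁ e₂ => e₁.val s < e₂.val s
  | .neg b => ¬ b.holds s
  | .conj b₁ b₂ => b₁.holds s ∧ b₂.holds s

/-- Number of elementary operations in a natural expression. -/
def NExp.cost : NExp → ℕ
  | .const _ => 1
  | .get _ i => i.cost + 1
  | .add e₁ e₂ => e₁.cost + e₂.cost + 1
  | .sub e₁ e₂ => e₁.cost + e₂.cost + 1

/-- Number of elementary operations in a real expression. -/
def RExp.cost : RExp → ℕ
  | .ofNat e => e.cost + 1
  | .get _ i => i.cost + 1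
  | .add e₁ e₂ => e₁.cost + e₂.cost + 1
  | .sub e₁ e₂ => e₁.cost + e₂.cost + 1
  | .mul e₁ e₂ => e₁.cost + e₂.cost + 1
  | .div e₁ e₂ => e₁.cost + e₂.cost + 1

/-- Number of elementary operations in a test. -/
def BExp.cost : BExp → ℕ
  | .ltNat e₁ e₂ => e₁.cost + e₂.cost + 1
  | .ltReal e₁ e₂ => e₁.cost + e₂.cost + 1
  | .neg b => b.cost + 1
  | .conj b₁ b₂ => b₁.cost + b₂.cost + 1

/-- Store `v` at index `i` of the natural array `a`. -/
def State.putNat (s : State n) (a i v : ℕ) : State n :=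
  { s with nat := Function.update s.nat a (Function.update (s.nat a) i v) }

/-- Store `v` at index `i` of the real array `a`. -/
noncomputable def State.putReal (s : State n) (a i : ℕ) (v : ℝ) : State n :=
  { s with real := Function.update s.real a (Function.update (s.real a) i v) }

/-- Store the `n` bits of `x` at indices `0, …, n - 1` of the natural array `a`. -/
def State.putPoint (s : State n) (a : ℕ) (x : Fin n → Bool) : State n :=
  { s with
    nat := Function.update s.nat a fun i =>
      if h : i < n then (x ⟨i, h⟩).toNat else s.nat a i }

/-- Replace the list of examples that have not been drawn yet. -/
def State.setExamples (s : State n) (l : List ((Fin n → Bool) × ℝ)) : State n :=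
  { s with examples := l }

/-- `Exec p s s' k`: started in `s`, the program `p` halts in `s'` after `k` steps. Drawing an
example costs `n + 1` steps, and is impossible when no example is left. -/
inductive Exec : Cmd → State n → State n → ℕ → Prop where
  | skip (s : State n) : Exec .skip s s 1
  | setNat (a : ℕ) (i e : NExp) (s : State n) :
      Exec (.setNat a i e) s (s.putNat a (i.val s) (e.val s)) (i.cost + e.cost + 1)
  | setReal (a : ℕ) (i : NExp) (e : RExp) (s : State n) :
      Exec (.setReal a i e) s (s.putReal a (i.val s) (e.val s)) (i.cost + e.cost + 1)
  | draw (a b : ℕ) (s : State n) (x : Fin n → Bool) (y : ℝ) (l : List ((Fin n → Bool) × ℝ))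
      (h : s.examples = (x, y) :: l) :
      Exec (.draw a b) s ((s.putPoint a x).putReal b 0 y |>.setExamples l) (n + 1)
  | seq {p q : Cmd} {s₁ s₂ s₃ : State n} {k₁ k₂ : ℕ} :
      Exec p s₁ s₂ k₁ → Exec q s₂ s₃ k₂ → Exec (.seq p q) s₁ s₃ (k₁ + k₂)
  | iteTrue {b : BExp} {p q : Cmd} {s s' : State n} {k : ℕ} :
      b.holds s → Exec p s s' k → Exec (.ite b p q) s s' (b.cost + 1 + k)
  | iteFalse {b : BExp} {p q : Cmd} {s s' : State n} {k : ℕ} :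
      ¬ b.holds s → Exec q s s' k → Exec (.ite b p q) s s' (b.cost + 1 + k)
  | loopTrue {b : BExp} {p : Cmd} {s₁ s₂ s₃ : State n} {k₁ k₂ : ℕ} :
      b.holds s₁ → Exec p s₁ s₂ k₁ → Exec (.loop b p) s₂ s₃ k₂ →
      Exec (.loop b p) s₁ s₃ (b.cost + 1 + k₁ + k₂)
  | loopFalse {b : BExp} {p : Cmd} {s : State n} :
      ¬ b.holds s → Exec (.loop b p) s s (b.cost + 1)

/-- Started in `s`, the program `p` halts in `s'` after at most `T` steps. -/
def HaltsWithin (p : Cmd) (s s' : State n) (T : ℝ) : Prop :=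
  ∃ k : ℕ, Exec p s s' k ∧ (k : ℝ) ≤ T

/-- Initial configuration of the learner: `n` is entry `0` of the natural array `0`, `γ` and `ε`
are entries `0` and `1` of the real array `0`, the rest of the memory is zero. -/
noncomputable def State.init (γ ε : ℝ) (l : List ((Fin n → Bool) × ℝ)) : State n where
  nat := fun a i => if a = 0 ∧ i = 0 then n else 0
  real := fun a i => if a = 0 ∧ i = 0 then γ else if a = 0 ∧ i = 1 then ε else 0
  examples := l

/-- Configuration in which the hypothesis stored in the memory is evaluated at `x`: the memory is
the one that the learner left, with `x` written to the natural array `1`, and no example of the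
target can be drawn. -/
def State.query (s : State n) (x : Fin n → Bool) : State n :=
  (s.putPoint 1 x).setExamples []

/-- Given `γ`, `ε` and the sequence `l` of examples, the algorithm outputs the hypothesis `h` in
time `T`: the program `learn` halts within `T` steps, without drawing more examples than there are
in `l`, and leaves a memory that represents `h` in the sense that the program `predict`, started
on this memory and any point `x`, computes `h x` within `T` steps (and returns it as entry `0` of
the real array `0`). -/
def Outputs (learn predict : Cmd) (γ ε : ℝ) (l : List ((Fin n → Bool) × ℝ))
    (T : ℝ) (h : (Fin n → Bool) → ℝ) : Prop :=
  ∃ s : State n, HaltsWithin learn (State.init γ ε l) s T ∧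
    ∀ x, ∃ s' : State n, HaltsWithin predict (s.query x) s' T ∧ s'.real 0 0 = h x

/-- The machine is deterministic: final configuration and number of steps are unique. -/
theorem Exec.unique {p : Cmd} {s s₁ s₂ : State n} {k₁ k₂ : ℕ}
    (h₁ : Exec p s s₁ k₁) (h₂ : Exec p s s₂ k₂) : s₁ = s₂ ∧ k₁ = k₂ := by
  induction h₁ generalizing s₂ k₂ with
  | skip s => cases h₂; exact ⟨rfl, rfl⟩
  | setNat a i e s => cases h₂; exact ⟨rfl, rfl⟩
  | setReal a i e s => cases h₂; exact ⟨rfl, rfl⟩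
  | draw a b s x y l h =>
    cases h₂ with
    | draw _ _ _ x' y' l' h' =>
      rw [h] at h'
      simp only [List.cons.injEq, Prod.mk.injEq] at h'
      obtain ⟨⟨rfl, rfl⟩, rfl⟩ := h'
      exact ⟨rfl, rfl⟩
  | seq _ _ ih₁ ih₂ =>
    cases h₂ with
    | seq a b =>
      obtain ⟨rfl, rfl⟩ := ih₁ a
      obtain ⟨rfl, rfl⟩ := ih₂ b
      exact ⟨rfl, rfl⟩
  | iteTrue hb _ ih =>
    cases h₂ with
    | iteTrue _ a => obtain ⟨rfl, rfl⟩ := ih a; exact ⟨rfl, rfl⟩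
    | iteFalse hb' _ => exact absurd hb hb'
  | iteFalse hb _ ih =>
    cases h₂ with
    | iteTrue hb' _ => exact absurd hb' hb
    | iteFalse _ a => obtain ⟨rfl, rfl⟩ := ih a; exact ⟨rfl, rfl⟩
  | loopTrue hb _ _ ih₁ ih₂ =>
    cases h₂ with
    | loopTrue _ a b =>
      obtain ⟨rfl, rfl⟩ := ih₁ a
      obtain ⟨rfl, rfl⟩ := ih₂ b
      exact ⟨rfl, rfl⟩
    | loopFalse hb' => exact absurd hb hb'
  | loopFalse hb =>
    cases h₂ with
    | loopTrue hb' _ _ => exact absurd hb' hb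
    | loopFalse _ => exact ⟨rfl, rfl⟩

end Semantics

end RealRAM

/-!
The hypothesis is computed lazily: the learner only stores a sample, and the program that evaluates
the hypothesis at `x` follows the branch of `x` in a decision tree of constant depth, each node of
which it determines from the stored examples that agree with `x` on the coordinates queried so far.
The answer is the mean label of the examples at the leaf, times `1 + γ / 4`.

At a node, that is, on a subcube with maximum `M`, the next queries are a set `J` of constant size
such that the mean of the function given the coordinates in `J` differs from the function by little,
relative to `M`, in the mean square. Such a set exists for the following reasons.
* The marginal values of a submodular function are antitone, and their total absolute mean is at
  most four times the mean of the function (`SubmodularFun.sum_bExp_abs_marg_le`). Antitone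
  functions behave well under a change of density (`Antitone.bExp_sq_le`,
  `Antitone.bExp_le_pow`): the coordinates of small influence in the `L¹` sense have a small
  influence in the `L²` sense (`SubmodularFun.sum_marg_sq_le`).
* A coordinate whose first and second order Fourier coefficients are tiny has small influence
  (`SubmodularFun.sum_marg_sq_le_of_undetected`). These coefficients can be estimated, and only a
  constant number of coordinates are detected in this way (`card_detected_le`).
* Among the detected coordinates, a maximization argument yields a small set after whose exposure
  the other marginal values are small with high probability; by the Efron–Stein inequality the
  variance that this set does not explain is small (`SubmodularFun.exists_junta_approx`).

The algorithm tries all sets of detected coordinates and takes the one that explains most of the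
variance of the labels (`bExp_sub_cavg_selected_le`).

The mean of a nonnegative submodular function is at least a quarter of its maximum
(`SubmodularFun.le_four_mul_bExp`). Hence with constant probability the mean on the subcube of a
child is comparable to `M`, and in this case Chebyshev's inequality shows that it is a
multiplicative approximation of the function at most points. Otherwise the next level of the tree
gets another chance, so that the error probability decreases exponentially with the depth
(`bExp_runTree_bad_le`). The same bound on the maximum makes Chernoff's inequality effective:
a sample of logarithmic size represents the function on all subcubes of constant codimension at
once (`uniformProb_not_representative_le`).

For the implementation, `RealRAM.Prog` is a language with counting loops only. Its programs have a
total semantics `RealRAM.Prog.eval`, about which one reasons with loop invariants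
(`RealRAM.Prog.eval_iter`), and the running time follows from the nesting depth of the loops alone
(`RealRAM.Prog.exec`). The exponents of `n` and of the other parameters are kept apart by counting
separately the loops that run over the coordinates, which are nested at most twice.
-/

/-! ### Biased product measures on the cube -/

/-- The probability of the point `x` when every coordinate is independently `true` with
probability `p`. -/
noncomputable def biasWeight {n : ℕ} (p : ℝ) (x : Fin n → Bool) : ℝ :=
  ∏ i, if x i then p else 1 - p

/-- Expectation of `φ` when every coordinate is independently `true` with probability `p`. -/
noncomputable def bExp {n : ℕ} (p : ℝ) (φ : (Fin n → Bool) → ℝ) : ℝ :=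
  ∑ x, biasWeight p x * φ x

/-- The point that has the coordinates of `x` in `J` and those of `y` elsewhere. -/
def patch {n : ℕ} (J : Finset (Fin n)) (x y : Fin n → Bool) : Fin n → Bool :=
  fun i => if i ∈ J then x i else y i

section BiasedExpectation

variable {n : ℕ} {p q : ℝ} {φ ψ : (Fin n → Bool) → ℝ}

theorem biasWeight_nonneg (h0 : 0 ≤ p) (h1 : p ≤ 1) (x : Fin n → Bool) : 0 ≤ biasWeight p x :=
  Finset.prod_nonneg fun i _ => by split_ifs <;> linarith

theorem bExp_add : bExp p (fun x => φ x + ψ x) = bExp p φ + bExp p ψ := by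
  simp [bExp, mul_add, Finset.sum_add_distrib]

theorem bExp_sub : bExp p (fun x => φ x - ψ x) = bExp p φ - bExp p ψ := by
  simp [bExp, mul_sub, Finset.sum_sub_distrib]

theorem bExp_neg : bExp p (fun x => -φ x) = -bExp p φ := by
  simp [bExp]

theorem bExp_const_mul (c : ℝ) : bExp p (fun x => c * φ x) = c * bExp p φ := by
  simp only [bExp, Finset.mul_sum]
  exact Finset.sum_congr rfl fun x _ => by ring

theorem bExp_mul_const (c : ℝ) : bExp p (fun x => φ x * c) = bExp p φ * c := by
  simp only [bExp, Finset.sum_mul]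
  exact Finset.sum_congr rfl fun x _ => by ring

theorem bExp_div_const (c : ℝ) : bExp p (fun x => φ x / c) = bExp p φ / c := by
  simp only [div_eq_mul_inv]
  exact bExp_mul_const _

theorem bExp_sum {ι : Type*} (s : Finset ι) (F : ι → (Fin n → Bool) → ℝ) :
    bExp p (fun x => ∑ i ∈ s, F i x) = ∑ i ∈ s, bExp p (F i) := by
  simp only [bExp, Finset.mul_sum]
  exact Finset.sum_comm

theorem bExp_mono (h0 : 0 ≤ p) (h1 : p ≤ 1) (h : ∀ x, φ x ≤ ψ x) : bExp p φ ≤ bExp p ψ :=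
  Finset.sum_le_sum fun x _ => mul_le_mul_of_nonneg_left (h x) (biasWeight_nonneg h0 h1 x)

theorem bExp_nonneg (h0 : 0 ≤ p) (h1 : p ≤ 1) (h : ∀ x, 0 ≤ φ x) : 0 ≤ bExp p φ :=
  Finset.sum_nonneg fun x _ => mul_nonneg (biasWeight_nonneg h0 h1 x) (h x)

/-- Under a product measure the expectation of a product of functions of the single coordinates
is the product of the expectations. -/
theorem bExp_prod (c : Fin n → Bool → ℝ) :
    bExp p (fun x => ∏ i, c i (x i)) = ∏ i, (p * c i true + (1 - p) * c i false) := by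
  have h : ∀ i, p * c i true + (1 - p) * c i false
      = ∑ b ∈ (Finset.univ : Finset Bool), (if b then p else 1 - p) * c i b := by
    intro i; simp
  simp only [h]
  rw [Finset.prod_univ_sum]
  simp only [bExp, biasWeight, ← Finset.prod_mul_distrib, Fintype.piFinset_univ]

theorem bExp_const (c : ℝ) : bExp (n := n) p (fun _ => c) = c := by
  have h := bExp_prod (n := n) (p := p) (fun _ _ => 1)
  simp only [Finset.prod_const_one, mul_one, add_sub_cancel] at h
  have := bExp_mul_const (n := n) (p := p) (φ := fun _ => 1) c
  simpa [h] using this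

theorem bExp_congr (h : ∀ x, φ x = ψ x) : bExp p φ = bExp p ψ := by
  rw [funext h]

theorem biasWeight_patch (J : Finset (Fin n)) (x y : Fin n → Bool) :
    biasWeight p (patch J x y) * biasWeight p (patch J y x) = biasWeight p x * biasWeight p y := by
  simp only [biasWeight, ← Finset.prod_mul_distrib, patch]
  refine Finset.prod_congr rfl fun i _ => ?_
  by_cases h : i ∈ J <;> simp [h, mul_comm]

/-- Resampling the coordinates outside `J` does not change the distribution. -/
theorem bExp_patch (J : Finset (Fin n)) (G : (Fin n → Bool) → ℝ) :
    bExp p (fun x => bExp p (fun y => G (patch J x y))) = bExp p G := by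
  -- exchanging the parts of `x` and `y` inside `J` preserves the joint distribution
  have hinv : Function.Involutive
      (fun z : (Fin n → Bool) × (Fin n → Bool) => (patch J z.1 z.2, patch J z.2 z.1)) := by
    rintro ⟨x, y⟩
    ext i <;> by_cases h : i ∈ J <;> simp [patch, h]
  have h1 : bExp p (fun x => bExp p (fun y => G (patch J x y)))
      = ∑ z : (Fin n → Bool) × (Fin n → Bool),
          biasWeight p z.1 * biasWeight p z.2 * G (patch J z.1 z.2) := by
    simp only [bExp, Fintype.sum_prod_type, Finset.mul_sum, mul_assoc]
  have h2 : bExp p G = ∑ z : (Fin n → Bool) × (Fin n → Bool),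
      biasWeight p z.1 * biasWeight p z.2 * G z.1 := by
    have hone := bExp_const (n := n) (p := p) 1
    simp only [bExp, mul_one] at hone
    simp only [Fintype.sum_prod_type, bExp]
    refine Finset.sum_congr rfl fun x _ => ?_
    rw [← Finset.sum_mul, ← Finset.mul_sum, hone, mul_one]
  rw [h1, h2]
  refine Fintype.sum_equiv hinv.toPerm _ _ fun z => ?_
  simp only [Function.Involutive.coe_toPerm, biasWeight_patch]

/-- A factor that depends on coordinate `i` only is independent of a function that does not
depend on this coordinate. -/
theorem bExp_coord_mul (i : Fin n) (c : Bool → ℝ)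
    (hφ : ∀ x y, (∀ j, j ≠ i → x j = y j) → φ x = φ y) :
    bExp p (fun x => c (x i) * φ x) = (p * c true + (1 - p) * c false) * bExp p φ := by
  rw [← bExp_patch {i}]
  have h1 : ∀ x y, c (patch {i} x y i) * φ (patch {i} x y) = c (x i) * φ y := by
    intro x y
    rw [hφ (patch {i} x y) y (fun j hj => by simp [patch, hj])]
    simp [patch]
  simp only [h1, bExp_const_mul, bExp_mul_const]
  congr 1
  have := bExp_prod (n := n) (p := p) (fun j b => if j = i then c b else 1)
  have h2 : ∀ x : Fin n → Bool, (∏ j, if j = i then c (x j) else 1) = c (x i) := by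
    intro x; simp
  simp only [h2] at this
  rw [this, Finset.prod_eq_single i]
  · simp
  · intro j _ hj; simp [hj]
  · simp

/-- The union of independent random sets of densities `p` and `q` is a random set of density
`1 - (1 - p) (1 - q)`. -/
theorem bExp_sup (G : (Fin n → Bool) → ℝ) :
    bExp p (fun x => bExp q (fun y => G (x ⊔ y))) = bExp (1 - (1 - p) * (1 - q)) G := by
  -- it suffices to treat the indicator of a point, which is a product of functions of coordinates
  have hG : ∀ w, G w = ∑ z, G z * ∏ i, if w i = z i then (1 : ℝ) else 0 := by
    intro w
    rw [Finset.sum_eq_single w]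
    · simp
    · intro z _ hz
      obtain ⟨i, hi⟩ := Function.ne_iff.1 hz
      rw [Finset.prod_eq_zero (Finset.mem_univ i), mul_zero]
      rw [if_neg (Ne.symm hi)]
    · simp
  have hmain : ∀ z : Fin n → Bool,
      bExp p (fun x => bExp q (fun y => ∏ i, if (x ⊔ y) i = z i then (1 : ℝ) else 0))
        = bExp (1 - (1 - p) * (1 - q)) (fun w => ∏ i, if w i = z i then (1 : ℝ) else 0) := by
    intro z
    rw [bExp_prod (fun i b => if b = z i then (1 : ℝ) else 0)]
    have h1 : ∀ x : Fin n → Bool,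
        bExp q (fun y => ∏ i, if (x ⊔ y) i = z i then (1 : ℝ) else 0)
          = ∏ i, (q * (if true = z i then (1 : ℝ) else 0)
              + (1 - q) * (if x i = z i then (1 : ℝ) else 0)) := by
      intro x
      have := bExp_prod (n := n) (p := q) (fun i b => if (x i ⊔ b) = z i then (1 : ℝ) else 0)
      simpa using this
    simp only [h1]
    rw [bExp_prod (fun i b => q * (if true = z i then (1 : ℝ) else 0)
              + (1 - q) * (if b = z i then (1 : ℝ) else 0))]
    refine Finset.prod_congr rfl fun i _ => ?_
    cases z i <;> simp
    ring
  have h3 : ∀ r : ℝ, bExp r G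
      = ∑ z, G z * bExp r (fun w => ∏ i, if w i = z i then (1 : ℝ) else 0) := by
    intro r
    rw [funext hG, bExp_sum]
    refine Finset.sum_congr rfl fun z _ => ?_
    rw [bExp_const_mul]
    simp only [← hG]
  rw [h3]
  simp only [← hmain]
  simp only [← bExp_const_mul, ← bExp_sum]
  simp only [← hG]

/-- Jensen's inequality for the square. -/
theorem sq_bExp_le (h0 : 0 ≤ p) (h1 : p ≤ 1) : bExp p φ ^ 2 ≤ bExp p (fun x => φ x ^ 2) := by
  have h := bExp_nonneg (n := n) h0 h1 (φ := fun x => (φ x - bExp p φ) ^ 2) fun x => sq_nonneg _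
  have e : bExp p (fun x => (φ x - bExp p φ) ^ 2)
      = bExp p (fun x => φ x ^ 2) - bExp p φ ^ 2 := by
    have : ∀ x, (φ x - bExp p φ) ^ 2
        = φ x ^ 2 - (2 * bExp p φ) * φ x + bExp p φ ^ 2 := fun x => by ring
    simp only [this, bExp_add, bExp_sub, bExp_const_mul, bExp_const]
    ring
  linarith

theorem biasWeight_half (x : Fin n → Bool) : biasWeight (1 / 2) x = (1 / 2) ^ n := by
  simp only [biasWeight]
  rw [Finset.prod_congr rfl (g := fun _ => (1 / 2 : ℝ)) (fun i _ => by split_ifs <;> norm_num)]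
  simp

/-- The measure of density `1 - p` is the image of that of density `p` under complementation. -/
theorem bExp_compl : bExp p (fun x => φ xᶜ) = bExp (1 - p) φ := by
  have hinv : Function.Involutive (fun x : Fin n → Bool => xᶜ) := fun x => compl_compl x
  refine Fintype.sum_equiv hinv.toPerm _ _ fun x => ?_
  simp only [Function.Involutive.coe_toPerm, biasWeight]
  congr 1
  refine Finset.prod_congr rfl fun i _ => ?_
  cases h : x i <;> simp [h]

end BiasedExpectation

theorem uniformProb_cube {n : ℕ} (A : (Fin n → Bool) → Prop) [DecidablePred A] :
    uniformProb A = bExp (1 / 2) (fun x => if A x then 1 else 0) := by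
  simp only [uniformProb, bExp, biasWeight_half]
  rw [← Finset.mul_sum, Finset.sum_boole]
  simp only [Fintype.card_pi, Fintype.card_bool, Finset.prod_const, Finset.card_univ,
    Fintype.card_fin]
  rw [div_eq_mul_inv, mul_comm]
  push_cast
  congr 1
  · rw [one_div, inv_pow]
  · congr

/-! ### Marginals of submodular functions -/

/-- The marginal value of coordinate `i`, that is, the discrete derivative of `f` in
direction `i`. -/
def marg {n : ℕ} (i : Fin n) (f : (Fin n → Bool) → ℝ) (x : Fin n → Bool) : ℝ :=
  f (Function.update x i true) - f (Function.update x i false)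

section Marginals

variable {n : ℕ} {f : (Fin n → Bool) → ℝ} {M : ℝ}

theorem update_eq_of_forall_ne {i : Fin n} {x y : Fin n → Bool} (h : ∀ j, j ≠ i → x j = y j)
    (b : Bool) : Function.update x i b = Function.update y i b := by
  ext j
  by_cases hj : j = i
  · subst hj; simp
  · simp [hj, h j hj]

theorem marg_congr {i : Fin n} {x y : Fin n → Bool} (h : ∀ j, j ≠ i → x j = y j) :
    marg i f x = marg i f y := by
  simp only [marg, update_eq_of_forall_ne h]

/-- Decreasing marginal values. -/
theorem SubmodularFun.marg_antitone (hf : SubmodularFun f) (i : Fin n) : Antitone (marg i f) := by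
  intro x y hxy
  have h := hf (Function.update x i true) (Function.update y i false)
  have h1 : Function.update x i true ⊔ Function.update y i false = Function.update y i true := by
    ext j
    by_cases hj : j = i
    · subst hj; simp
    · have := hxy j
      simp only [Pi.sup_apply, Function.update_of_ne hj]
      rw [sup_eq_right.2 this]
  have h2 : Function.update x i true ⊓ Function.update y i false = Function.update x i false := by
    ext j
    by_cases hj : j = i
    · subst hj; simp
    · have := hxy j
      simp only [Pi.inf_apply, Function.update_of_ne hj]
      rw [inf_eq_left.2 this]
  rw [h1, h2] at h
  simp only [marg]
  linarith

theorem SubmodularFun.compl (hf : SubmodularFun f) : SubmodularFun (fun x => f xᶜ) := by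
  intro x y
  have := hf xᶜ yᶜ
  simp only [compl_sup, compl_inf]
  linarith

theorem update_compl (i : Fin n) (b : Bool) (x : Fin n → Bool) :
    (Function.update x i b)ᶜ = Function.update xᶜ i (!b) := by
  ext j
  by_cases hj : j = i
  · subst hj; simp
  · simp [hj]

theorem marg_compl (i : Fin n) (x : Fin n → Bool) :
    marg i (fun x => f xᶜ) x = -marg i f xᶜ := by
  simp [marg, update_compl]

theorem SubmodularFun.comp_patch (hf : SubmodularFun f) (J : Finset (Fin n)) (x : Fin n → Bool) :
    SubmodularFun (fun y => f (patch J x y)) := by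
  intro y z
  have h1 : patch J x (y ⊔ z) = patch J x y ⊔ patch J x z := by
    ext j; by_cases hj : j ∈ J <;> simp [patch, hj]
  have h2 : patch J x (y ⊓ z) = patch J x y ⊓ patch J x z := by
    ext j; by_cases hj : j ∈ J <;> simp [patch, hj]
  simp only [h1, h2]
  exact hf _ _

/-- Removing elements of positive marginal value one after the other: the sum of these values is
at most the value of the set. -/
theorem SubmodularFun.sum_pos_marg_le (hf : SubmodularFun f) (h0 : ∀ x, 0 ≤ f x)
    (x : Fin n → Bool) :
    ∑ i, (if x i then max (marg i f x) 0 else 0) ≤ f x := by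
  have key : ∀ P : Finset (Fin n), (∀ i ∈ P, x i = true) →
      ∑ i ∈ P, marg i f x ≤ f x - f (fun j => if j ∈ P then false else x j) := by
    intro P
    induction P using Finset.induction_on with
    | empty => simp
    | insert i P hi ih =>
      intro hP
      rw [Finset.sum_insert hi]
      have h1 := ih fun j hj => hP j (Finset.mem_insert_of_mem hj)
      have hle : (fun j => if j ∈ P then false else x j) ≤ x := by
        intro j
        by_cases hj : j ∈ P <;> simp [hj]
      have h2 := hf.marg_antitone i hle
      have e1 : Function.update (fun j => if j ∈ P then false else x j) i true
          = (fun j => if j ∈ P then false else x j) := by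
        ext j
        by_cases hj : j = i
        · subst hj; simp [hi, hP j (Finset.mem_insert_self _ _)]
        · simp [hj]
      have e2 : Function.update (fun j => if j ∈ P then false else x j) i false
          = (fun j => if j ∈ insert i P then false else x j) := by
        ext j
        by_cases hj : j = i
        · subst hj; simp
        · simp [hj]
      simp only [marg] at h2 h1 ⊢
      rw [e1, e2] at h2
      linarith
  have h := key (Finset.univ.filter fun i => x i = true ∧ 0 < marg i f x)
    (fun i hi => (Finset.mem_filter.1 hi).2.1)
  refine le_trans (le_of_eq ?_) (h.trans (sub_le_self _ (h0 _)))
  rw [Finset.sum_filter]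
  refine Finset.sum_congr rfl fun i _ => ?_
  by_cases h1 : x i = true <;> by_cases h2 : 0 < marg i f x
  · simp [h1, h2, h2.le]
  · simp [h1, h2, not_lt.1 h2]
  · simp [h1]
  · simp [h1]

/-- Averaging `SubmodularFun.sum_pos_marg_le` over a random set of density `p`: the presence of `i` is
independent of its marginal value. -/
theorem SubmodularFun.sum_bExp_pos_marg_le (hf : SubmodularFun f) (h0 : ∀ x, 0 ≤ f x) {p : ℝ}
    (hp0 : 0 ≤ p) (hp1 : p ≤ 1) :
    p * ∑ i, bExp p (fun x => max (marg i f x) 0) ≤ bExp p f := by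
  rw [Finset.mul_sum]
  refine le_trans (le_of_eq ?_) (bExp_mono hp0 hp1 (hf.sum_pos_marg_le h0))
  rw [bExp_sum]
  refine Finset.sum_congr rfl fun i _ => ?_
  have := bExp_coord_mul (p := p) i (fun b => if b then 1 else 0)
    (φ := fun x => max (marg i f x) 0) (fun x y h => by simp only [marg_congr h])
  simp only [if_true, mul_one, Bool.false_eq_true, if_false, mul_zero, add_zero] at this
  rw [← this]
  exact bExp_congr fun x => by split_ifs <;> simp

/-- The same for the negative parts, by complementation. -/
theorem SubmodularFun.sum_bExp_neg_marg_le (hf : SubmodularFun f) (h0 : ∀ x, 0 ≤ f x) {p : ℝ}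
    (hp0 : 0 ≤ p) (hp1 : p ≤ 1) :
    (1 - p) * ∑ i, bExp p (fun x => max (-marg i f x) 0) ≤ bExp p f := by
  have h := hf.compl.sum_bExp_pos_marg_le (fun x => h0 _) (p := 1 - p) (by linarith) (by linarith)
  simp only [marg_compl] at h
  rw [bExp_compl] at h
  have e : ∀ i, bExp (1 - p) (fun x => max (-marg i f xᶜ) 0)
      = bExp p (fun x => max (-marg i f x) 0) := by
    intro i
    have := bExp_compl (p := 1 - p) (φ := fun x => max (-marg i f x) 0)
    rwa [sub_sub_cancel] at this
  simpa only [e, sub_sub_cancel] using h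

/-- The total influence of a nonnegative submodular function, in the `L¹` sense, is at most four
times its mean. -/
theorem SubmodularFun.sum_bExp_abs_marg_le (hf : SubmodularFun f) (h0 : ∀ x, 0 ≤ f x) :
    ∑ i, bExp (1 / 2) (fun x => |marg i f x|) ≤ 4 * bExp (1 / 2) f := by
  have h1 := hf.sum_bExp_pos_marg_le h0 (p := 1 / 2) (by norm_num) (by norm_num)
  have h2 := hf.sum_bExp_neg_marg_le h0 (p := 1 / 2) (by norm_num) (by norm_num)
  have e : ∑ i, bExp (1 / 2) (fun x => |marg i f x|)
      = ∑ i, bExp (1 / 2) (fun x => max (marg i f x) 0)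
        + ∑ i, bExp (1 / 2) (fun x => max (-marg i f x) 0) := by
    rw [← Finset.sum_add_distrib]
    refine Finset.sum_congr rfl fun i _ => ?_
    rw [← bExp_add]
    refine bExp_congr fun x => ?_
    rcases le_total 0 (marg i f x) with h | h
    · rw [abs_of_nonneg h, max_eq_left h, max_eq_right (by linarith), add_zero]
    · rw [abs_of_nonpos h, max_eq_right h, max_eq_left (by linarith), zero_add]
  rw [e]
  linarith

theorem abs_marg_le (h0 : ∀ x, 0 ≤ f x) (hM : ∀ x, f x ≤ M) (i : Fin n) (x : Fin n → Bool) :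
    |marg i f x| ≤ M := by
  rw [abs_le, marg]
  constructor <;> linarith [h0 (Function.update x i true), h0 (Function.update x i false),
    hM (Function.update x i true), hM (Function.update x i false)]

/-- The mean of a nonnegative submodular function is at least a quarter of its maximum. -/
theorem SubmodularFun.le_four_mul_bExp (hf : SubmodularFun f) (h0 : ∀ x, 0 ≤ f x)
    (s : Fin n → Bool) : f s ≤ 4 * bExp (1 / 2) f := by
  have hflip : ∀ (t : Fin n → Bool) (φ : (Fin n → Bool) → ℝ),
      bExp (1 / 2) (fun y => φ (symmDiff y t)) = bExp (1 / 2) φ := by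
    intro t φ
    have hinv : Function.Involutive (fun y : Fin n → Bool => symmDiff y t) := fun y => by
      simp
    refine Fintype.sum_equiv hinv.toPerm _ _ fun x => ?_
    simp only [Function.Involutive.coe_toPerm, biasWeight_half]
  have hh : (0:ℝ) ≤ 1 / 2 := by norm_num
  have hh1 : (1 / 2 : ℝ) ≤ 1 := by norm_num
  -- `y` and its flip on `s` have union `y ⊔ s`
  have h1 : bExp (1 / 2) (fun y => f (y ⊔ s)) ≤ 2 * bExp (1 / 2) f := by
    have : bExp (1 / 2) (fun y => f (y ⊔ s))
        ≤ bExp (1 / 2) (fun y => f y + f (symmDiff y s)) := by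
      refine bExp_mono hh hh1 fun y => ?_
      have h := hf y (symmDiff y s)
      have e : y ⊔ symmDiff y s = y ⊔ s := by
        ext j; cases hy : y j <;> cases hs : s j <;> simp [symmDiff, hy, hs, disjoint_iff]
      rw [e] at h
      linarith [h0 (y ⊓ symmDiff y s)]
    rw [bExp_add, hflip] at this
    linarith
  -- `y ⊔ s` and `yᶜ ⊔ s` have union `⊤` and intersection `s`
  have h2 : f s ≤ 2 * bExp (1 / 2) (fun y => f (y ⊔ s)) := by
    have : bExp (n := n) (1 / 2) (fun _ => f s)
        ≤ bExp (1 / 2) (fun y => f (y ⊔ s) + f (yᶜ ⊔ s)) := by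
      refine bExp_mono hh hh1 fun y => ?_
      have h := hf (y ⊔ s) (yᶜ ⊔ s)
      rw [← sup_inf_right, inf_compl_self, bot_sup_eq] at h
      linarith [h0 (y ⊔ s ⊔ (yᶜ ⊔ s))]
    rw [bExp_const, bExp_add] at this
    have e := bExp_compl (n := n) (p := 1 / 2) (φ := fun y => f (y ⊔ s))
    norm_num at e this
    linarith
  linarith

end Marginals

/-! ### Conditional averages and variance -/

/-- The average of `f` over the subcube of the points that agree with `x` on `J`. -/
noncomputable def cavg {n : ℕ} (J : Finset (Fin n)) (f : (Fin n → Bool) → ℝ)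
    (x : Fin n → Bool) : ℝ :=
  bExp (1 / 2) (fun y => f (patch J x y))

section ConditionalAverage

variable {n : ℕ} {f : (Fin n → Bool) → ℝ} {J : Finset (Fin n)}

theorem half_nonneg' : (0 : ℝ) ≤ 1 / 2 := by norm_num

theorem half_le_one' : (1 / 2 : ℝ) ≤ 1 := by norm_num

theorem patch_congr {x x' : Fin n → Bool} (h : ∀ i ∈ J, x i = x' i) (y : Fin n → Bool) :
    patch J x y = patch J x' y := by
  ext i
  by_cases hi : i ∈ J
  · simp [patch, hi, h i hi]
  · simp [patch, hi]

theorem patch_patch {Z Z' : Finset (Fin n)} (h : Z ⊆ Z') (x w y : Fin n → Bool) :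
    patch Z' (patch Z x w) y = patch Z x (patch Z' w y) := by
  ext i
  by_cases hi : i ∈ Z
  · simp [patch, hi, h hi]
  · by_cases hi' : i ∈ Z' <;> simp [patch, hi, hi']

theorem patch_self (Z : Finset (Fin n)) (x : Fin n → Bool) : patch Z x x = x := by
  ext i; simp [patch]

theorem patch_union (Z J : Finset (Fin n)) (x w y : Fin n → Bool) :
    patch (Z ∪ J) (patch Z x w) y = patch Z x (patch J w y) := by
  ext i
  by_cases hi : i ∈ Z
  · simp [patch, hi]
  · by_cases hi' : i ∈ J <;> simp [patch, hi, hi']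

theorem cavg_congr {x x' : Fin n → Bool} (h : ∀ i ∈ J, x i = x' i) :
    cavg J f x = cavg J f x' := by
  simp only [cavg, patch_congr h]

theorem cavg_empty (x : Fin n → Bool) : cavg ∅ f x = bExp (1 / 2) f := by
  simp only [cavg]
  exact bExp_congr fun y => congrArg f (by ext; simp [patch])

theorem cavg_univ (x : Fin n → Bool) : cavg Finset.univ f x = f x := by
  have h : ∀ y, patch Finset.univ x y = x := fun y => by ext; simp [patch]
  simp only [cavg, h, bExp_const]

theorem cavg_patch (x y : Fin n → Bool) : cavg J f (patch J x y) = cavg J f x :=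
  cavg_congr fun i hi => by simp [patch, hi]

theorem cavg_nonneg (h0 : ∀ x, 0 ≤ f x) (x : Fin n → Bool) : 0 ≤ cavg J f x :=
  bExp_nonneg half_nonneg' half_le_one' fun _ => h0 _

theorem cavg_le {M : ℝ} (hM : ∀ x, f x ≤ M) (x : Fin n → Bool) : cavg J f x ≤ M :=
  (bExp_mono half_nonneg' half_le_one' fun _ => hM _).trans (bExp_const M).le

theorem bExp_cavg : bExp (1 / 2) (cavg J f) = bExp (1 / 2) f :=
  bExp_patch J f

/-- A function of the coordinates in `J` can be taken out of the conditional average. -/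
theorem bExp_mul_cavg {Φ : (Fin n → Bool) → ℝ}
    (hΦ : ∀ x y, (∀ i ∈ J, x i = y i) → Φ x = Φ y) :
    bExp (1 / 2) (fun x => f x * Φ x) = bExp (1 / 2) (fun x => cavg J f x * Φ x) := by
  rw [← bExp_patch J]
  refine bExp_congr fun x => ?_
  have : ∀ y, Φ (patch J x y) = Φ x := fun y => hΦ _ _ fun i hi => by simp [patch, hi]
  simp only [this, bExp_mul_const, cavg]

theorem bExp_sub_cavg_sq (f : (Fin n → Bool) → ℝ) (J : Finset (Fin n)) :
    bExp (1 / 2) (fun x => (f x - cavg J f x) ^ 2)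
      = bExp (1 / 2) (fun x => f x ^ 2) - bExp (1 / 2) (fun x => cavg J f x ^ 2) := by
  have h : ∀ x, (f x - cavg J f x) ^ 2
      = f x ^ 2 - 2 * (f x * cavg J f x) + cavg J f x ^ 2 := fun x => by ring
  simp only [h, bExp_add, bExp_sub, bExp_const_mul]
  rw [bExp_mul_cavg (J := J) (Φ := cavg J f) fun x y h => cavg_congr h]
  simp only [← pow_two]
  ring

theorem bExp_split (i : Fin n) (G : (Fin n → Bool) → ℝ) :
    bExp (1 / 2) G = bExp (1 / 2) (fun x =>
      (G (Function.update x i true) + G (Function.update x i false)) / 2) := by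
  have h1 := bExp_coord_mul (p := 1 / 2) i (fun b => if b then (1:ℝ) else 0)
    (φ := fun x => G (Function.update x i true))
    (fun x y h => by simp only [update_eq_of_forall_ne h])
  have h2 := bExp_coord_mul (p := 1 / 2) i (fun b => if b then (0:ℝ) else 1)
    (φ := fun x => G (Function.update x i false))
    (fun x y h => by simp only [update_eq_of_forall_ne h])
  have e : ∀ x : Fin n → Bool, G x = (if x i then (1:ℝ) else 0) * G (Function.update x i true)
      + (if x i then (0:ℝ) else 1) * G (Function.update x i false) := by
    intro x
    cases hx : x i
    · have := Function.update_eq_self i x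
      rw [hx] at this
      simp [this]
    · have := Function.update_eq_self i x
      rw [hx] at this
      simp [this]
  rw [bExp_congr e, bExp_add, h1, h2]
  have e2 : ∀ x : Fin n → Bool,
      (G (Function.update x i true) + G (Function.update x i false)) / 2
        = (1 / 2) * G (Function.update x i true) + (1 / 2) * G (Function.update x i false) :=
    fun x => by ring
  simp only [e2, bExp_add, bExp_const_mul]
  norm_num

theorem patch_update {i : Fin n} (hi : i ∉ J) (x y : Fin n → Bool) (b : Bool) :
    patch J x (Function.update y i b) = patch (insert i J) (Function.update x i b) y := by
  ext j
  by_cases hj : j = i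
  · subst hj; simp [patch, hi]
  · by_cases hj' : j ∈ J <;> simp [patch, hj, hj']

theorem cavg_eq_half {i : Fin n} (hi : i ∉ J) (x : Fin n → Bool) :
    cavg J f x = (cavg (insert i J) f (Function.update x i true)
      + cavg (insert i J) f (Function.update x i false)) / 2 := by
  have h : ∀ b, cavg (insert i J) f (Function.update x i b)
      = bExp (1 / 2) (fun y => f (patch J x (Function.update y i b))) := by
    intro b
    simp only [cavg, patch_update hi]
  rw [cavg, bExp_split i, h, h, ← bExp_add, ← bExp_div_const]

theorem cavg_update_sub {i : Fin n} (hi : i ∉ J) (x : Fin n → Bool) :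
    cavg (insert i J) f (Function.update x i true)
      - cavg (insert i J) f (Function.update x i false) = cavg J (marg i f) x := by
  simp only [cavg, ← patch_update hi, marg, ← bExp_sub]
  refine bExp_congr fun y => ?_
  have : ∀ b, patch J x (Function.update y i b) = Function.update (patch J x y) i b := by
    intro b
    ext j
    by_cases hj : j = i
    · subst hj; simp [patch, hi]
    · by_cases hj' : j ∈ J <;> simp [patch, hj, hj']
  simp only [this]

theorem bExp_cavg_insert_sq {i : Fin n} (hi : i ∉ J) :
    bExp (1 / 2) (fun x => cavg (insert i J) f x ^ 2)
      = bExp (1 / 2) (fun x => cavg J f x ^ 2)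
        + bExp (1 / 2) (fun x => cavg J (marg i f) x ^ 2) / 4 := by
  rw [bExp_split i, ← bExp_div_const, ← bExp_add]
  refine bExp_congr fun x => ?_
  rw [cavg_eq_half hi x, ← cavg_update_sub hi x]
  ring

theorem bExp_cavg_sq_le (g : (Fin n → Bool) → ℝ) (J : Finset (Fin n)) :
    bExp (1 / 2) (fun x => cavg J g x ^ 2) ≤ bExp (1 / 2) (fun x => g x ^ 2) := by
  rw [← bExp_cavg (J := J) (f := fun x => g x ^ 2)]
  exact bExp_mono half_nonneg' half_le_one' fun x => sq_bExp_le half_nonneg' half_le_one'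

theorem bExp_cavg_sq_mono {J J' : Finset (Fin n)} (h : J ⊆ J') :
    bExp (1 / 2) (fun x => cavg J f x ^ 2) ≤ bExp (1 / 2) (fun x => cavg J' f x ^ 2) := by
  have hc : ∀ x, cavg J f x = cavg J (cavg J' f) x := by
    intro x
    simp only [cavg]
    rw [← bExp_patch J']
    refine bExp_congr fun w => ?_
    simp only [patch_patch h]
  simp only [hc]
  exact bExp_cavg_sq_le _ _

/-- Efron–Stein inequality for the part of `f` that the coordinates in `J` do not determine. -/
theorem bExp_sub_cavg_sq_le (f : (Fin n → Bool) → ℝ) (J : Finset (Fin n)) :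
    bExp (1 / 2) (fun x => (f x - cavg J f x) ^ 2)
      ≤ (∑ i ∈ Jᶜ, bExp (1 / 2) (fun x => marg i f x ^ 2)) / 4 := by
  rw [bExp_sub_cavg_sq]
  induction hk : Jᶜ using Finset.induction_on generalizing J with
  | empty =>
    have : J = Finset.univ := by simpa using hk
    subst this
    simp [cavg_univ]
  | insert i K hi ih =>
    have hiJ : i ∉ J := by
      have : i ∈ Jᶜ := hk ▸ Finset.mem_insert_self _ _
      simpa using this
    have hK : (insert i J)ᶜ = K := by
      rw [← Finset.erase_insert hi, ← hk]
      ext j; simp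
    have h1 := ih _ hK
    have h2 := bExp_cavg_insert_sq (f := f) hiJ
    have h3 := bExp_cavg_sq_le (marg i f) J
    rw [Finset.sum_insert hi]
    linarith

/-- Poincaré inequality. -/
theorem bExp_sq_le_of_marg (f : (Fin n → Bool) → ℝ) :
    bExp (1 / 2) (fun x => f x ^ 2)
      ≤ bExp (1 / 2) f ^ 2 + (∑ i, bExp (1 / 2) (fun x => marg i f x ^ 2)) / 4 := by
  have h := bExp_sub_cavg_sq_le f ∅
  rw [bExp_sub_cavg_sq] at h
  simp only [cavg_empty, bExp_const, Finset.compl_empty] at h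
  linarith

end ConditionalAverage

/-! ### Monotone functions under a change of density -/

section Monotone

variable {n : ℕ} {f h : (Fin n → Bool) → ℝ} {M : ℝ}

theorem bExp_le_mul_of_sup {p q : ℝ} (hp0 : 0 ≤ p) (hp1 : p ≤ 1) (hq0 : 0 ≤ q) (hq1 : q ≤ 1)
    {a b : (Fin n → Bool) → ℝ} (hab : ∀ x y, h (x ⊔ y) ≤ a x * b y) :
    bExp (1 - (1 - p) * (1 - q)) h ≤ bExp p a * bExp q b := by
  rw [← bExp_sup, ← bExp_mul_const]
  refine bExp_mono hp0 hp1 fun x => ?_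
  rw [← bExp_const_mul]
  exact bExp_mono hq0 hq1 fun y => hab x y

/-- The expectation of an antitone function decreases with the density. -/
theorem Antitone.bExp_le (hh : Antitone h) {p r : ℝ} (hp0 : 0 ≤ p) (hpr : p ≤ r) (hr : r < 1) :
    bExp r h ≤ bExp p h := by
  have hp : 0 < 1 - p := by linarith
  have hq0 : 0 ≤ (r - p) / (1 - p) := div_nonneg (by linarith) hp.le
  have hq1 : (r - p) / (1 - p) ≤ 1 := (div_le_one hp).2 (by linarith)
  have := bExp_le_mul_of_sup (h := h) (a := h) (b := fun _ => 1) hp0 (by linarith) hq0 hq1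
    (fun x y => by rw [mul_one]; exact hh le_sup_left)
  rw [bExp_const, mul_one] at this
  have e : 1 - (1 - p) * (1 - (r - p) / (1 - p)) = r := by field_simp; ring
  rwa [e] at this

/-- For antitone `h ≥ 0`, the second moment at density `1/2` is controlled by the first moment at
density `1/4`, since two independent sets of density `1/4` have a union of density below
`1/2`. -/
theorem Antitone.bExp_sq_le (hh : Antitone h) (h0 : ∀ x, 0 ≤ h x) :
    bExp (1 / 2) (fun x => h x ^ 2) ≤ bExp (1 / 4) h ^ 2 := by
  have hanti : Antitone (fun x => h x ^ 2) := fun x y hxy =>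
    pow_le_pow_left₀ (h0 y) (hh hxy) 2
  have h1 := hanti.bExp_le (p := 1 - (1 - 1 / 4) * (1 - 1 / 4)) (r := 1 / 2) (by norm_num)
    (by norm_num) (by norm_num)
  have h2 := bExp_le_mul_of_sup (h := fun x => h x ^ 2) (a := h) (b := h) (p := 1 / 4)
    (q := 1 / 4) (by norm_num) (by norm_num) (by norm_num) (by norm_num) (fun x y => by
      rw [pow_two]
      exact mul_le_mul (hh le_sup_left) (hh le_sup_right) (h0 _) (h0 _))
  rw [pow_two]
  exact h1.trans h2

/-- The probability of an antitone event at density `1/2` is at most the `k`-th power of its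
probability at density `1 / (2k)`. -/
theorem Antitone.bExp_le_pow {k : ℕ} (hk : 1 ≤ k) (hh : Antitone h) (h0 : ∀ x, 0 ≤ h x)
    (hidem : ∀ x, h x * h x = h x) :
    bExp (1 / 2) h ≤ bExp (1 / (2 * k)) h ^ k := by
  have hk' : (1 : ℝ) ≤ k := by exact_mod_cast hk
  set p : ℝ := 1 / (2 * k) with hp
  have hp0 : 0 ≤ p := by positivity
  have hp1 : p ≤ 1 / 2 := by
    rw [hp]
    exact one_div_le_one_div_of_le (by norm_num) (by linarith)
  have key : ∀ j : ℕ, bExp (1 - (1 - p) ^ (j + 1)) h ≤ bExp p h ^ (j + 1) := by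
    intro j
    induction j with
    | zero => simp
    | succ j ih =>
      have hb : 0 ≤ (1 - p) ^ (j + 1) := pow_nonneg (by linarith) _
      have hb1 : (1 - p) ^ (j + 1) ≤ 1 := pow_le_one₀ (by linarith) (by linarith)
      have h1 := bExp_le_mul_of_sup (h := h) (a := h) (b := h) (p := 1 - (1 - p) ^ (j + 1))
        (q := p) (by linarith) (by linarith) hp0 (by linarith) (fun x y => by
          rw [← hidem (x ⊔ y)]
          exact mul_le_mul (hh le_sup_left) (hh le_sup_right) (h0 _) (h0 _))
      have e : 1 - (1 - (1 - (1 - p) ^ (j + 1))) * (1 - p) = 1 - (1 - p) ^ (j + 1 + 1) := by ring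
      rw [e] at h1
      refine h1.trans ?_
      rw [pow_succ (bExp p h)]
      exact mul_le_mul_of_nonneg_right ih (bExp_nonneg hp0 (by linarith) h0)
  obtain ⟨j, rfl⟩ : ∃ j, k = j + 1 := ⟨k - 1, by omega⟩
  refine le_trans (hh.bExp_le ?_ ?_ (by norm_num)) (key j)
  · have : (1 - p) ^ (j + 1) ≤ 1 := pow_le_one₀ (by linarith) (by linarith)
    linarith
  · have hbern := one_add_mul_le_pow (a := -p) (by linarith) (j + 1)
    have e : ((j + 1 : ℕ) : ℝ) * p = 1 / 2 := by
      rw [hp]; field_simp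
    rw [← sub_eq_add_neg] at hbern
    nlinarith

/-! ### Coordinates of small influence -/

/-- The positive part of a marginal is antitone, so that `Antitone.bExp_sq_le` bounds its second
moment by a product of first moments at density `1/4`. One factor is small because `i` has small
influence, and the other one is summed by `SubmodularFun.sum_bExp_pos_marg_le`. -/
theorem SubmodularFun.sum_pos_marg_sq_le (hf : SubmodularFun f) (h0 : ∀ x, 0 ≤ f x)
    (hM : ∀ x, f x ≤ M) {σ : ℝ} (hσ : 0 ≤ σ) (P : Finset (Fin n))
    (hP : ∀ i ∈ P, bExp (1 / 2) (fun x => |marg i f x|) ≤ σ ^ 2 * M) :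
    ∑ i ∈ P, bExp (1 / 2) (fun x => max (marg i f x) 0 ^ 2) ≤ 4 * σ * M ^ 2 := by
  have hM0 : 0 ≤ M := (h0 ⊥).trans (hM _)
  have hterm : ∀ i ∈ P, bExp (1 / 2) (fun x => max (marg i f x) 0 ^ 2)
      ≤ σ * M * bExp (1 / 4) (fun x => max (marg i f x) 0) := by
    intro i hi
    have hg0 : ∀ x, 0 ≤ max (marg i f x) 0 := fun x => le_max_right _ _
    have h1 : bExp (1 / 2) (fun x => max (marg i f x) 0 ^ 2)
        ≤ bExp (1 / 4) (fun x => max (marg i f x) 0) ^ 2 :=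
      Antitone.bExp_sq_le (fun x y hxy => max_le_max (hf.marg_antitone i hxy) le_rfl) hg0
    have h2 : bExp (1 / 2) (fun x => max (marg i f x) 0 ^ 2) ≤ (σ * M) ^ 2 := by
      have : bExp (1 / 2) (fun x => max (marg i f x) 0 ^ 2)
          ≤ bExp (1 / 2) (fun x => M * |marg i f x|) := by
        refine bExp_mono half_nonneg' half_le_one' fun x => ?_
        have ha := abs_marg_le h0 hM i x
        have hb : max (marg i f x) 0 ≤ |marg i f x| := max_le (le_abs_self _) (abs_nonneg _)
        rw [pow_two]
        exact mul_le_mul (hb.trans ha) hb (hg0 x) hM0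
      rw [bExp_const_mul] at this
      have h3 := mul_le_mul_of_nonneg_left (hP i hi) hM0
      calc _ ≤ _ := this
        _ ≤ M * (σ ^ 2 * M) := h3
        _ = (σ * M) ^ 2 := by ring
    have hB : 0 ≤ bExp (1 / 4) (fun x => max (marg i f x) 0) :=
      bExp_nonneg (by norm_num) (by norm_num) hg0
    have hX : 0 ≤ bExp (1 / 2) (fun x => max (marg i f x) 0 ^ 2) :=
      bExp_nonneg half_nonneg' half_le_one' fun x => sq_nonneg _
    refine le_of_sq_le_sq ?_ (by positivity)
    calc bExp (1 / 2) (fun x => max (marg i f x) 0 ^ 2) ^ 2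
        = bExp (1 / 2) (fun x => max (marg i f x) 0 ^ 2)
          * bExp (1 / 2) (fun x => max (marg i f x) 0 ^ 2) := pow_two _
      _ ≤ (σ * M) ^ 2 * bExp (1 / 4) (fun x => max (marg i f x) 0) ^ 2 :=
          mul_le_mul h2 h1 hX (sq_nonneg _)
      _ = _ := by ring
  refine (Finset.sum_le_sum hterm).trans ?_
  rw [← Finset.mul_sum]
  have h1 : ∑ i ∈ P, bExp (1 / 4) (fun x => max (marg i f x) 0)
      ≤ ∑ i, bExp (1 / 4) (fun x => max (marg i f x) 0) :=
    Finset.sum_le_univ_sum_of_nonneg fun i =>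
      bExp_nonneg (by norm_num) (by norm_num) fun x => le_max_right _ _
  have h2 := hf.sum_bExp_pos_marg_le h0 (p := 1 / 4) (by norm_num) (by norm_num)
  have h3 : bExp (1 / 4) f ≤ M :=
    (bExp_mono (by norm_num) (by norm_num) hM).trans (bExp_const M).le
  have h4 : ∑ i ∈ P, bExp (1 / 4) (fun x => max (marg i f x) 0) ≤ 4 * M := by linarith
  calc _ ≤ σ * M * (4 * M) := mul_le_mul_of_nonneg_left h4 (by positivity)
    _ = _ := by ring

/-- Coordinates whose marginals are small in `L¹` have a small total influence in `L²`. -/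
theorem SubmodularFun.sum_marg_sq_le (hf : SubmodularFun f) (h0 : ∀ x, 0 ≤ f x)
    (hM : ∀ x, f x ≤ M) {σ : ℝ} (hσ : 0 ≤ σ) (P : Finset (Fin n))
    (hP : ∀ i ∈ P, bExp (1 / 2) (fun x => |marg i f x|) ≤ σ ^ 2 * M) :
    ∑ i ∈ P, bExp (1 / 2) (fun x => marg i f x ^ 2) ≤ 8 * σ * M ^ 2 := by
  have hcompl : ∀ φ : (Fin n → Bool) → ℝ,
      bExp (1 / 2) (fun x => φ xᶜ) = bExp (1 / 2) φ := by
    intro φ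
    rw [bExp_compl]; norm_num
  have h1 := hf.sum_pos_marg_sq_le h0 hM hσ P hP
  have h2 := hf.compl.sum_pos_marg_sq_le (fun x => h0 _) (fun x => hM _) hσ P (fun i hi => by
    simp only [marg_compl, abs_neg]
    exact (hcompl fun x => |marg i f x|).trans_le (hP i hi))
  have e : ∀ i, bExp (1 / 2) (fun x => max (marg i (fun x => f xᶜ) x) 0 ^ 2)
      = bExp (1 / 2) (fun x => max (-marg i f x) 0 ^ 2) := by
    intro i
    simp only [marg_compl]
    exact hcompl fun x => max (-marg i f x) 0 ^ 2
  simp only [e] at h2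
  have e2 : ∀ i, bExp (1 / 2) (fun x => marg i f x ^ 2)
      = bExp (1 / 2) (fun x => max (marg i f x) 0 ^ 2)
        + bExp (1 / 2) (fun x => max (-marg i f x) 0 ^ 2) := by
    intro i
    rw [← bExp_add]
    refine bExp_congr fun x => ?_
    rcases le_total 0 (marg i f x) with h | h
    · rw [max_eq_left h, max_eq_right (by linarith)]; ring
    · rw [max_eq_right h, max_eq_left (by linarith)]; ring
  simp only [e2, Finset.sum_add_distrib]
  linarith

theorem marg_marg_self (i : Fin n) (x : Fin n → Bool) : marg i (marg i f) x = 0 := by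
  simp [marg]

theorem marg_comm (i j : Fin n) (x : Fin n → Bool) :
    marg j (marg i f) x = marg i (marg j f) x := by
  by_cases h : i = j
  · rw [h]
  · simp only [marg]
    simp only [Function.update_comm h]
    ring

theorem SubmodularFun.marg_marg_nonpos (hf : SubmodularFun f) (i j : Fin n)
    (x : Fin n → Bool) : marg j (marg i f) x ≤ 0 := by
  have h : Function.update x j false ≤ Function.update x j true := by
    intro l
    by_cases hl : l = j
    · subst hl; simp
    · simp [hl]
  have := hf.marg_antitone i h
  rw [marg]
  linarith

theorem bExp_marg_marg_sq_le (i j : Fin n) :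
    bExp (1 / 2) (fun x => marg j (marg i f) x ^ 2)
      ≤ 4 * bExp (1 / 2) (fun x => marg j f x ^ 2) := by
  rw [bExp_split i (fun x => marg j f x ^ 2), ← bExp_const_mul]
  refine bExp_mono half_nonneg' half_le_one' fun x => ?_
  rw [marg_comm, marg]
  nlinarith [sq_nonneg (marg j f (Function.update x i true)
    + marg j f (Function.update x i false))]

/-- Low-degree statistics detect every coordinate that matters: if the means of all first and
second order marginals at the coordinates outside `V` are tiny, then these coordinates have a
small total influence. The second order marginals in directions of small `L¹` influence are
controlled by `SubmodularFun.sum_marg_sq_le`; there are few other directions, and for these the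
mean of a second order marginal, which has a constant sign, bounds its second moment. -/
theorem SubmodularFun.sum_marg_sq_le_of_undetected (hf : SubmodularFun f) (h0 : ∀ x, 0 ≤ f x)
    (hM : ∀ x, f x ≤ M) {κ : ℝ} (hκ : 0 < κ) (hκ1 : κ ≤ 1) (P : Finset (Fin n))
    (h1 : ∀ i ∈ P, |bExp (1 / 2) (marg i f)| ≤ κ ^ 16 * M)
    (h2 : ∀ i ∈ P, ∀ j, j ≠ i → |bExp (1 / 2) (marg j (marg i f))| ≤ κ ^ 16 * M) :
    ∑ i ∈ P, bExp (1 / 2) (fun x => marg i f x ^ 2) ≤ 16 * κ * M ^ 2 := by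
  have hM0 : 0 ≤ M := (h0 ⊥).trans (hM _)
  rcases hM0.eq_or_lt with hM0' | hMpos
  · have : ∀ i x, marg i f x = 0 := fun i x => by
      have := abs_marg_le h0 hM i x
      rw [← hM0'] at this
      exact abs_eq_zero.1 (le_antisymm this (abs_nonneg _))
    simp [this, bExp_const, ← hM0']
  suffices hP : ∀ i ∈ P, bExp (1 / 2) (fun x => |marg i f x|) ≤ (2 * κ) ^ 2 * M by
    have := hf.sum_marg_sq_le h0 hM (by positivity) P hP
    linarith
  intro i hi
  classical
  set H : Finset (Fin n) :=
    Finset.univ.filter fun j => ¬ bExp (1 / 2) (fun x => |marg j f x|) ≤ (κ ^ 4) ^ 2 * M with hH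
  -- the directions of small influence
  have hlight : ∑ j ∈ Hᶜ, bExp (1 / 2) (fun x => marg j (marg i f) x ^ 2)
      ≤ 32 * κ ^ 4 * M ^ 2 := by
    have ha := hf.sum_marg_sq_le h0 hM (σ := κ ^ 4) (by positivity) Hᶜ (fun j hj => by
      simpa [hH] using hj)
    calc _ ≤ ∑ j ∈ Hᶜ, 4 * bExp (1 / 2) (fun x => marg j f x ^ 2) :=
          Finset.sum_le_sum fun j _ => bExp_marg_marg_sq_le i j
      _ ≤ _ := by rw [← Finset.mul_sum]; linarith
  have hcard : (H.card : ℝ) * κ ^ 8 ≤ 4 := by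
    have ha : ∑ j ∈ H, (κ ^ 4) ^ 2 * M ≤ ∑ j ∈ H, bExp (1 / 2) (fun x => |marg j f x|) :=
      Finset.sum_le_sum fun j hj => (not_le.1 (Finset.mem_filter.1 hj).2).le
    have hb : ∑ j ∈ H, bExp (1 / 2) (fun x => |marg j f x|)
        ≤ ∑ j, bExp (1 / 2) (fun x => |marg j f x|) :=
      Finset.sum_le_univ_sum_of_nonneg fun j =>
        bExp_nonneg half_nonneg' half_le_one' fun x => abs_nonneg _
    have hc := hf.sum_bExp_abs_marg_le h0
    have hd : bExp (1 / 2) f ≤ M :=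
      (bExp_mono half_nonneg' half_le_one' hM).trans (bExp_const M).le
    rw [Finset.sum_const, nsmul_eq_mul] at ha
    have he : (H.card : ℝ) * κ ^ 8 * M ≤ 4 * M := by
      calc _ = (H.card : ℝ) * ((κ ^ 4) ^ 2 * M) := by ring
        _ ≤ _ := by linarith
    exact le_of_mul_le_mul_right he hMpos
  have hheavy : ∑ j ∈ H, bExp (1 / 2) (fun x => marg j (marg i f) x ^ 2)
      ≤ 8 * κ ^ 8 * M ^ 2 := by
    have ht : ∀ j ∈ H, bExp (1 / 2) (fun x => marg j (marg i f) x ^ 2)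
        ≤ 2 * M * (κ ^ 16 * M) := by
      intro j _
      by_cases hij : j = i
      · subst hij
        simp only [marg_marg_self]
        rw [show ((0 : ℝ) ^ 2) = 0 by norm_num, bExp_const]
        positivity
      · have ha : bExp (1 / 2) (fun x => marg j (marg i f) x ^ 2)
            ≤ bExp (1 / 2) (fun x => 2 * M * (-marg j (marg i f) x)) := by
          refine bExp_mono half_nonneg' half_le_one' fun x => ?_
          have hneg := hf.marg_marg_nonpos i j x
          have hb : -marg j (marg i f) x ≤ 2 * M := by
            have hx := abs_le.1 (abs_marg_le h0 hM i (Function.update x j true))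
            have hy := abs_le.1 (abs_marg_le h0 hM i (Function.update x j false))
            rw [marg]; linarith
          nlinarith
        rw [bExp_const_mul, bExp_neg] at ha
        refine ha.trans (mul_le_mul_of_nonneg_left ?_ (by positivity))
        exact (neg_le_abs _).trans (h2 i hi j hij)
    refine (Finset.sum_le_sum ht).trans ?_
    rw [Finset.sum_const, nsmul_eq_mul]
    calc (H.card : ℝ) * (2 * M * (κ ^ 16 * M)) = (H.card * κ ^ 8) * (2 * κ ^ 8 * M ^ 2) := by ring
      _ ≤ 4 * (2 * κ ^ 8 * M ^ 2) := mul_le_mul_of_nonneg_right hcard (by positivity)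
      _ = _ := by ring
  have hsq := bExp_sq_le_of_marg (marg i f)
  rw [← Finset.sum_add_sum_compl H] at hsq
  have hmean : bExp (1 / 2) (marg i f) ^ 2 ≤ (κ ^ 16 * M) ^ 2 := by
    rw [← sq_abs]
    exact pow_le_pow_left₀ (abs_nonneg _) (h1 i hi) 2
  have ha := sq_bExp_le (p := 1 / 2) (φ := fun x => |marg i f x|) half_nonneg' half_le_one'
  simp only [sq_abs] at ha
  refine le_of_sq_le_sq (ha.trans ?_) (by positivity)
  have hk8 : κ ^ 8 ≤ κ ^ 4 := pow_le_pow_of_le_one hκ.le hκ1 (by norm_num)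
  have hk32 : κ ^ 32 ≤ κ ^ 4 := pow_le_pow_of_le_one hκ.le hκ1 (by norm_num)
  have hb : (κ ^ 16 * M) ^ 2 = κ ^ 32 * M ^ 2 := by ring
  have hM2 : 0 ≤ M ^ 2 := sq_nonneg M
  have hc := mul_le_mul_of_nonneg_right hk8 hM2
  have hd := mul_le_mul_of_nonneg_right hk32 hM2
  have he : ((2 * κ) ^ 2 * M) ^ 2 = 16 * (κ ^ 4 * M ^ 2) := by ring
  rw [he]
  have hf : 0 ≤ κ ^ 4 * M ^ 2 := by positivity
  linarith

end Monotone

/-! ### Approximation by juntas -/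

/-- The largest value of `f` at a subset of the part of the set `S` inside `J`. -/
noncomputable def bestSub {n : ℕ} (f : (Fin n → Bool) → ℝ) (J : Finset (Fin n))
    (S : Fin n → Bool) : ℝ :=
  (Finset.univ.filter fun T : Fin n → Bool => ∀ j, T j ≤ patch J S ⊥ j).sup' ⟨⊥, by simp⟩ f

section Junta

variable {n : ℕ} {f : (Fin n → Bool) → ℝ} {M : ℝ}

theorem bestSub_le (hM : ∀ x, f x ≤ M) (J : Finset (Fin n)) (S : Fin n → Bool) :
    bestSub f J S ≤ M :=
  Finset.sup'_le _ _ fun x _ => hM x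

theorem le_bestSub {J : Finset (Fin n)} {S T : Fin n → Bool} (h : T ≤ patch J S ⊥) :
    f T ≤ bestSub f J S :=
  Finset.le_sup' f (Finset.mem_filter.2 ⟨Finset.mem_univ _, fun j => h j⟩)

theorem patch_bot_mono {J J' : Finset (Fin n)} (h : J ⊆ J') (S : Fin n → Bool) :
    patch J S ⊥ ≤ patch J' S ⊥ := by
  intro j
  by_cases hj : j ∈ J
  · simp [patch, hj, h hj]
  · simp [patch, hj]

theorem patch_bot_le (J : Finset (Fin n)) (S : Fin n → Bool) : patch J S ⊥ ≤ S := by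
  intro j
  by_cases hj : j ∈ J <;> simp [patch, hj]

theorem patch_bot_compl (J : Finset (Fin n)) (S : Fin n → Bool) :
    (patch J S ⊥)ᶜ = patch J Sᶜ ⊤ := by
  ext j
  by_cases hj : j ∈ J <;> simp [patch, hj]

theorem bestSub_mono {J J' : Finset (Fin n)} (h : J ⊆ J') (S : Fin n → Bool) :
    bestSub f J S ≤ bestSub f J' S :=
  Finset.sup'_le _ _ fun T hT => le_bestSub (by
    exact le_trans (b := patch J S ⊥) (Finset.mem_filter.1 hT).2 (patch_bot_mono h S))

/-- If the marginal value of `i` at the part of `S` inside `J` exceeds `a`, then admitting `i ∈ S`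
raises the best value by `a`, since the marginal value at any subset is at least as large. -/
theorem SubmodularFun.bestSub_insert (hf : SubmodularFun f) {J : Finset (Fin n)} {i : Fin n}
    (hi : i ∉ J) (a : ℝ) (S : Fin n → Bool) :
    bestSub f J S + (if S i then (1:ℝ) else 0)
      * (a * if a < marg i f (patch J S ⊥) then 1 else 0) ≤ bestSub f (insert i J) S := by
  by_cases h : S i = true ∧ a < marg i f (patch J S ⊥)
  · obtain ⟨hS, ha⟩ := h
    simp only [hS, if_true, ha, one_mul, mul_one]
    obtain ⟨T, hT, hTe⟩ := Finset.exists_mem_eq_sup' (s := Finset.univ.filter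
      fun T : Fin n → Bool => ∀ j, T j ≤ patch J S ⊥ j) ⟨⊥, by simp⟩ f
    rw [bestSub, hTe]
    replace hT : T ≤ patch J S ⊥ := (Finset.mem_filter.1 hT).2
    have h1 := hf.marg_antitone i hT
    have hTi : T i = false := by
      have := hT i
      rw [patch, if_neg hi] at this
      exact le_bot_iff.1 this
    have e : Function.update T i false = T := by rw [← hTi, Function.update_eq_self]
    have h2 : f (Function.update T i true) ≤ bestSub f (insert i J) S := by
      refine le_bestSub fun j => ?_
      by_cases hj : j = i
      · subst hj; simp [patch, hS]
      · have := hT j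
        simpa [patch, hj] using this
    have h3 : marg i f T = f (Function.update T i true) - f T := by rw [marg, e]
    linarith
  · have : (if S i then (1:ℝ) else 0) * (a * if a < marg i f (patch J S ⊥) then 1 else 0)
        = 0 := by
      by_cases h1 : S i = true
      · have h2 : ¬ a < marg i f (patch J S ⊥) := fun h2 => h ⟨h1, h2⟩
        simp [h2]
      · simp [h1]
    rw [this, add_zero]
    exact bestSub_mono (Finset.subset_insert _ _) S

/-- Adding `i` to `J` increases the expected best value by at least `p a` times the probability that
the marginal value of `i` still exceeds `a`. -/
theorem SubmodularFun.bExp_bestSub_insert (hf : SubmodularFun f) {J : Finset (Fin n)} {i : Fin n}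
    (hi : i ∉ J) (a : ℝ) {p : ℝ} (hp0 : 0 ≤ p) (hp1 : p ≤ 1) :
    bExp p (bestSub f J)
      + p * (a * bExp p (fun S => if a < marg i f (patch J S ⊥) then 1 else 0))
      ≤ bExp p (bestSub f (insert i J)) := by
  have h := bExp_mono hp0 hp1 (hf.bestSub_insert hi a)
  rw [bExp_add] at h
  have h2 := bExp_coord_mul (p := p) i (fun b => if b then (1:ℝ) else 0)
    (φ := fun S => a * if a < marg i f (patch J S ⊥) then 1 else 0) (fun x y hxy => by
      have : marg i f (patch J x ⊥) = marg i f (patch J y ⊥) :=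
        marg_congr fun j hj => by simp [patch, hxy j hj]
      simp only [this])
  simp only [if_true, mul_one, Bool.false_eq_true, if_false, mul_zero, add_zero,
    bExp_const_mul] at h2
  rw [h2] at h
  exact h

theorem SubmodularFun.antitone_marg_event (hf : SubmodularFun f) (J : Finset (Fin n)) (i : Fin n)
    (a : ℝ) :
    Antitone (fun S : Fin n → Bool =>
      if a < marg i f (patch J S ⊥) then (1:ℝ) else 0) := by
  intro x y hxy
  have h : patch J x ⊥ ≤ patch J y ⊥ := by
    intro j
    by_cases hj : j ∈ J
    · simpa [patch, hj] using hxy j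
    · simp [patch, hj]
  have := hf.marg_antitone i h
  dsimp only
  split_ifs with h1 h2
  · exact le_rfl
  · exact absurd (h1.trans_le this) h2
  · exact zero_le_one
  · exact le_rfl

/-- A small set `J` of coordinates after whose exposure the marginal values in `V` are, with high
probability, bounded by `a` in absolute value on the whole subcube. The set `J` maximizes the
expected best value at a random set of small density, minus a price for each element; the
probability at density `1 / (2k)` that a coordinate violates the bound is then at most `1/2`, and
drops to `2⁻ᵏ` at density `1/2`. -/
theorem SubmodularFun.exists_junta (hf : SubmodularFun f) (h0 : ∀ x, 0 ≤ f x)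
    (hM : ∀ x, f x ≤ M) (V : Finset (Fin n)) {a : ℝ} (ha : 0 < a) {k : ℕ} (hk : 1 ≤ k) :
    ∃ J ⊆ V, (J.card : ℝ) * a ≤ 8 * k * M ∧ ∀ i ∈ V \ J,
      bExp (1 / 2) (fun S => if a < marg i f (patch J S ⊥) then (1:ℝ) else 0)
        ≤ (1 / 2) ^ k ∧
      bExp (1 / 2) (fun S => if a < -marg i f (patch J S ⊤) then (1:ℝ) else 0)
        ≤ (1 / 2) ^ k := by
  have hk' : (1 : ℝ) ≤ k := by exact_mod_cast hk
  set p : ℝ := 1 / (2 * k) with hp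
  have hp0 : 0 < p := by positivity
  have hp1 : p ≤ 1 := by
    rw [hp, div_le_one (by positivity)]; linarith
  have hM0 : 0 ≤ M := (h0 ⊥).trans (hM _)
  have hb0 : ∀ g : (Fin n → Bool) → ℝ, (∀ x, 0 ≤ g x) → ∀ J, 0 ≤ bExp p (bestSub g J) :=
    fun g hg J => bExp_nonneg hp0.le hp1 fun S => (hg ⊥).trans (le_bestSub bot_le)
  have hbM : ∀ g : (Fin n → Bool) → ℝ, (∀ x, g x ≤ M) → ∀ J, bExp p (bestSub g J) ≤ M :=
    fun g hg J => (bExp_mono hp0.le hp1 fun S => bestSub_le hg J S).trans (bExp_const M).le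
  set Φ : Finset (Fin n) → ℝ := fun J =>
    bExp p (bestSub f J) + bExp p (bestSub (fun x => f xᶜ) J) - (a * p / 2) * J.card with hΦ
  obtain ⟨J, hJ, hmax⟩ := Finset.exists_max_image V.powerset Φ ⟨∅, by simp⟩
  rw [Finset.mem_powerset] at hJ
  refine ⟨J, hJ, ?_, ?_⟩
  · have h1 := hmax ∅ (by simp)
    simp only [hΦ, Finset.card_empty, Nat.cast_zero, mul_zero, sub_zero] at h1
    have h2 := hb0 f h0 ∅
    have h3 := hb0 (fun x => f xᶜ) (fun x => h0 _) ∅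
    have h4 := hbM f hM J
    have h5 := hbM (fun x => f xᶜ) (fun x => hM _) J
    have h6 : a * p / 2 * J.card ≤ 2 * M := by linarith
    have e : a * p / 2 * J.card = (J.card * a) / (4 * k) := by rw [hp]; field_simp; ring
    rw [e, div_le_iff₀ (by positivity)] at h6
    linarith
  · intro i hi
    rw [Finset.mem_sdiff] at hi
    have h1 := hmax (insert i J) (by
      rw [Finset.mem_powerset]; exact Finset.insert_subset hi.1 hJ)
    simp only [hΦ, Finset.card_insert_of_notMem hi.2, Nat.cast_add, Nat.cast_one] at h1
    have hmono : ∀ g : (Fin n → Bool) → ℝ,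
        bExp p (bestSub g J) ≤ bExp p (bestSub g (insert i J)) := fun g =>
      bExp_mono hp0.le hp1 fun S => bestSub_mono (Finset.subset_insert _ _) S
    -- the gain of either summand is at most the price of `i`
    have main : ∀ g : (Fin n → Bool) → ℝ, SubmodularFun g →
        bExp p (bestSub g (insert i J)) ≤ bExp p (bestSub g J) + a * p / 2 →
        bExp (1 / 2) (fun S => if a < marg i g (patch J S ⊥) then (1:ℝ) else 0)
          ≤ (1 / 2) ^ k := by
      intro g hg hgain
      have h2 := hg.bExp_bestSub_insert hi.2 a hp0.le hp1
      have h3 : bExp p (fun S => if a < marg i g (patch J S ⊥) then (1:ℝ) else 0)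
          ≤ 1 / 2 := by
        by_contra hcon
        push Not at hcon
        have := mul_lt_mul_of_pos_left hcon (mul_pos hp0 ha)
        nlinarith
      refine ((hg.antitone_marg_event J i a).bExp_le_pow hk (fun x => ?_) (fun x => ?_)).trans
        (pow_le_pow_left₀ (bExp_nonneg hp0.le hp1 fun x => ?_) h3 k)
      · split_ifs <;> norm_num
      · split_ifs <;> norm_num
      · split_ifs <;> norm_num
    refine ⟨main f hf ?_, ?_⟩
    · have := hmono (fun x => f xᶜ)
      linarith
    · have h2 := main (fun x => f xᶜ) hf.compl (by have := hmono f; linarith)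
      have e := bExp_compl (n := n) (p := 1 / 2)
        (φ := fun S => if a < -marg i f (patch J S ⊤) then (1:ℝ) else 0)
      rw [show (1 - 1 / 2 : ℝ) = 1 / 2 by norm_num] at e
      rw [← e]
      simpa only [marg_compl, patch_bot_compl] using h2

theorem sq_le_of_event {g c a M : ℝ} (hg0 : 0 ≤ g) (hgM : g ≤ M) (hgc : g ≤ max c 0)
    (ha : 0 ≤ a) :
    g ^ 2 ≤ a * g + M ^ 2 * (if a < c then 1 else 0) := by
  split_ifs with h
  · nlinarith
  · push Not at h
    have : g ≤ a := hgc.trans (max_le h ha)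
    nlinarith

/-- A nonnegative submodular function is close in `L²` to its average over the coordinates outside
a small subset `J` of any set `V` that contains all coordinates of noticeable first or second
order marginals. -/
theorem SubmodularFun.exists_junta_approx (hf : SubmodularFun f) (h0 : ∀ x, 0 ≤ f x)
    (hM : ∀ x, f x ≤ M) (V : Finset (Fin n)) {α κ : ℝ} (hα : 0 < α) (hκ : 0 < κ) (hκ1 : κ ≤ 1)
    {k : ℕ} (hk : 1 ≤ k)
    (h1 : ∀ i ∉ V, |bExp (1 / 2) (marg i f)| ≤ κ ^ 16 * M)
    (h2 : ∀ i ∉ V, ∀ j, j ≠ i → |bExp (1 / 2) (marg j (marg i f))| ≤ κ ^ 16 * M) :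
    ∃ J ⊆ V, (J.card : ℝ) * α ≤ 8 * k ∧
      bExp (1 / 2) (fun x => (f x - cavg J f x) ^ 2)
        ≤ (4 * κ + α + V.card * (1 / 2) ^ k / 2) * M ^ 2 := by
  have hM0 : 0 ≤ M := (h0 ⊥).trans (hM _)
  rcases hM0.eq_or_lt with hM0' | hMpos
  · have hz : ∀ x, f x = 0 := fun x => le_antisymm (by rw [hM0']; exact hM x) (h0 x)
    refine ⟨∅, by simp, by simp, ?_⟩
    simp [hz, cavg, bExp_const, ← hM0']
  obtain ⟨J, hJV, hcard, hJ⟩ := hf.exists_junta h0 hM V (mul_pos hα hMpos) hk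
  refine ⟨J, hJV, ?_, ?_⟩
  · refine le_of_mul_le_mul_right ?_ hMpos
    linarith
  have hout := hf.sum_marg_sq_le_of_undetected h0 hM hκ hκ1 Vᶜ
    (fun i hi => h1 i (by simpa using hi)) (fun i hi => h2 i (by simpa using hi))
  have hin : ∑ i ∈ V \ J, bExp (1 / 2) (fun x => marg i f x ^ 2)
      ≤ 4 * α * M ^ 2 + V.card * (2 * (1 / 2) ^ k * M ^ 2) := by
    have ht : ∀ i ∈ V \ J, bExp (1 / 2) (fun x => marg i f x ^ 2)
        ≤ α * M * bExp (1 / 2) (fun x => |marg i f x|) + 2 * (1 / 2) ^ k * M ^ 2 := by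
      intro i hi
      obtain ⟨ha, hb⟩ := hJ i hi
      have : bExp (1 / 2) (fun x => marg i f x ^ 2)
          ≤ bExp (1 / 2) (fun x => α * M * |marg i f x|
            + (M ^ 2 * (if α * M < marg i f (patch J x ⊥) then (1:ℝ) else 0)
              + M ^ 2 * (if α * M < -marg i f (patch J x ⊤) then (1:ℝ) else 0))) := by
        refine bExp_mono half_nonneg' half_le_one' fun x => ?_
        have hx := abs_marg_le h0 hM i x
        have hle1 := hf.marg_antitone i (patch_bot_le J x)
        have hle2 : marg i f (patch J x ⊤) ≤ marg i f x := by
          refine hf.marg_antitone i fun j => ?_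
          by_cases hj : j ∈ J <;> simp [patch, hj]
        have hpos1 : 0 ≤ M ^ 2 * (if α * M < marg i f (patch J x ⊥) then (1:ℝ) else 0) := by
          split_ifs <;> positivity
        have hpos2 : 0 ≤ M ^ 2
            * (if α * M < -marg i f (patch J x ⊤) then (1:ℝ) else 0) := by
          split_ifs <;> positivity
        have hαM : 0 ≤ α * M := by positivity
        rcases le_total 0 (marg i f x) with h | h
        · rw [abs_of_nonneg h] at hx ⊢
          have := sq_le_of_event h hx (hle1.trans (le_max_left _ 0)) hαM
          linarith
        · rw [abs_of_nonpos h] at hx ⊢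
          have := sq_le_of_event (c := -marg i f (patch J x ⊤)) (neg_nonneg.2 h) hx
            ((neg_le_neg hle2).trans (le_max_left _ 0)) hαM
          rw [neg_sq] at this
          linarith
      rw [bExp_add, bExp_add, bExp_const_mul, bExp_const_mul, bExp_const_mul] at this
      have hM2 : 0 ≤ M ^ 2 := sq_nonneg M
      nlinarith [mul_le_mul_of_nonneg_left ha hM2, mul_le_mul_of_nonneg_left hb hM2]
    refine (Finset.sum_le_sum ht).trans ?_
    rw [Finset.sum_add_distrib, ← Finset.mul_sum, Finset.sum_const, nsmul_eq_mul]
    have hs : ∑ i ∈ V \ J, bExp (1 / 2) (fun x => |marg i f x|) ≤ 4 * M := by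
      refine (Finset.sum_le_univ_sum_of_nonneg fun i => ?_).trans
        ((hf.sum_bExp_abs_marg_le h0).trans ?_)
      · exact bExp_nonneg half_nonneg' half_le_one' fun x => abs_nonneg _
      · have : bExp (1 / 2) f ≤ M :=
          (bExp_mono half_nonneg' half_le_one' hM).trans (bExp_const M).le
        linarith
    have hc : ((V \ J).card : ℝ) ≤ V.card := by
      exact_mod_cast Finset.card_le_card Finset.sdiff_subset
    have hd : (0:ℝ) ≤ 2 * (1 / 2) ^ k * M ^ 2 := by positivity
    have he := mul_le_mul_of_nonneg_left hs (show 0 ≤ α * M by positivity)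
    have hf := mul_le_mul_of_nonneg_right hc hd
    nlinarith
  have hsub : Jᶜ ⊆ Vᶜ ∪ (V \ J) := by
    intro i hi
    simp only [Finset.mem_compl, Finset.mem_union, Finset.mem_sdiff] at hi ⊢
    tauto
  have hES := bExp_sub_cavg_sq_le f J
  have hsum : ∑ i ∈ Jᶜ, bExp (1 / 2) (fun x => marg i f x ^ 2)
      ≤ ∑ i ∈ Vᶜ, bExp (1 / 2) (fun x => marg i f x ^ 2)
        + ∑ i ∈ V \ J, bExp (1 / 2) (fun x => marg i f x ^ 2) := by
    rw [← Finset.sum_union]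
    · exact Finset.sum_le_sum_of_subset_of_nonneg hsub fun i _ _ =>
        bExp_nonneg half_nonneg' half_le_one' fun x => sq_nonneg _
    · rw [Finset.disjoint_left]
      intro i hi hi'
      simp only [Finset.mem_compl] at hi
      exact hi (Finset.mem_sdiff.1 hi').1
  linarith

end Junta

/-! ### Decision trees with a fresh set of queries at each level -/

/-- The set of coordinates queried on input `x` by the decision tree that starts with the set `Z`
and then queries, `R` times, the set `sel` determines from the coordinates queried so far. -/
def runTree {n : ℕ} (sel : Finset (Fin n) → (Fin n → Bool) → Finset (Fin n)) :
    ℕ → Finset (Fin n) → (Fin n → Bool) → Finset (Fin n)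
  | 0, Z, _ => Z
  | R + 1, Z, x => runTree sel R (Z ∪ sel Z x) x

section DecisionTree

variable {n : ℕ} {f : (Fin n → Bool) → ℝ}
  {sel : Finset (Fin n) → (Fin n → Bool) → Finset (Fin n)}

theorem subset_runTree (R : ℕ) (Z : Finset (Fin n)) (x : Fin n → Bool) :
    Z ⊆ runTree sel R Z x := by
  induction R generalizing Z with
  | zero => exact Finset.Subset.rfl
  | succ R ih => exact Finset.subset_union_left.trans (ih _)

/-- Refining a subcube: a random point of the subcube can be drawn by first drawing the
coordinates in a larger set `Z'`. -/
theorem bExp_patch_patch {Z Z' : Finset (Fin n)} (h : Z ⊆ Z') (x : Fin n → Bool)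
    (G : (Fin n → Bool) → ℝ) :
    bExp (1 / 2) (fun w => bExp (1 / 2) (fun y => G (patch Z' (patch Z x w) y)))
      = bExp (1 / 2) (fun y => G (patch Z x y)) := by
  simp only [patch_patch h]
  exact bExp_patch Z' (fun y => G (patch Z x y))

/-- Unfolding one level of the tree in an average over a subcube. -/
theorem bExp_runTree_succ
    (hsel : ∀ Z x y, (∀ i ∈ Z, x i = y i) → sel Z x = sel Z y) (R : ℕ) (Z : Finset (Fin n))
    (x : Fin n → Bool) (F : Finset (Fin n) → (Fin n → Bool) → ℝ) :
    bExp (1 / 2) (fun y => F (runTree sel (R + 1) Z (patch Z x y)) (patch Z x y))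
      = bExp (1 / 2) (fun w => bExp (1 / 2) (fun y =>
          F (runTree sel R (Z ∪ sel Z x) (patch (Z ∪ sel Z x) (patch Z x w) y))
            (patch (Z ∪ sel Z x) (patch Z x w) y))) := by
  rw [bExp_patch_patch (Z := Z) (Z' := Z ∪ sel Z x) Finset.subset_union_left x
    (fun y => F (runTree sel R (Z ∪ sel Z x) y) y)]
  refine bExp_congr fun y => ?_
  have : sel Z (patch Z x y) = sel Z x := hsel _ _ _ fun i hi => by simp [patch, hi]
  simp only [runTree, this]

/-- Averaging over the leaves of a decision tree preserves the mean. -/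
theorem bExp_cavg_runTree
    (hsel : ∀ Z x y, (∀ i ∈ Z, x i = y i) → sel Z x = sel Z y) (R : ℕ) (Z : Finset (Fin n))
    (x : Fin n → Bool) (φ : (Fin n → Bool) → ℝ) :
    bExp (1 / 2) (fun y => cavg (runTree sel R Z (patch Z x y)) φ (patch Z x y))
      = cavg Z φ x := by
  induction R generalizing Z x with
  | zero => simp only [runTree, cavg_patch, bExp_const]
  | succ R ih =>
    rw [bExp_runTree_succ hsel R Z x (fun W y => cavg W φ y)]
    simp only [ih]
    simp only [cavg]
    exact bExp_patch_patch Finset.subset_union_left x φ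

/-- If both `a` and `c` are close to `m`, relative to `m`, then they are close to each other,
relative to `c`. -/
theorem indicator_le_of_dev {a c m η : ℝ} (hm : 0 < m) (hη : 0 < η) (hη1 : η ≤ 1)
    [Decidable (|a - c| ≤ η * c)] :
    (if |a - c| ≤ η * c then (0:ℝ) else 1)
      ≤ 16 / (η ^ 2 * m ^ 2) * ((a - m) ^ 2 + (c - m) ^ 2) := by
  split_ifs with hgood
  · positivity
  · rw [div_mul_eq_mul_div, one_le_div (by positivity)]
    by_contra hcon
    push Not at hcon
    have e1 : (a - m) ^ 2 ≤ (η / 4 * m) ^ 2 := by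
      rw [mul_pow, div_pow]
      linarith [sq_nonneg (c - m)]
    have e2 : (c - m) ^ 2 ≤ (η / 4 * m) ^ 2 := by
      rw [mul_pow, div_pow]
      linarith [sq_nonneg (a - m)]
    have e3 := abs_le.1 (abs_le_of_sq_le_sq e1 (by positivity))
    have e4 := abs_le.1 (abs_le_of_sq_le_sq e2 (by positivity))
    apply hgood
    have e5 : m ≤ 2 * c := by nlinarith
    have e6 : η * m ≤ η * (2 * c) := mul_le_mul_of_nonneg_left e5 hη.le
    rw [abs_le]
    constructor <;> linarith

open Classical in
/-- A decision tree whose levels all explain most of the variance, on the scale of the maximum on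
the respective subcube, ends with high probability in a leaf whose mean is a multiplicative
approximation: with probability at least `1/5` over the queried set the mean does not drop far
below the maximum, so that Chebyshev's inequality applies on this scale. -/
theorem bExp_runTree_bad_le (hf : SubmodularFun f) (h0 : ∀ x, 0 ≤ f x)
    (hsel : ∀ Z x y, (∀ i ∈ Z, x i = y i) → sel Z x = sel Z y) {D T : ℕ}
    (hD : ∀ Z x, (sel Z x).card ≤ D) {β ρ η : ℝ} (hβ : 0 ≤ β) (hρ : 0 < ρ) (hη : 0 < η)
    (hη1 : η ≤ 1)
    (hvar : ∀ Z x M, Z.card + D ≤ T → (∀ y, f (patch Z x y) ≤ M) →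
      bExp (1 / 2) (fun y => (f (patch Z x y)
        - cavg (sel Z x) (fun y => f (patch Z x y)) y) ^ 2) ≤ β * M ^ 2)
    (R : ℕ) (Z : Finset (Fin n)) (x : Fin n → Bool) (hZ : Z.card + R * D ≤ T) :
    bExp (1 / 2) (fun y =>
      if |f (patch Z x y) - cavg (runTree sel R Z (patch Z x y)) f (patch Z x y)|
        ≤ η * cavg (runTree sel R Z (patch Z x y)) f (patch Z x y) then 0 else 1)
      ≤ (4 / 5) ^ R + 5 * (β / ρ + 8192 * ρ / η ^ 2) := by
  set B : Finset (Fin n) → (Fin n → Bool) → ℝ := fun W y =>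
    if |f y - cavg W f y| ≤ η * cavg W f y then 0 else 1 with hB
  have hB0 : ∀ W y, 0 ≤ B W y := fun W y => by simp only [hB]; split_ifs <;> norm_num
  have hB1 : ∀ W y, B W y ≤ 1 := fun W y => by simp only [hB]; split_ifs <;> norm_num
  change bExp (1 / 2) (fun y => B (runTree sel R Z (patch Z x y)) (patch Z x y)) ≤ _
  induction R generalizing Z x with
  | zero =>
    have h := bExp_mono (n := n) (ψ := fun _ => 1) half_nonneg' half_le_one' fun y =>
      hB1 (runTree sel 0 Z (patch Z x y)) (patch Z x y)
    rw [bExp_const] at h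
    have : 0 ≤ 5 * (β / ρ + 8192 * ρ / η ^ 2) := by positivity
    rw [pow_zero]
    linarith
  | succ R ih =>
    set δ : ℝ := β / ρ + 8192 * ρ / η ^ 2 with hδ
    have hδ0 : 0 ≤ δ := by positivity
    obtain ⟨y0, -, hy0⟩ := Finset.exists_max_image Finset.univ (fun y => f (patch Z x y))
      ⟨⊥, Finset.mem_univ _⟩
    have hmax : ∀ y, f (patch Z x y) ≤ f (patch Z x y0) := fun y => hy0 y (Finset.mem_univ _)
    set M := f (patch Z x y0) with hM
    have hM0 : 0 ≤ M := h0 _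
    rcases hM0.eq_or_lt with hMz | hMpos
    · -- on a subcube where `f` vanishes every leaf is exact
      have hz : ∀ y, f (patch Z x y) = 0 := fun y => le_antisymm (hMz ▸ hmax y) (h0 _)
      have hBz : ∀ y, B (runTree sel (R + 1) Z (patch Z x y)) (patch Z x y) = 0 := by
        intro y
        have hc : cavg (runTree sel (R + 1) Z (patch Z x y)) f (patch Z x y) = 0 := by
          simp only [cavg, patch_patch (subset_runTree (R + 1) Z (patch Z x y)), hz, bExp_const]
        simp only [hB]
        rw [hz y, hc]
        simp
      simp only [hBz, bExp_const]
      positivity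
    set Z' := Z ∪ sel Z x with hZ'
    have hZ'card : Z'.card + R * D ≤ T := by
      have h1 : Z'.card ≤ Z.card + (sel Z x).card := Finset.card_union_le Z (sel Z x)
      have h2 := hD Z x
      have h3 : (R + 1) * D = R * D + D := by ring
      omega
    have hv := hvar Z x M (by
      have h3 : (R + 1) * D = R * D + D := by ring
      omega) hmax
    rw [bExp_runTree_succ hsel R Z x B]
    set μ : (Fin n → Bool) → ℝ := fun w => cavg Z' f (patch Z x w) with hμ
    set v : (Fin n → Bool) → ℝ := fun w =>
      bExp (1 / 2) (fun y => (f (patch Z' (patch Z x w) y) - μ w) ^ 2) with hvdef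
    have hv0 : ∀ w, 0 ≤ v w := fun w =>
      bExp_nonneg half_nonneg' half_le_one' fun y => sq_nonneg _
    have hμM : ∀ w, μ w ≤ M := by
      intro w
      simp only [hμ, cavg, hZ', patch_union]
      exact (bExp_mono half_nonneg' half_le_one' fun y => hmax _).trans (bExp_const M).le
    have hμ0 : ∀ w, 0 ≤ μ w := fun w => cavg_nonneg h0 _
    have hEμ : bExp (1 / 2) μ = bExp (1 / 2) (fun y => f (patch Z x y)) :=
      bExp_patch_patch Finset.subset_union_left x f
    have hEv : bExp (1 / 2) v ≤ β * M ^ 2 := by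
      refine le_trans (le_of_eq (Eq.trans ?_ (bExp_patch (sel Z x) _))) hv
      refine bExp_congr fun w => bExp_congr fun y => ?_
      rw [cavg_patch]
      simp only [hμ, cavg, hZ', patch_union]
    have hquarter : M ≤ 4 * bExp (1 / 2) μ := by
      rw [hEμ]
      exact (hf.comp_patch Z x).le_four_mul_bExp (fun y => h0 _) y0
    -- only on the cells in `S`, where the mean drops far below `M`, the next levels are needed
    set S : (Fin n → Bool) → ℝ := fun w => if μ w < M / 16 then 1 else 0 with hS
    have hS0 : ∀ w, 0 ≤ S w := fun w => by simp only [hS]; split_ifs <;> norm_num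
    have hES : bExp (1 / 2) S ≤ 4 / 5 := by
      have h1 : bExp (1 / 2) μ ≤ bExp (1 / 2) (fun w => M - (15 / 16 * M) * S w) := by
        refine bExp_mono half_nonneg' half_le_one' fun w => ?_
        simp only [hS]
        split_ifs with h
        · linarith
        · linarith [hμM w]
      rw [bExp_sub, bExp_const, bExp_const_mul] at h1
      have h2 : M * bExp (1 / 2) S ≤ M * (4 / 5) := by linarith
      exact le_of_mul_le_mul_left h2 hMpos
    set b : ℝ := (4 / 5) ^ R + 5 * δ with hb
    have hb0 : 0 ≤ b := by positivity
    have hpt : ∀ w, bExp (1 / 2) (fun y =>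
        B (runTree sel R Z' (patch Z' (patch Z x w) y)) (patch Z' (patch Z x w) y))
        ≤ b * S w + (1 / (ρ * M ^ 2)) * v w + 8192 * ρ / η ^ 2 := by
      intro w
      have hlast : 0 ≤ 8192 * ρ / η ^ 2 := by positivity
      have hmid : 0 ≤ (1 / (ρ * M ^ 2)) * v w := mul_nonneg (by positivity) (hv0 w)
      by_cases hsmall : μ w < M / 16
      · have h1 := ih Z' (patch Z x w) hZ'card
        have h2 : S w = 1 := by simp only [hS, if_pos hsmall]
        rw [h2]
        linarith
      have h2 : S w = 0 := by simp only [hS, if_neg hsmall]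
      rw [h2, mul_zero, zero_add]
      by_cases hvar' : ρ * M ^ 2 < v w
      · have h1 := bExp_mono (n := n) (ψ := fun _ => 1) half_nonneg' half_le_one' fun y =>
          hB1 (runTree sel R Z' (patch Z' (patch Z x w) y)) (patch Z' (patch Z x w) y)
        rw [bExp_const] at h1
        have h3 : 1 ≤ (1 / (ρ * M ^ 2)) * v w := by
          rw [one_div, ← div_eq_inv_mul, one_le_div (by positivity)]
          exact hvar'.le
        linarith
      push Not at hsmall hvar'
      have hμpos : 0 < μ w := by linarith
      -- a bad point deviates from the mean, or its leaf does
      have h3 : ∀ y, B (runTree sel R Z' (patch Z' (patch Z x w) y)) (patch Z' (patch Z x w) y)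
          ≤ (16 / (η ^ 2 * μ w ^ 2)) * ((f (patch Z' (patch Z x w) y) - μ w) ^ 2
            + cavg (runTree sel R Z' (patch Z' (patch Z x w) y)) (fun u => (f u - μ w) ^ 2)
              (patch Z' (patch Z x w) y)) := by
        intro y
        set u := patch Z' (patch Z x w) y
        set W := runTree sel R Z' u
        have hjens : (cavg W f u - μ w) ^ 2 ≤ cavg W (fun u => (f u - μ w) ^ 2) u := by
          have := sq_bExp_le (n := n) (p := 1 / 2) (φ := fun y => f (patch W u y) - μ w)
            half_nonneg' half_le_one'
          rw [bExp_sub, bExp_const] at this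
          exact this
        have hpos : 0 < 16 / (η ^ 2 * μ w ^ 2) := by positivity
        refine le_trans ?_ (mul_le_mul_of_nonneg_left
          (add_le_add_right hjens ((f u - μ w) ^ 2)) hpos.le)
        exact indicator_le_of_dev hμpos hη hη1
      have h4 := bExp_mono (n := n) half_nonneg' half_le_one' h3
      rw [bExp_const_mul, bExp_add, bExp_cavg_runTree hsel] at h4
      have h5 : cavg Z' (fun u => (f u - μ w) ^ 2) (patch Z x w) = v w := rfl
      have h6 : bExp (1 / 2) (fun y => (f (patch Z' (patch Z x w) y) - μ w) ^ 2) = v w := rfl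
      rw [h5, h6] at h4
      have h7 : 16 / (η ^ 2 * μ w ^ 2) * (v w + v w) ≤ 8192 * ρ / η ^ 2 := by
        have h8 : v w ≤ 256 * ρ * μ w ^ 2 := by
          have : M ^ 2 ≤ (16 * μ w) ^ 2 := pow_le_pow_left₀ hMpos.le (by linarith) 2
          have := mul_le_mul_of_nonneg_left this hρ.le
          linarith
        have h9 : 16 / (η ^ 2 * μ w ^ 2) * (v w + v w)
            ≤ 16 / (η ^ 2 * μ w ^ 2) * (512 * ρ * μ w ^ 2) :=
          mul_le_mul_of_nonneg_left (by linarith) (by positivity)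
        refine h9.trans (le_of_eq ?_)
        field_simp
        norm_num
      linarith
    refine (bExp_mono half_nonneg' half_le_one' hpt).trans ?_
    rw [bExp_add, bExp_add, bExp_const, bExp_const_mul, bExp_const_mul]
    have h1 := mul_le_mul_of_nonneg_left hES hb0
    have h2 : 1 / (ρ * M ^ 2) * bExp (1 / 2) v ≤ β / ρ := by
      rw [one_div_mul_eq_div, div_le_div_iff₀ (by positivity) hρ]
      nlinarith
    rw [pow_succ (4 / 5 : ℝ)]
    rw [hb] at h1 ⊢
    linarith

end DecisionTree

/-! ### Uniform probabilities and a Chernoff bound -/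

section Chernoff

theorem uniformProb_eq {Ω : Type} [Fintype Ω] (A : Ω → Prop) [DecidablePred A] :
    uniformProb A = ((Finset.univ.filter A).card : ℝ) / (Fintype.card Ω : ℝ) := by
  rw [uniformProb]
  congr!

/-- Markov's inequality. -/
theorem uniformProb_le_sum {Ω : Type} [Fintype Ω] {A : Ω → Prop} {ψ : Ω → ℝ} (h0 : ∀ ω, 0 ≤ ψ ω)
    (h : ∀ ω, A ω → 1 ≤ ψ ω) : uniformProb A ≤ (∑ ω, ψ ω) / Fintype.card Ω := by
  classical
  rw [uniformProb]
  refine div_le_div_of_nonneg_right ?_ (Nat.cast_nonneg _)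
  rw [Finset.card_eq_sum_ones, Finset.sum_filter]
  push_cast
  refine Finset.sum_le_sum fun ω _ => ?_
  split_ifs with hω
  · exact h ω hω
  · exact h0 ω

theorem uniformProb_mono {Ω : Type} [Fintype Ω] {A B : Ω → Prop} (h : ∀ ω, A ω → B ω) :
    uniformProb A ≤ uniformProb B := by
  classical
  refine div_le_div_of_nonneg_right ?_ (Nat.cast_nonneg _)
  exact_mod_cast Finset.card_le_card (Finset.monotone_filter_right _ fun ω _ => h ω)

theorem uniformProb_or_le {Ω : Type} [Fintype Ω] (A B : Ω → Prop) :
    uniformProb (fun ω => A ω ∨ B ω) ≤ uniformProb A + uniformProb B := by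
  classical
  rw [uniformProb_eq, uniformProb_eq, uniformProb_eq, ← add_div]
  refine div_le_div_of_nonneg_right ?_ (Nat.cast_nonneg _)
  rw [Finset.filter_or]
  exact_mod_cast Finset.card_union_le _ _

theorem uniformProb_exists_le {Ω ι : Type} [Fintype Ω] [Fintype ι] (A : ι → Ω → Prop) {c : ℝ}
    (h : ∀ i, uniformProb (A i) ≤ c) :
    uniformProb (fun ω => ∃ i, A i ω) ≤ Fintype.card ι * c := by
  classical
  have h1 : uniformProb (fun ω => ∃ i, A i ω) ≤ ∑ i, uniformProb (A i) := by
    simp only [uniformProb_eq]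
    rw [← Finset.sum_div]
    refine div_le_div_of_nonneg_right ?_ (Nat.cast_nonneg _)
    have : (Finset.univ.filter fun ω => ∃ i, A i ω)
        ⊆ Finset.univ.biUnion fun i => Finset.univ.filter (A i) := by
      intro ω hω
      simpa using hω
    have h2 := (Finset.card_le_card this).trans Finset.card_biUnion_le
    have h3 : (((Finset.univ.filter fun ω => ∃ i, A i ω).card : ℕ) : ℝ)
        ≤ ((∑ i, (Finset.univ.filter (A i)).card : ℕ) : ℝ) := by exact_mod_cast h2
    push_cast at h3
    exact h3
  refine h1.trans ((Finset.sum_le_sum fun i _ => h i).trans ?_)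
  rw [Finset.sum_const, nsmul_eq_mul, Finset.card_univ]

theorem one_sub_uniformProb_not_le {Ω : Type} [Fintype Ω] [Nonempty Ω] (A : Ω → Prop) :
    1 - uniformProb (fun ω => ¬ A ω) ≤ uniformProb A := by
  classical
  have h1 : uniformProb (fun ω => A ω ∨ ¬ A ω) ≤ _ := uniformProb_or_le A fun ω => ¬ A ω
  have h2 : uniformProb (fun ω : Ω => A ω ∨ ¬ A ω) = 1 := by
    rw [uniformProb_eq, Finset.filter_true_of_mem fun ω _ => em (A ω), Finset.card_univ]
    exact div_self (Nat.cast_ne_zero.2 Fintype.card_ne_zero)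
  linarith

variable {n m : ℕ}

theorem sum_prod_div_card (g : (Fin n → Bool) → ℝ) :
    (∑ S : Fin m → Fin n → Bool, ∏ i, g (S i)) / Fintype.card (Fin m → Fin n → Bool)
      = bExp (1 / 2) g ^ m := by
  rw [← Fintype.sum_pow]
  simp only [bExp, biasWeight_half, ← Finset.mul_sum, mul_pow]
  simp only [Fintype.card_pi, Fintype.card_bool, Finset.prod_const, Finset.card_univ,
    Fintype.card_fin]
  push_cast
  rw [one_div, inv_pow, inv_pow, div_eq_mul_inv, mul_comm]

/-- Bernstein's bound for the moment generating function of a variable in `[0, B]`. -/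
theorem bExp_exp_le {Y : (Fin n → Bool) → ℝ} {B s : ℝ} (h0 : ∀ x, 0 ≤ Y x) (hB : ∀ x, Y x ≤ B)
    (hs : |s| * B ≤ 1) :
    bExp (1 / 2) (fun x => Real.exp (s * Y x))
      ≤ Real.exp (s * bExp (1 / 2) Y + s ^ 2 * B * bExp (1 / 2) Y) := by
  have h1 : bExp (1 / 2) (fun x => Real.exp (s * Y x))
      ≤ bExp (1 / 2) (fun x => 1 + (s * Y x + s ^ 2 * B * Y x)) := by
    refine bExp_mono half_nonneg' half_le_one' fun x => ?_
    have ha : |s * Y x| ≤ 1 := by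
      rw [abs_mul, abs_of_nonneg (h0 x)]
      exact (mul_le_mul_of_nonneg_left (hB x) (abs_nonneg s)).trans hs
    have hb := (abs_le.1 (Real.abs_exp_sub_one_sub_id_le ha)).2
    have hc : (s * Y x) ^ 2 ≤ s ^ 2 * B * Y x := by
      have := mul_le_mul_of_nonneg_right (hB x) (h0 x)
      have := mul_le_mul_of_nonneg_left this (sq_nonneg s)
      linarith
    linarith
  rw [bExp_add, bExp_const, bExp_add, bExp_const_mul, bExp_const_mul] at h1
  refine h1.trans ?_
  have := Real.add_one_le_exp (s * bExp (1 / 2) Y + s ^ 2 * B * bExp (1 / 2) Y)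
  linarith

/-- One-sided exponential moment bound for the sum of `m` independent copies. -/
theorem uniformProb_lt_sum_le {Y : (Fin n → Bool) → ℝ} {B s c : ℝ} (h0 : ∀ x, 0 ≤ Y x)
    (hB : ∀ x, Y x ≤ B) (hs : |s| * B ≤ 1) :
    uniformProb (fun S : Fin m → Fin n → Bool => c < s * ∑ i, Y (S i))
      ≤ Real.exp (m * (s * bExp (1 / 2) Y + s ^ 2 * B * bExp (1 / 2) Y) - c) := by
  have h1 := uniformProb_le_sum (A := fun S : Fin m → Fin n → Bool => c < s * ∑ i, Y (S i))
    (ψ := fun S => Real.exp (-c) * ∏ i, Real.exp (s * Y (S i)))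
    (fun S => mul_nonneg (Real.exp_pos _).le (Finset.prod_nonneg fun i _ => (Real.exp_pos _).le))
    (fun S hS => by
      rw [← Real.exp_sum, ← Finset.mul_sum, ← Real.exp_add]
      exact Real.one_le_exp (by linarith))
  refine h1.trans ?_
  rw [← Finset.mul_sum, mul_div_assoc,
    sum_prod_div_card (fun x => Real.exp (s * Y x))]
  have h2 := pow_le_pow_left₀ (bExp_nonneg half_nonneg' half_le_one' fun x =>
    (Real.exp_pos _).le) (bExp_exp_le h0 hB hs) m
  rw [← Real.exp_nat_mul] at h2
  refine (mul_le_mul_of_nonneg_left h2 (Real.exp_pos _).le).trans (le_of_eq ?_)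
  rw [← Real.exp_add]
  congr 1
  ring

/-- Multiplicative Chernoff bound. -/
theorem uniformProb_chernoff {Y : (Fin n → Bool) → ℝ} {B τ : ℝ} (h0 : ∀ x, 0 ≤ Y x)
    (hBpos : 0 < B) (hB : ∀ x, Y x ≤ B) (hτ : 0 < τ) (hτ1 : τ ≤ 1) :
    uniformProb (fun S : Fin m → Fin n → Bool =>
        ¬ |∑ i, Y (S i) - m * bExp (1 / 2) Y| ≤ τ * (m * bExp (1 / 2) Y))
      ≤ 2 * Real.exp (-(m * bExp (1 / 2) Y * τ ^ 2 / (4 * B))) := by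
  set ν := bExp (1 / 2) Y with hν
  set s := τ / (2 * B) with hs
  have hspos : 0 < s := by positivity
  have hsB : s * B ≤ 1 := by
    have : s * B = τ / 2 := by rw [hs]; field_simp
    rw [this]; linarith
  have hup := uniformProb_lt_sum_le (m := m) (c := s * ((1 + τ) * (m * ν))) (s := s) h0 hB
    (by rwa [abs_of_pos hspos])
  have hdn := uniformProb_lt_sum_le (m := m) (c := -s * ((1 - τ) * (m * ν))) (s := -s) h0 hB
    (by rwa [abs_neg, abs_of_pos hspos])
  have e1 : m * (s * ν + s ^ 2 * B * ν) - s * ((1 + τ) * (m * ν))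
      = -(m * ν * τ ^ 2 / (4 * B)) := by
    rw [hs]; field_simp; ring
  have e2 : m * (-s * ν + (-s) ^ 2 * B * ν) - -s * ((1 - τ) * (m * ν))
      = -(m * ν * τ ^ 2 / (4 * B)) := by
    rw [hs]; field_simp; ring
  rw [← hν, e1] at hup
  rw [← hν, e2] at hdn
  refine (uniformProb_mono (B := fun S : Fin m → Fin n → Bool =>
    (s * ((1 + τ) * (m * ν)) < s * ∑ i, Y (S i))
      ∨ (-s * ((1 - τ) * (m * ν)) < -s * ∑ i, Y (S i))) fun S hS => ?_).trans
    ((uniformProb_or_le _ _).trans (by linarith))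
  rw [abs_le, not_and_or, not_le, not_le] at hS
  rcases hS with hS | hS
  · right
    have := mul_lt_mul_of_pos_left hS hspos
    nlinarith
  · left
    exact mul_lt_mul_of_pos_left (by linarith) hspos

end Chernoff

/-! ### Samples that represent all small subcubes -/

section Sampling

variable {n m : ℕ} {f φ : (Fin n → Bool) → ℝ}

/-- `φ` on the subcube of the points that agree with `u` on `W`, and zero elsewhere. -/
def onCell (W : Finset (Fin n)) (u : Fin n → Bool) (φ : (Fin n → Bool) → ℝ)
    (x : Fin n → Bool) : ℝ :=
  if ∀ j ∈ W, x j = u j then φ x else 0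

/-- On each of the subcubes that fix the coordinates in `W`, the sum of `φ` over the sample is
within a relative error `τ` of its expectation. -/
def Accurate (τ : ℝ) (S : Fin m → Fin n → Bool) (φ : (Fin n → Bool) → ℝ)
    (W : Finset (Fin n)) : Prop :=
  ∀ u, |∑ i, onCell W u φ (S i) - m * bExp (1 / 2) (onCell W u φ)|
    ≤ τ * (m * bExp (1 / 2) (onCell W u φ))

theorem bExp_agree (W : Finset (Fin n)) (x : Fin n → Bool) :
    bExp (1 / 2) (fun u => if ∀ j ∈ W, x j = u j then (1:ℝ) else 0) = (1 / 2) ^ W.card := by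
  have h := bExp_prod (n := n) (p := 1 / 2)
    (fun j b => if j ∈ W then (if x j = b then (1:ℝ) else 0) else 1)
  have e : ∀ u : Fin n → Bool, (if ∀ j ∈ W, x j = u j then (1:ℝ) else 0)
      = ∏ j, if j ∈ W then (if x j = u j then (1:ℝ) else 0) else 1 := by
    intro u
    split_ifs with hu
    · symm
      refine Finset.prod_eq_one fun j _ => ?_
      split_ifs with h1 h2
      · rfl
      · exact absurd (hu j h1) h2
      · rfl
    · push Not at hu
      obtain ⟨j, hj, hne⟩ := hu
      symm
      exact Finset.prod_eq_zero (Finset.mem_univ j) (by simp [hj, hne])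
  rw [bExp_congr e, h, ← Finset.prod_const, ← Finset.prod_filter_mul_prod_filter_not
    Finset.univ (· ∈ W)]
  rw [Finset.filter_mem_eq_inter, Finset.univ_inter]
  rw [Finset.prod_congr rfl (g := fun _ => (1 / 2 : ℝ)), Finset.prod_congr (s₂ :=
    Finset.univ.filter fun j => j ∉ W) rfl (g := fun _ => (1 : ℝ))]
  · simp
  · intro j hj
    simp only [Finset.mem_filter] at hj
    simp [hj.2]
  · intro j hj
    cases x j <;> simp [hj]
    all_goals norm_num

theorem bExp_onCell (W : Finset (Fin n)) (u : Fin n → Bool) (φ : (Fin n → Bool) → ℝ) :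
    bExp (1 / 2) (onCell W u φ) = (1 / 2) ^ W.card * cavg W φ u := by
  have h := bExp_mul_cavg (J := W) (f := φ)
    (Φ := fun x => if ∀ j ∈ W, u j = x j then (1:ℝ) else 0) (fun x y hxy => by
      have : (∀ j ∈ W, u j = x j) ↔ ∀ j ∈ W, u j = y j :=
        forall₂_congr fun j hj => by rw [hxy j hj]
      simp only [this])
  have e1 : ∀ x, onCell W u φ x = φ x * (if ∀ j ∈ W, u j = x j then (1:ℝ) else 0) := by
    intro x
    simp only [onCell, eq_comm (a := x _), mul_ite, mul_one, mul_zero]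
  have e2 : ∀ x, cavg W φ x * (if ∀ j ∈ W, u j = x j then (1:ℝ) else 0)
      = cavg W φ u * (if ∀ j ∈ W, u j = x j then (1:ℝ) else 0) := by
    intro x
    split_ifs with hx
    · rw [cavg_congr hx]
    · simp
  rw [bExp_congr e1, h, bExp_congr e2, bExp_const_mul, bExp_agree, mul_comm]

/-- On an accurate sample, sums of `φ` against a function of the coordinates in `W` are close to
their expectations. The function is written as an average over the cells of `W`. -/
theorem Accurate.sum_mul {τ : ℝ} {S : Fin m → Fin n → Bool} {W : Finset (Fin n)}
    (h : Accurate τ S φ W) {Φ : (Fin n → Bool) → ℝ}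
    (hΦ : ∀ x y, (∀ j ∈ W, x j = y j) → Φ x = Φ y) :
    |∑ i, φ (S i) * Φ (S i) - m * bExp (1 / 2) (fun x => φ x * Φ x)|
      ≤ τ * (m * bExp (1 / 2) (fun x => φ x * |Φ x|)) := by
  have hpow : ((1:ℝ) / 2) ^ W.card * 2 ^ W.card = 1 := by
    rw [← mul_pow]; norm_num
  have key : ∀ Ψ : (Fin n → Bool) → ℝ, (∀ x y, (∀ j ∈ W, x j = y j) → Ψ x = Ψ y) →
      ∀ x, φ x * Ψ x = 2 ^ W.card * bExp (1 / 2) (fun u => Ψ u * onCell W u φ x) := by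
    intro Ψ hΨ x
    have : ∀ u, Ψ u * onCell W u φ x
        = (φ x * Ψ x) * (if ∀ j ∈ W, x j = u j then (1:ℝ) else 0) := by
      intro u
      rw [onCell]
      split_ifs with hu
      · rw [hΨ x u hu]; ring
      · simp
    rw [bExp_congr this, bExp_const_mul, bExp_agree]
    linear_combination (-(φ x * Ψ x)) * hpow
  have swap : ∀ Ψ : (Fin n → Bool) → ℝ, (∀ x y, (∀ j ∈ W, x j = y j) → Ψ x = Ψ y) →
      bExp (1 / 2) (fun x => φ x * Ψ x)
        = 2 ^ W.card * bExp (1 / 2) (fun u => Ψ u * bExp (1 / 2) (onCell W u φ)) := by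
    intro Ψ hΨ
    rw [bExp_congr (key Ψ hΨ), bExp_const_mul]
    congr 1
    simp only [← bExp_const_mul]
    simp only [bExp, Finset.mul_sum]
    rw [Finset.sum_comm]
    refine Finset.sum_congr rfl fun x _ => Finset.sum_congr rfl fun y _ => ?_
    ring
  have habs : ∀ x y : Fin n → Bool, (∀ j ∈ W, x j = y j) → |Φ x| = |Φ y| :=
    fun x y hxy => by rw [hΦ x y hxy]
  have hsum : ∑ i, φ (S i) * Φ (S i)
      = 2 ^ W.card * bExp (1 / 2) (fun u => Φ u * ∑ i, onCell W u φ (S i)) := by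
    simp only [key Φ hΦ, ← Finset.mul_sum, ← bExp_sum]
  rw [hsum, swap Φ hΦ, swap (fun x => |Φ x|) habs]
  have e : (2:ℝ) ^ W.card * bExp (1 / 2) (fun u => Φ u * ∑ i, onCell W u φ (S i))
      - m * (2 ^ W.card * bExp (1 / 2) (fun u => Φ u * bExp (1 / 2) (onCell W u φ)))
      = 2 ^ W.card * bExp (1 / 2) (fun u => Φ u * (∑ i, onCell W u φ (S i)
        - m * bExp (1 / 2) (onCell W u φ))) := by
    have : ∀ u, Φ u * (∑ i, onCell W u φ (S i) - m * bExp (1 / 2) (onCell W u φ))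
        = Φ u * ∑ i, onCell W u φ (S i) - m * (Φ u * bExp (1 / 2) (onCell W u φ)) :=
      fun u => by ring
    rw [bExp_congr this, bExp_sub, bExp_const_mul]
    ring
  rw [e, abs_mul, abs_of_pos (by positivity : (0:ℝ) < 2 ^ W.card)]
  have habs2 : |bExp (1 / 2) (fun u => Φ u * (∑ i, onCell W u φ (S i)
        - m * bExp (1 / 2) (onCell W u φ)))|
      ≤ bExp (1 / 2) (fun u => τ * m * (|Φ u| * bExp (1 / 2) (onCell W u φ))) := by
    have hpt : ∀ u, |Φ u * (∑ i, onCell W u φ (S i) - m * bExp (1 / 2) (onCell W u φ))|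
        ≤ τ * m * (|Φ u| * bExp (1 / 2) (onCell W u φ)) := by
      intro u
      rw [abs_mul]
      calc _ ≤ |Φ u| * (τ * (m * bExp (1 / 2) (onCell W u φ))) :=
            mul_le_mul_of_nonneg_left (h u) (abs_nonneg _)
        _ = _ := by ring
    rw [abs_le, ← bExp_neg]
    exact ⟨bExp_mono half_nonneg' half_le_one' fun u => neg_le_of_abs_le (hpt u),
      bExp_mono half_nonneg' half_le_one' fun u => (le_abs_self _).trans (hpt u)⟩
  rw [bExp_const_mul] at habs2
  calc _ ≤ 2 ^ W.card * (τ * m * bExp (1 / 2) fun u => |Φ u| * bExp (1 / 2) (onCell W u φ)) :=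
        mul_le_mul_of_nonneg_left habs2 (by positivity)
    _ = _ := by ring

/-- A sample is representative if it is accurate for counting points and for summing `f`, on all
subcubes that fix between `1` and `t` coordinates. -/
def Representative (τ : ℝ) (t : ℕ) (f : (Fin n → Bool) → ℝ) (S : Fin m → Fin n → Bool) : Prop :=
  ∀ W : Finset (Fin n), W.Nonempty → W.card ≤ t →
    Accurate τ S (fun _ => 1) W ∧ Accurate τ S f W

/-- Chernoff's bound on one subcube. Hypothesis `h4`, which is `SubmodularFun.le_four_mul_cavg` for
submodular functions, makes the bound independent of the range of `φ`. -/
theorem uniformProb_cell_le (h0 : ∀ x, 0 ≤ φ x) (W : Finset (Fin n)) (u : Fin n → Bool)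
    (h4 : ∀ x, (∀ j ∈ W, x j = u j) → φ x ≤ 4 * cavg W φ u) {t : ℕ} (hW : W.card ≤ t) {τ : ℝ}
    (hτ : 0 < τ) (hτ1 : τ ≤ 1) :
    uniformProb (fun S : Fin m → Fin n → Bool =>
      ¬ |∑ i, onCell W u φ (S i) - m * bExp (1 / 2) (onCell W u φ)|
        ≤ τ * (m * bExp (1 / 2) (onCell W u φ)))
      ≤ 2 * Real.exp (-(m * τ ^ 2 * (1 / 2) ^ t / 16)) := by
  have hc0 : 0 ≤ cavg W φ u := cavg_nonneg h0 u
  have hY0 : ∀ x, 0 ≤ onCell W u φ x := fun x => by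
    rw [onCell]; split_ifs; exacts [h0 x, le_rfl]
  have hY4 : ∀ x, onCell W u φ x ≤ 4 * cavg W φ u := fun x => by
    rw [onCell]
    split_ifs with hx
    · exact h4 x hx
    · linarith
  rcases hc0.eq_or_lt with hc | hc
  · have hz : ∀ x, onCell W u φ x = 0 := fun x => le_antisymm (by
      have := hY4 x; rwa [← hc, mul_zero] at this) (hY0 x)
    have hz' : bExp (1 / 2) (onCell W u φ) = 0 := by rw [bExp_onCell, ← hc, mul_zero]
    have : uniformProb (fun S : Fin m → Fin n → Bool =>
      ¬ |∑ i, onCell W u φ (S i) - m * bExp (1 / 2) (onCell W u φ)|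
        ≤ τ * (m * bExp (1 / 2) (onCell W u φ))) = 0 := by
      rw [hz']
      simp [hz, uniformProb]
    rw [this]
    positivity
  · refine (uniformProb_chernoff hY0 (B := 4 * cavg W φ u) (by positivity) hY4 hτ hτ1).trans ?_
    refine mul_le_mul_of_nonneg_left (Real.exp_le_exp.2 (neg_le_neg ?_)) (by norm_num)
    rw [bExp_onCell]
    have h1 : ((1:ℝ) / 2) ^ t ≤ (1 / 2) ^ W.card :=
      pow_le_pow_of_le_one (by norm_num) (by norm_num) hW
    have e : m * ((1 / 2) ^ W.card * cavg W φ u) * τ ^ 2 / (4 * (4 * cavg W φ u))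
        = m * τ ^ 2 * (1 / 2) ^ W.card / 16 := by
      field_simp; ring
    rw [e]
    gcongr

theorem SubmodularFun.le_four_mul_cavg (hf : SubmodularFun f) (h0 : ∀ x, 0 ≤ f x)
    (W : Finset (Fin n)) (u x : Fin n → Bool) (hx : ∀ j ∈ W, x j = u j) :
    f x ≤ 4 * cavg W f u := by
  have h := (hf.comp_patch W u).le_four_mul_bExp (fun y => h0 _) x
  have e : patch W u x = x := by
    rw [← patch_congr hx, patch_self]
  simp only [e] at h
  exact h

/-- Most samples are representative: Chernoff's bound and a union bound over the
`(2n)ᵗ` descriptions of a subcube. -/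
theorem uniformProb_not_representative_le (hf : SubmodularFun f) (h0 : ∀ x, 0 ≤ f x) {τ : ℝ}
    (hτ : 0 < τ) (hτ1 : τ ≤ 1) (t : ℕ)
    (hm : 12 * (2 * n : ℝ) ^ t ≤ Real.exp (m * τ ^ 2 * (1 / 2) ^ t / 16)) :
    uniformProb (fun S : Fin m → Fin n → Bool => ¬ Representative τ t f S) ≤ 1 / 3 := by
  classical
  set bad : ((Fin n → Bool) → ℝ) → ((Fin t → Fin n) × (Fin t → Bool)) →
      (Fin m → Fin n → Bool) → Prop := fun φ c S =>
    ∃ u : Fin n → Bool, (∀ k, u (c.1 k) = c.2 k) ∧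
      ¬ |∑ i, onCell (Finset.univ.image c.1) u φ (S i)
          - m * bExp (1 / 2) (onCell (Finset.univ.image c.1) u φ)|
        ≤ τ * (m * bExp (1 / 2) (onCell (Finset.univ.image c.1) u φ)) with hbad
  have hbound : ∀ φ : (Fin n → Bool) → ℝ, (∀ x, 0 ≤ φ x) →
      (∀ W u x, (∀ j ∈ W, x j = u j) → φ x ≤ 4 * cavg W φ u) →
      uniformProb (fun S => ∃ c, bad φ c S)
        ≤ (2 * n : ℝ) ^ t * (2 * Real.exp (-(m * τ ^ 2 * (1 / 2) ^ t / 16))) := by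
    intro φ hφ h4
    refine (uniformProb_exists_le (bad φ)
      (c := 2 * Real.exp (-(m * τ ^ 2 * (1 / 2) ^ t / 16))) fun c => ?_).trans (le_of_eq ?_)
    · by_cases hc : ∃ u : Fin n → Bool, ∀ k, u (c.1 k) = c.2 k
      · obtain ⟨u, hu⟩ := hc
        refine (uniformProb_mono fun S hS => ?_).trans
          (uniformProb_cell_le hφ (Finset.univ.image c.1) u (h4 _ u) (t := t)
            (Finset.card_image_le.trans (by simp)) hτ hτ1)
        obtain ⟨u', hu', hS⟩ := hS
        have e : onCell (Finset.univ.image c.1) u' φ = onCell (Finset.univ.image c.1) u φ := by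
          ext x
          simp [onCell, hu, hu']
        rwa [e] at hS
      · have : uniformProb (bad φ c) = 0 := by
          have : ∀ S, ¬ bad φ c S := fun S hS => hc ⟨hS.choose, hS.choose_spec.1⟩
          simp [uniformProb, this]
        rw [this]
        positivity
    · simp only [Fintype.card_prod, Fintype.card_pi, Fintype.card_fin, Fintype.card_bool,
        Finset.prod_const, Finset.card_univ]
      push_cast
      rw [mul_pow]
      ring
  have h1 := hbound (fun _ => 1) (fun _ => zero_le_one) (fun W u x _ => by
    rw [cavg, bExp_const]; norm_num)
  have h2 := hbound f h0 fun W u x hx => hf.le_four_mul_cavg h0 W u x hx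
  refine (uniformProb_mono (B := fun S => (∃ c, bad (fun _ => 1) c S) ∨ ∃ c, bad f c S)
    fun S hS => ?_).trans ((uniformProb_or_le _ _).trans ((add_le_add h1 h2).trans ?_))
  · simp only [Representative, not_forall] at hS
    obtain ⟨W, hW, hWt, hS⟩ := hS
    have hι : ∃ ι : Fin t → Fin n, Finset.univ.image ι = W := by
      obtain ⟨w, hw⟩ := hW
      refine ⟨fun k => if h : k.val < W.card then W.orderEmbOfFin rfl ⟨k, h⟩ else w, ?_⟩
      ext j
      simp only [Finset.mem_image, Finset.mem_univ, true_and]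
      constructor
      · rintro ⟨k, rfl⟩
        split_ifs
        · exact Finset.orderEmbOfFin_mem _ _ _
        · exact hw
      · intro hj
        have : j ∈ Set.range (W.orderEmbOfFin rfl) := by
          rw [Finset.range_orderEmbOfFin]; exact hj
        obtain ⟨k, rfl⟩ := this
        exact ⟨⟨k, k.2.trans_le hWt⟩, by simp⟩
    obtain ⟨ι, rfl⟩ := hι
    rw [not_and_or] at hS
    refine hS.imp (fun h => ?_) (fun h => ?_) <;>
    · rw [Accurate, not_forall] at h
      obtain ⟨u, hu⟩ := h
      exact ⟨(ι, fun k => u (ι k)), u, fun k => rfl, hu⟩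
  · set X := m * τ ^ 2 * (1 / 2) ^ t / 16
    have h3 : Real.exp (-X) * Real.exp X = 1 := by rw [← Real.exp_add]; simp
    have h4 := mul_le_mul_of_nonneg_left hm (Real.exp_pos (-X)).le
    rw [h3] at h4
    linarith

end Sampling

/-! ### The learning algorithm as a function -/

section Algorithm

/-- The sum of the labels of the active examples. -/
noncomputable def activeSum (lb : ℕ → ℝ) (m : ℕ) (act : ℕ → ℕ) : ℝ :=
  ∑ s ∈ Finset.range m, if act s = 1 then lb s else 0

/-- The sum of the labels of the active examples, with a negative sign where the bits `i` and `j`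
of the example differ. -/
noncomputable def corrSum (bits : ℕ → ℕ → ℕ) (lb : ℕ → ℝ) (m : ℕ) (act : ℕ → ℕ) (i j : ℕ) : ℝ :=
  ∑ s ∈ Finset.range m,
    if act s = 1 then (if bits s i = bits s j then lb s else -lb s) else 0

/-- Coordinate `i` is detected if it has a noticeable empirical correlation with the labels, alone
(`j = n`, where all examples have the additional bit `0`) or together with a coordinate `j`. -/
def Detected (bits : ℕ → ℕ → ℕ) (lb : ℕ → ℝ) (m n N : ℕ) (act : ℕ → ℕ) (i : ℕ) : Prop :=
  ∃ j < n + 1, j ≠ i ∧ (activeSum lb m act < N * corrSum bits lb m act i j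
    ∨ activeSum lb m act < N * -corrSum bits lb m act i j)

open Classical in
/-- The detected coordinates below `k`. -/
noncomputable def detectedList (bits : ℕ → ℕ → ℕ) (lb : ℕ → ℝ) (m n N : ℕ) (act : ℕ → ℕ) (k : ℕ) :
    List ℕ :=
  (List.range k).filter fun i => Detected bits lb m n N act i

/-- The `D` coordinates with code `c`: the digits of `c` in base `K` are positions in the list of
detected coordinates. -/
noncomputable def tuple (bits : ℕ → ℕ → ℕ) (lb : ℕ → ℝ) (m n N K D : ℕ) (act : ℕ → ℕ) (c : ℕ) :
    List ℕ :=
  (List.range D).map fun p => (detectedList bits lb m n N act n).getD (c / K ^ p % K) 0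

/-- The sum of the labels of the active examples that agree with example `s` on `J`. -/
noncomputable def groupSum (bits : ℕ → ℕ → ℕ) (lb : ℕ → ℝ) (m : ℕ) (act : ℕ → ℕ) (J : List ℕ)
    (s : ℕ) : ℝ :=
  ∑ s' ∈ Finset.range m, if act s' = 1 ∧ ∀ i ∈ J, bits s' i = bits s i then lb s' else 0

/-- The number of active examples that agree with example `s` on `J`. -/
noncomputable def groupCount (bits : ℕ → ℕ → ℕ) (m : ℕ) (act : ℕ → ℕ) (J : List ℕ) (s : ℕ) : ℝ :=
  groupSum bits (fun _ => 1) m act J s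

/-- The empirical second moment of the conditional mean given the coordinates in `J`, as a sum over
the active examples that is not divided by their number. -/
noncomputable def energy (bits : ℕ → ℕ → ℕ) (lb : ℕ → ℝ) (m : ℕ) (act : ℕ → ℕ) (J : List ℕ) : ℝ :=
  ∑ s ∈ Finset.range m,
    if act s = 1 then
      groupSum bits lb m act J s / groupCount bits m act J s
        * (groupSum bits lb m act J s / groupCount bits m act J s)
    else 0

open Classical in
/-- The first position below `k` at which `e` takes its maximum. -/
noncomputable def argmax (e : ℕ → ℝ) : ℕ → ℕ
  | 0 => 0
  | k + 1 => if e (argmax e k) < e k then k else argmax e k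

/-- The coordinates that are queried next: among all tuples of detected coordinates, one of the
largest energy. -/
noncomputable def selected (bits : ℕ → ℕ → ℕ) (lb : ℕ → ℝ) (m n N K D : ℕ) (act : ℕ → ℕ) :
    List ℕ :=
  tuple bits lb m n N K D act
    (argmax (fun c => energy bits lb m act (tuple bits lb m n N K D act c)) (K ^ D))

/-- The indicator of the examples that agree with `x` on `l`. -/
def active (bits : ℕ → ℕ → ℕ) (x : ℕ → ℕ) (l : List ℕ) (s : ℕ) : ℕ :=
  if ∀ i ∈ l, bits s i = x i then 1 else 0

/-- The coordinates of `x` that have been queried after `r` rounds. -/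
noncomputable def queried (bits : ℕ → ℕ → ℕ) (lb : ℕ → ℝ) (m n N K D : ℕ) (x : ℕ → ℕ) :
    ℕ → List ℕ
  | 0 => []
  | r + 1 => queried bits lb m n N K D x r
      ++ selected bits lb m n N K D (active bits x (queried bits lb m n N K D x r))

/-- The prediction at `x`: the mean label of the examples that agree with `x` on all queried
coordinates, raised so that it is an upper bound with high probability. -/
noncomputable def prediction (bits : ℕ → ℕ → ℕ) (lb : ℕ → ℝ) (m n N K D R : ℕ) (γ : ℝ)
    (x : ℕ → ℕ) : ℝ :=
  (1 + γ / 4) * (activeSum lb m (active bits x (queried bits lb m n N K D x R))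
    / activeSum (fun _ => 1) m (active bits x (queried bits lb m n N K D x R)))

theorem argmax_spec (e : ℕ → ℝ) (k : ℕ) :
    (∀ c < k, e c ≤ e (argmax e k)) ∧ (0 < k → argmax e k < k) := by
  induction k with
  | zero => simp
  | succ k ih =>
    rw [argmax]
    split_ifs with h
    · refine ⟨fun c hc => ?_, fun _ => by omega⟩
      rcases Nat.lt_succ_iff_lt_or_eq.1 hc with hc | rfl
      · exact (ih.1 c hc).trans h.le
      · exact le_rfl
    · push Not at h
      refine ⟨fun c hc => ?_, fun _ => ?_⟩
      · rcases Nat.lt_succ_iff_lt_or_eq.1 hc with hc | rfl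
        · exact ih.1 c hc
        · exact h
      · rcases Nat.eq_zero_or_pos k with rfl | hk
        · simp [argmax]
        · exact (ih.2 hk).trans (Nat.lt_succ_self _)

theorem exists_digits (K : ℕ) (hK : 0 < K) (D : ℕ) (d : ℕ → ℕ) (hd : ∀ p, d p < K) :
    ∃ c < K ^ D, ∀ p < D, c / K ^ p % K = d p := by
  induction D generalizing d with
  | zero => exact ⟨0, by simp, by simp⟩
  | succ D ih =>
    obtain ⟨c, hc, hcd⟩ := ih (fun p => d (p + 1)) fun p => hd _
    refine ⟨d 0 + K * c, ?_, fun p hp => ?_⟩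
    · rw [pow_succ']
      have h0 := hd 0
      have : K * (c + 1) ≤ K * K ^ D := Nat.mul_le_mul_left _ hc
      rw [mul_add, mul_one] at this
      omega
    · cases p with
      | zero => simp [Nat.mod_eq_of_lt (hd 0)]
      | succ p =>
        rw [pow_succ', ← Nat.div_div_eq_div_mul, Nat.add_mul_div_left _ _ hK,
          Nat.div_eq_of_lt (hd 0), zero_add]
        exact hcd p (by omega)

theorem mem_detectedList {bits : ℕ → ℕ → ℕ} {lb : ℕ → ℝ} {m n N : ℕ} {act : ℕ → ℕ} {k i : ℕ} :
    i ∈ detectedList bits lb m n N act k ↔ i < k ∧ Detected bits lb m n N act i := by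
  simp [detectedList]

theorem exists_tuple {bits : ℕ → ℕ → ℕ} {lb : ℕ → ℝ} {m n N K D : ℕ} {act : ℕ → ℕ} (hK : 0 < K)
    (hlen : (detectedList bits lb m n N act n).length ≤ K) (J : List ℕ) (hJD : J.length ≤ D)
    (hJ : ∀ i ∈ J, i ∈ detectedList bits lb m n N act n) :
    ∃ c < K ^ D, ∀ i ∈ J, i ∈ tuple bits lb m n N K D act c := by
  set L := detectedList bits lb m n N act n with hL
  obtain ⟨c, hc, hcd⟩ := exists_digits K hK D
    (fun p => if L.idxOf (J.getD p 0) < K then L.idxOf (J.getD p 0) else 0) (fun p => by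
      split_ifs with h; exacts [h, hK])
  refine ⟨c, hc, fun i hi => ?_⟩
  obtain ⟨p, hp, rfl⟩ := List.mem_iff_getElem.1 hi
  rw [tuple, List.mem_map]
  refine ⟨p, by simp; omega, ?_⟩
  rw [hcd p (by omega)]
  have e : J.getD p 0 = J[p] := by simp [hp]
  have hmem := hJ _ hi
  have hlt := List.idxOf_lt_length_iff.2 hmem
  rw [e, if_pos (hlt.trans_le hlen), ← hL]
  rw [List.getD_eq_getElem _ _ hlt, List.getElem_idxOf]

theorem tuple_lt {bits : ℕ → ℕ → ℕ} {lb : ℕ → ℝ} {m n N K D : ℕ} {act : ℕ → ℕ} (hn : 0 < n)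
    {c i : ℕ} (hi : i ∈ tuple bits lb m n N K D act c) : i < n := by
  rw [tuple, List.mem_map] at hi
  obtain ⟨p, -, rfl⟩ := hi
  rw [List.getD_eq_getElem?_getD]
  cases h : (detectedList bits lb m n N act n)[c / K ^ p % K]? with
  | none => simpa
  | some i =>
    have := List.mem_of_getElem? h
    simpa using (mem_detectedList.1 this).1

end Algorithm

/-! ### Empirical statistics of a representative sample -/

/-- Bit `i` of the point `u`, as a number; the bits from position `n` on are zero. -/
def bitVal {n : ℕ} (u : Fin n → Bool) (i : ℕ) : ℕ :=
  if h : i < n then (u ⟨i, h⟩).toNat else 0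

/-- The character `1` or `-1` according to whether bits `i` and `j` agree. -/
def parity {n : ℕ} (i j : ℕ) (u : Fin n → Bool) : ℝ :=
  if bitVal u i = bitVal u j then 1 else -1

/-- The coordinates in the list `l`. -/
def toCoords (n : ℕ) (l : List ℕ) : Finset (Fin n) :=
  Finset.univ.filter fun j => j.val ∈ l

section Statistics

variable {n m : ℕ} {f : (Fin n → Bool) → ℝ}

theorem bitVal_lt_two (u : Fin n → Bool) (i : ℕ) : bitVal u i < 2 := by
  rw [bitVal]
  split_ifs with h
  · exact Bool.toNat_lt _
  · norm_num

theorem bitVal_fin (u : Fin n → Bool) (i : Fin n) : bitVal u i = (u i).toNat := by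
  simp [bitVal]

theorem bitVal_eq_iff (u v : Fin n → Bool) (i : Fin n) : bitVal u i = bitVal v i ↔ u i = v i := by
  rw [bitVal_fin, bitVal_fin]
  cases u i <;> cases v i <;> simp

theorem bitVal_congr {u v : Fin n → Bool} {i : ℕ} (h : ∀ j : Fin n, j.val = i → u j = v j) :
    bitVal u i = bitVal v i := by
  rw [bitVal, bitVal]
  split_ifs with hi
  · rw [h ⟨i, hi⟩ rfl]
  · rfl

theorem forall_toCoords {l : List ℕ} (hl : ∀ i ∈ l, i < n) (u v : Fin n → Bool) :
    (∀ i ∈ l, bitVal u i = bitVal v i) ↔ ∀ j ∈ toCoords n l, u j = v j := by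
  constructor
  · intro h j hj
    exact (bitVal_eq_iff u v j).1 (h j (by simpa [toCoords] using hj))
  · intro h i hi
    exact (bitVal_eq_iff u v ⟨i, hl i hi⟩).2 (h _ (by simpa [toCoords] using hi))

theorem card_toCoords_le (l : List ℕ) : (toCoords n l).card ≤ l.length := by
  refine le_trans ?_ (List.toFinset_card_le l)
  rw [← Finset.card_map Fin.valEmbedding]
  refine Finset.card_le_card fun i hi => ?_
  simp only [Finset.mem_map, toCoords, Finset.mem_filter, Finset.mem_univ, true_and] at hi
  obtain ⟨j, hj, rfl⟩ := hi
  simpa using hj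

theorem toCoords_append (l l' : List ℕ) :
    toCoords n (l ++ l') = toCoords n l ∪ toCoords n l' := by
  ext j; simp [toCoords]

/-- The correlation with a pair of bits is half the mean marginal in the first direction, weighted
by the second bit. -/
theorem bExp_mul_parity (g : (Fin n → Bool) → ℝ) (Z : Finset (Fin n)) (x : Fin n → Bool)
    {i : Fin n} (hi : i ∉ Z) {j : ℕ} (hj : j ≠ i) :
    bExp (1 / 2) (fun y => g y * parity i j (patch Z x y))
      = bExp (1 / 2) (fun y =>
          (if bitVal (patch Z x y) j = 1 then 1 else -1) * marg i g y / 2) := by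
  rw [bExp_split i]
  refine bExp_congr fun y => ?_
  have h1 : ∀ b, bitVal (patch Z x (Function.update y i b)) j = bitVal (patch Z x y) j := by
    intro b
    refine bitVal_congr fun l hl => ?_
    have : l ≠ i := fun h => hj (by rw [← hl, h])
    by_cases hlZ : l ∈ Z <;> simp [patch, hlZ, this]
  have h2 : ∀ b, bitVal (patch Z x (Function.update y i b)) i = b.toNat := by
    intro b
    rw [bitVal_fin]
    simp [patch, hi]
  have h3 := bitVal_lt_two (patch Z x y) j
  simp only [parity, h1, h2, marg]
  interval_cases h : bitVal (patch Z x y) j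
  · simp; ring
  · simp; ring

theorem bExp_mul_parity_last (g : (Fin n → Bool) → ℝ) (Z : Finset (Fin n)) (x : Fin n → Bool)
    {i : Fin n} (hi : i ∉ Z) :
    bExp (1 / 2) (fun y => g y * parity i n (patch Z x y)) = -bExp (1 / 2) (marg i g) / 2 := by
  rw [bExp_mul_parity g Z x hi (ne_of_gt i.2), ← bExp_neg, ← bExp_div_const]
  refine bExp_congr fun y => ?_
  simp [bitVal]

theorem bExp_mul_parity_pair (g : (Fin n → Bool) → ℝ) (Z : Finset (Fin n)) (x : Fin n → Bool)
    {i j : Fin n} (hi : i ∉ Z) (hj : j ∉ Z) (hij : j ≠ i) :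
    bExp (1 / 2) (fun y => g y * parity i j (patch Z x y))
      = bExp (1 / 2) (marg j (marg i g)) / 4 := by
  rw [bExp_mul_parity g Z x hi (fun h => hij (Fin.ext h)), bExp_split j, ← bExp_div_const]
  refine bExp_congr fun y => ?_
  have h2 : ∀ b, bitVal (patch Z x (Function.update y j b)) j = b.toNat := by
    intro b
    rw [bitVal_fin]
    simp [patch, hj]
  simp only [h2, marg]
  simp
  ring

theorem abs_bExp_mul_parity_le (g : (Fin n → Bool) → ℝ) (Z : Finset (Fin n)) (x : Fin n → Bool)
    {i : Fin n} (hi : i ∉ Z) {j : ℕ} (hj : j ≠ i) :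
    |bExp (1 / 2) (fun y => g y * parity i j (patch Z x y))|
      ≤ bExp (1 / 2) (fun y => |marg i g y|) / 2 := by
  rw [bExp_mul_parity g Z x hi hj, ← bExp_div_const, abs_le, ← bExp_neg]
  constructor
  · refine bExp_mono half_nonneg' half_le_one' fun y => ?_
    split_ifs
    · linarith [neg_abs_le (marg i g y)]
    · linarith [le_abs_self (marg i g y)]
  · refine bExp_mono half_nonneg' half_le_one' fun y => ?_
    split_ifs
    · linarith [le_abs_self (marg i g y)]
    · linarith [neg_abs_le (marg i g y)]

theorem marg_patch_of_mem (Z : Finset (Fin n)) (x : Fin n → Bool) {i : Fin n} (hi : i ∈ Z)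
    (y : Fin n → Bool) : marg i (fun y => f (patch Z x y)) y = 0 := by
  have : patch Z x (Function.update y i true) = patch Z x (Function.update y i false) := by
    ext l
    by_cases hl : l ∈ Z
    · simp [patch, hl]
    · have : l ≠ i := fun h => hl (h ▸ hi)
      simp [patch, hl, this]
  simp [marg, this]

/-- The bits and labels stored in the memory are those of the sample `S` labelled by `f`. -/
structure StoresSample (f : (Fin n → Bool) → ℝ) (S : Fin m → Fin n → Bool)
    (bits : ℕ → ℕ → ℕ) (lb : ℕ → ℝ) : Prop where
  bits_eq : ∀ (s : Fin m) (i : ℕ), i < n + 1 → bits s i = bitVal (S s) i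
  lb_eq : ∀ s : Fin m, lb s = f (S s)

/-- The active examples are those in the subcube of the points that agree with `x` on `Z`. -/
def IsActive (S : Fin m → Fin n → Bool) (Z : Finset (Fin n)) (x : Fin n → Bool)
    (act : ℕ → ℕ) : Prop :=
  ∀ s : Fin m, act s = 1 ↔ ∀ j ∈ Z, S s j = x j

variable {S : Fin m → Fin n → Bool} {bits : ℕ → ℕ → ℕ} {lb : ℕ → ℝ} {Z : Finset (Fin n)}
  {x : Fin n → Bool} {act : ℕ → ℕ} {τ : ℝ} {t : ℕ}

theorem activeSum_eq (hact : IsActive S Z x act) {φ : (Fin n → Bool) → ℝ}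
    (hφ : ∀ s : Fin m, lb s = φ (S s)) :
    activeSum lb m act = ∑ s, onCell Z x φ (S s) := by
  rw [activeSum, Finset.sum_range]
  refine Finset.sum_congr rfl fun s _ => ?_
  simp only [onCell, hact s, hφ s]

theorem Accurate.onCell_of_subset {φ : (Fin n → Bool) → ℝ} {W : Finset (Fin n)}
    (h : Accurate τ S φ W) (hZ : Z ⊆ W) (Φ : (Fin n → Bool) → ℝ)
    (hΦ : ∀ x y, (∀ j ∈ W, x j = y j) → Φ x = Φ y) :
    |∑ s, onCell Z x (fun u => φ u * Φ u) (S s)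
        - m * ((1 / 2) ^ Z.card * cavg Z (fun u => φ u * Φ u) x)|
      ≤ τ * (m * ((1 / 2) ^ Z.card * cavg Z (fun u => φ u * |Φ u|) x)) := by
  have h1 := h.sum_mul (Φ := onCell Z x Φ) (fun u v huv => by
    have : (∀ j ∈ Z, u j = x j) ↔ ∀ j ∈ Z, v j = x j :=
      forall₂_congr fun j hj => by rw [huv j (hZ hj)]
    simp only [onCell, this, hΦ u v huv])
  have e1 : ∀ u, φ u * onCell Z x Φ u = onCell Z x (fun u => φ u * Φ u) u := by
    intro u; simp only [onCell]; split_ifs <;> simp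
  have e2 : ∀ u, φ u * |onCell Z x Φ u| = onCell Z x (fun u => φ u * |Φ u|) u := by
    intro u; simp only [onCell]; split_ifs <;> simp
  simp only [e1, e2] at h1
  have e3 : (fun u => onCell Z x (fun u => φ u * Φ u) u) = onCell Z x (fun u => φ u * Φ u) := rfl
  have e4 : (fun u => onCell Z x (fun u => φ u * |Φ u|) u)
    = onCell Z x (fun u => φ u * |Φ u|) := rfl
  rw [e3, e4, bExp_onCell, bExp_onCell] at h1
  exact h1

theorem Accurate.activeSum {φ : (Fin n → Bool) → ℝ} {W : Finset (Fin n)}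
    (h : Accurate τ S φ W) (hZ : Z ⊆ W) (hact : IsActive S Z x act)
    (hφ : ∀ s : Fin m, lb s = φ (S s)) :
    |activeSum lb m act - m * ((1 / 2) ^ Z.card * cavg Z φ x)|
      ≤ τ * (m * ((1 / 2) ^ Z.card * cavg Z φ x)) := by
  have := h.onCell_of_subset (x := x) hZ (fun _ => 1) fun _ _ _ => rfl
  simp only [mul_one, abs_one] at this
  rw [activeSum_eq hact hφ]
  exact this

theorem Representative.corrSum (h : Representative τ t f S) (hs : StoresSample f S bits lb)
    (hZ : Z.card + 2 ≤ t) (hact : IsActive S Z x act) {i j : ℕ} (hi : i < n) (hj : j < n + 1) :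
    |corrSum bits lb m act i j
        - m * ((1 / 2) ^ Z.card * bExp (1 / 2) (fun y => f (patch Z x y)
          * parity i j (patch Z x y)))|
      ≤ τ * (m * ((1 / 2) ^ Z.card * cavg Z f x)) := by
  set W : Finset (Fin n) := Z ∪ toCoords n [i, j] with hW
  have hcard : W.card ≤ t := by
    have h1 : W.card ≤ _ := Finset.card_union_le Z (toCoords n [i, j])
    have h2 := card_toCoords_le (n := n) [i, j]
    simp only [List.length_cons, List.length_nil] at h2
    omega
  have hne : W.Nonempty := ⟨⟨i, hi⟩, by simp [hW, toCoords]⟩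
  have h1 := (h W hne hcard).2.onCell_of_subset (x := x) (Z := Z) Finset.subset_union_left
    (parity i j) (fun u v huv => by
      have hb : ∀ k ∈ [i, j], bitVal u k = bitVal v k := fun k hk =>
        bitVal_congr fun l hl => huv l (by simp [hW, toCoords, hl] at hk ⊢; tauto)
      simp only [parity, hb i (by simp), hb j (by simp)])
  have e : _root_.corrSum bits lb m act i j
      = ∑ s, onCell Z x (fun u => f u * parity i j u) (S s) := by
    rw [_root_.corrSum, Finset.sum_range]
    refine Finset.sum_congr rfl fun s _ => ?_
    simp only [onCell, hact s, hs.lb_eq s, hs.bits_eq s i (by omega), hs.bits_eq s j hj, parity]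
    split_ifs <;> simp
  have e2 : ∀ u : Fin n → Bool, f u * |parity i j u| = f u := by
    intro u
    simp only [parity]
    split_ifs <;> simp
  rw [e]
  simp only [e2] at h1
  exact h1

end Statistics

section Guarantee

variable {n m : ℕ} {f : (Fin n → Bool) → ℝ}
  {S : Fin m → Fin n → Bool} {bits : ℕ → ℕ → ℕ} {lb : ℕ → ℝ} {Z : Finset (Fin n)}
  {x : Fin n → Bool} {act : ℕ → ℕ} {τ : ℝ} {t N : ℕ}

/-! ### Detected coordinates -/

/-- The correlation of the label with a pair of bits on the subcube that fixes `x` on `Z`. -/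
noncomputable def cellCorr (f : (Fin n → Bool) → ℝ) (Z : Finset (Fin n)) (x : Fin n → Bool)
    (i j : ℕ) : ℝ :=
  bExp (1 / 2) (fun y => f (patch Z x y) * parity i j (patch Z x y))

/-- The set `Z` may be empty, so representativity is used on `Z` with one more coordinate. -/
theorem Representative.activeSum (hn : 0 < n) (h : Representative τ t f S)
    (hs : StoresSample f S bits lb) (hZ : Z.card + 1 ≤ t) (hact : IsActive S Z x act) :
    |activeSum lb m act - m * ((1 / 2) ^ Z.card * cavg Z f x)|
      ≤ τ * (m * ((1 / 2) ^ Z.card * cavg Z f x)) :=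
  (h (insert ⟨0, hn⟩ Z) (Finset.insert_nonempty _ _)
    ((Finset.card_insert_le _ _).trans hZ)).2.activeSum (Finset.subset_insert _ _) hact hs.lb_eq

theorem Representative.activeCount (hn : 0 < n) (h : Representative τ t f S)
    (hZ : Z.card + 1 ≤ t) (hact : IsActive S Z x act) :
    |_root_.activeSum (fun _ => 1) m act - m * (1 / 2) ^ Z.card| ≤ τ * (m * (1 / 2) ^ Z.card) := by
  have := (h (insert ⟨0, hn⟩ Z) (Finset.insert_nonempty _ _)
    ((Finset.card_insert_le _ _).trans hZ)).1.activeSum (x := x) (lb := fun _ => 1)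
      (Finset.subset_insert _ _) hact fun _ => rfl
  simpa only [cavg, bExp_const, mul_one] using this

/-- Undetected coordinates have small correlations on the subcube. -/
theorem abs_cellCorr_le_of_not_detected (hn : 0 < n) (hm : 0 < m) (h0 : ∀ x, 0 ≤ f x)
    (hrep : Representative τ t f S) (hs : StoresSample f S bits lb) (hZ : Z.card + 2 ≤ t)
    (hact : IsActive S Z x act) (hN : 0 < N) (hτN : τ * (4 * N) ≤ 1)
    {i j : ℕ} (hi : i < n) (hj : j < n + 1) (hij : j ≠ i)
    (hd : ¬ Detected bits lb m n N act i) :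
    |cellCorr f Z x i j| * N ≤ 3 * cavg Z f x := by
  have h1 := hrep.activeSum hn hs (by omega) hact
  have h2 := hrep.corrSum hs hZ hact hi hj
  set a : ℝ := m * (1 / 2) ^ Z.card with ha
  have hapos : 0 < a := by positivity
  have hμ := cavg_nonneg (J := Z) h0 x
  set μ := cavg Z f x
  set c := cellCorr f Z x i j with hc
  have hN' : (1:ℝ) ≤ N := by exact_mod_cast hN
  have e1 : m * ((1 / 2) ^ Z.card * μ) = a * μ := by rw [ha]; ring
  have e2 : m * ((1 / 2) ^ Z.card * bExp (1 / 2) (fun y => f (patch Z x y)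
          * parity i j (patch Z x y))) = a * c := by rw [ha, hc, cellCorr]; ring
  rw [e1] at h1
  rw [e1, e2] at h2
  rw [Detected] at hd
  push Not at hd
  obtain ⟨h3, h4⟩ := hd j hj hij
  rw [abs_le] at h1 h2
  have haμ : 0 ≤ a * μ := by positivity
  have hτμ : τ * (4 * N) * (a * μ) ≤ 1 * (a * μ) := mul_le_mul_of_nonneg_right hτN haμ
  have hτμ1 : τ * (a * μ) ≤ a * μ := by
    rcases le_total 0 τ with h | h
    · have : 0 ≤ τ * (a * μ) := by positivity
      nlinarith
    · have : 0 ≤ (-τ) * (a * μ) := mul_nonneg (by linarith) haμ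
      linarith
  rcases le_total 0 c with h | h
  · rw [abs_of_nonneg h]
    have h5 : (N:ℝ) * (a * c - τ * (a * μ)) ≤ N * corrSum bits lb m act i j :=
      mul_le_mul_of_nonneg_left (by linarith [h2.1]) (by positivity)
    have h6 : a * (c * N) ≤ a * (3 * μ) := by linarith [h1.2]
    exact le_of_mul_le_mul_left h6 hapos
  · rw [abs_of_nonpos h]
    have h5 : (N:ℝ) * (-(a * c) - τ * (a * μ)) ≤ N * -corrSum bits lb m act i j :=
      mul_le_mul_of_nonneg_left (by linarith [h2.2]) (by positivity)
    have h6 : a * (-c * N) ≤ a * (3 * μ) := by linarith [h1.2]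
    exact le_of_mul_le_mul_left h6 hapos

/-- Detected coordinates have a noticeable influence on the subcube. -/
theorem lt_of_detected (hn : 0 < n) (hm : 0 < m) (h0 : ∀ x, 0 ≤ f x)
    (hrep : Representative τ t f S) (hs : StoresSample f S bits lb) (hZ : Z.card + 2 ≤ t)
    (hact : IsActive S Z x act) (hN : 0 < N) (hτN : τ * (4 * N) ≤ 1)
    {i : Fin n} (hi : i ∉ Z) (hd : Detected bits lb m n N act i) :
    cavg Z f x < N * bExp (1 / 2) (fun y => |marg i (fun y => f (patch Z x y)) y|) := by
  obtain ⟨j, hj, hij, hd⟩ := hd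
  have h1 := hrep.activeSum hn hs (by omega) hact
  have h2 := hrep.corrSum hs hZ hact i.2 hj
  have hle := abs_bExp_mul_parity_le (fun y => f (patch Z x y)) Z x hi hij
  set a : ℝ := m * (1 / 2) ^ Z.card with ha
  have hapos : 0 < a := by positivity
  have hμ := cavg_nonneg (J := Z) h0 x
  set μ := cavg Z f x
  set c := bExp (1 / 2) (fun y => f (patch Z x y) * parity i j (patch Z x y)) with hc
  set b := bExp (1 / 2) (fun y => |marg i (fun y => f (patch Z x y)) y|)
  have hN' : (1:ℝ) ≤ N := by exact_mod_cast hN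
  have e1 : m * ((1 / 2) ^ Z.card * μ) = a * μ := by rw [ha]; ring
  have e2 : m * ((1 / 2) ^ Z.card * c) = a * c := by rw [ha]; ring
  rw [e1] at h1
  rw [e1, e2] at h2
  rw [abs_le] at h1 h2 hle
  have haμ : 0 ≤ a * μ := by positivity
  have hτμ : τ * (4 * N) * (a * μ) ≤ 1 * (a * μ) := mul_le_mul_of_nonneg_right hτN haμ
  have hτμ1 : τ * (a * μ) ≤ a * μ / 4 := by
    rcases le_total 0 τ with h | h
    · have : 0 ≤ τ * (a * μ) := by positivity
      nlinarith
    · have : 0 ≤ (-τ) * (a * μ) := mul_nonneg (by linarith) haμ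
      linarith
  have h3 : a * μ < a * (N * b) := by
    rcases hd with hd | hd
    · have h5 : (N:ℝ) * corrSum bits lb m act i j ≤ N * (a * (b / 2) + τ * (a * μ)) := by
        refine mul_le_mul_of_nonneg_left ?_ (by positivity)
        have := mul_le_mul_of_nonneg_left hle.2 hapos.le
        linarith [h2.2]
      linarith [h1.1]
    · have h5 : (N:ℝ) * -corrSum bits lb m act i j ≤ N * (a * (b / 2) + τ * (a * μ)) := by
        refine mul_le_mul_of_nonneg_left ?_ (by positivity)
        have := mul_le_mul_of_nonneg_left hle.1 hapos.le
        linarith [h2.1]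
      linarith [h1.1]
  exact lt_of_mul_lt_mul_left h3 hapos.le

/-- Since the total influence is at most four times the mean, few coordinates are detected. -/
theorem card_detected_le (hn : 0 < n) (hm : 0 < m) (hf : SubmodularFun f) (h0 : ∀ x, 0 ≤ f x)
    (hrep : Representative τ t f S) (hs : StoresSample f S bits lb) (hZ : Z.card + 2 ≤ t)
    (hact : IsActive S Z x act) (hN : 0 < N) (hτN : τ * (4 * N) ≤ 1) :
    (toCoords n (detectedList bits lb m n N act n)).card ≤ Z.card + 4 * N := by
  set V := toCoords n (detectedList bits lb m n N act n) with hV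
  set g : (Fin n → Bool) → ℝ := fun y => f (patch Z x y) with hg
  have hd : ∀ i ∈ V \ Z, bExp (1 / 2) g
      < N * bExp (1 / 2) (fun y => |marg i g y|) := by
    intro i hi
    rw [Finset.mem_sdiff] at hi
    refine lt_of_detected hn hm h0 hrep hs hZ hact hN hτN hi.2 ?_
    have h1 := hi.1
    simp only [hV, toCoords, Finset.mem_filter, Finset.mem_univ, true_and] at h1
    exact (mem_detectedList.1 h1).2
  have hsum := (hf.comp_patch Z x).sum_bExp_abs_marg_le (fun y => h0 _)
  have hbnn : ∀ i, 0 ≤ bExp (1 / 2) (fun y => |marg i g y|) := fun i =>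
    bExp_nonneg half_nonneg' half_le_one' fun y => abs_nonneg _
  have hμ : 0 ≤ bExp (1 / 2) g := bExp_nonneg half_nonneg' half_le_one' fun y => h0 _
  have hcard : (V \ Z).card ≤ 4 * N := by
    have h1 : ∑ i ∈ V \ Z, bExp (1 / 2) g
        ≤ ∑ i ∈ V \ Z, N * bExp (1 / 2) (fun y => |marg i g y|) :=
      Finset.sum_le_sum fun i hi => (hd i hi).le
    have h2 : ∑ i ∈ V \ Z, bExp (1 / 2) (fun y => |marg i g y|) ≤ 4 * bExp (1 / 2) g :=
      (Finset.sum_le_univ_sum_of_nonneg hbnn).trans hsum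
    rw [Finset.sum_const, nsmul_eq_mul, ← Finset.mul_sum] at h1
    rcases hμ.eq_or_lt with hz | hpos
    · rcases (V \ Z).eq_empty_or_nonempty with he | ⟨i, hi⟩
      · simp [he]
      · have h3 := hd i hi
        have h4 : bExp (1 / 2) (fun y => |marg i g y|)
            ≤ ∑ i ∈ V \ Z, bExp (1 / 2) (fun y => |marg i g y|) :=
          Finset.single_le_sum (fun i _ => hbnn i) hi
        have h5 : bExp (1 / 2) (fun y => |marg i g y|) ≤ 0 := by linarith
        have h6 : (N:ℝ) * bExp (1 / 2) (fun y => |marg i g y|) ≤ 0 :=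
          mul_nonpos_of_nonneg_of_nonpos (Nat.cast_nonneg _) h5
        linarith
    · have h3 := mul_le_mul_of_nonneg_left h2 (Nat.cast_nonneg (α := ℝ) N)
      have h4 : ((V \ Z).card : ℝ) * bExp (1 / 2) g ≤ (4 * N : ℕ) * bExp (1 / 2) g := by
        push_cast; linarith
      exact_mod_cast le_of_mul_le_mul_right h4 hpos
  have h1 : V.card ≤ (V \ Z).card + Z.card := by
    have := Finset.card_le_card (s := V) (t := (V \ Z) ∪ Z) (by
      intro i hi; by_cases h : i ∈ Z <;> simp [hi, h])
    exact this.trans (Finset.card_union_le _ _)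
  omega

/-! ### The empirical energy -/

/-- The second moment of the conditional mean on the subcube that fixes `x` on `Z`. -/
noncomputable def cellEnergy (f : (Fin n → Bool) → ℝ) (Z : Finset (Fin n)) (x : Fin n → Bool)
    (J : Finset (Fin n)) : ℝ :=
  bExp (1 / 2) (fun y => cavg J (fun y => f (patch Z x y)) y ^ 2)

theorem ratio_sq_bounds {s c a b τ : ℝ} (ha : 0 ≤ a) (hb : 0 < b) (hτ0 : 0 ≤ τ)
    (hτ : τ ≤ 1 / 100) (hs : |s - b * a| ≤ τ * (b * a)) (hc : |c - b| ≤ τ * b) :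
    |s / c * (s / c) - a ^ 2| ≤ 7 * τ * a ^ 2 := by
  rw [abs_le] at hs hc
  have hcpos : 0 < c := by nlinarith
  have h1 : s / c ≤ (1 + 3 * τ) * a := by
    rw [div_le_iff₀ hcpos]
    have h2 : (1 + 3 * τ) * a * ((1 - τ) * b) ≤ (1 + 3 * τ) * a * c :=
      mul_le_mul_of_nonneg_left (by linarith) (by positivity)
    have h3 : (1 + τ) * (b * a) ≤ (1 + 3 * τ) * a * ((1 - τ) * b) := by
      have : 0 ≤ (b * a) * (τ * (1 - 3 * τ)) :=
        mul_nonneg (by positivity) (mul_nonneg hτ0 (by linarith))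
      linarith
    linarith
  have h2 : (1 - 2 * τ) * a ≤ s / c := by
    rw [le_div_iff₀ hcpos]
    have h2 : (1 - 2 * τ) * a * c ≤ (1 - 2 * τ) * a * ((1 + τ) * b) :=
      mul_le_mul_of_nonneg_left (by linarith) (mul_nonneg (by linarith) ha)
    have h3 : (1 - 2 * τ) * a * ((1 + τ) * b) ≤ (1 - τ) * (b * a) := by
      have : 0 ≤ (b * a) * (2 * τ ^ 2) := by positivity
      linarith
    linarith
  have h0 : 0 ≤ (1 - 2 * τ) * a := mul_nonneg (by linarith) ha
  have h3 : s / c * (s / c) ≤ ((1 + 3 * τ) * a) * ((1 + 3 * τ) * a) :=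
    mul_le_mul h1 h1 (h0.trans h2) (by positivity)
  have h4 : ((1 - 2 * τ) * a) * ((1 - 2 * τ) * a) ≤ s / c * (s / c) :=
    mul_le_mul h2 h2 h0 (h0.trans h2)
  have ha2 : 0 ≤ a ^ 2 := sq_nonneg a
  have h5 : τ ^ 2 * a ^ 2 ≤ τ / 100 * a ^ 2 :=
    mul_le_mul_of_nonneg_right (by nlinarith) ha2
  have h6 : 0 ≤ τ * a ^ 2 := by positivity
  have h7 : 0 ≤ τ ^ 2 * a ^ 2 := by positivity
  rw [abs_le]
  constructor <;> linarith

/-- The group of an example on the coordinates `J` is the part of the sample in a subcube. -/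
theorem groupSum_eq (hbits : ∀ (s : Fin m) (i : ℕ), i < n + 1 → bits s i = bitVal (S s) i)
    (hact : IsActive S Z x act) {φ : (Fin n → Bool) → ℝ} (hφ : ∀ s : Fin m, lb s = φ (S s))
    {J : List ℕ} (hJ : ∀ i ∈ J, i < n) (s : Fin m) (hsx : ∀ j ∈ Z, S s j = x j) :
    groupSum bits lb m act J s = ∑ s', onCell (Z ∪ toCoords n J) (S s) φ (S s') := by
  rw [groupSum, Finset.sum_range]
  refine Finset.sum_congr rfl fun s' _ => ?_
  have h : (act s' = 1 ∧ ∀ i ∈ J, bits s' i = bits s i)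
      ↔ ∀ j ∈ Z ∪ toCoords n J, S s' j = S s j := by
    rw [hact s']
    have h1 : (∀ i ∈ J, bits s' i = bits s i) ↔ ∀ j ∈ toCoords n J, S s' j = S s j := by
      rw [← forall_toCoords hJ]
      refine forall₂_congr fun i hi => ?_
      have := hJ i hi
      rw [hbits s' i (by omega), hbits s i (by omega)]
    rw [h1]
    simp only [Finset.mem_union]
    constructor
    · rintro ⟨h2, h3⟩ j (hj | hj)
      · rw [h2 j hj, hsx j hj]
      · exact h3 j hj
    · intro h2
      exact ⟨fun j hj => (h2 j (Or.inl hj)).trans (hsx j hj), fun j hj => h2 j (Or.inr hj)⟩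
  simp only [onCell, h, hφ]

/-- The empirical energy of a tuple is a multiplicative approximation to the true one. -/
theorem abs_energy_sub_le (hm : 0 < m) (h0 : ∀ x, 0 ≤ f x) (hrep : Representative τ t f S)
    (hs : StoresSample f S bits lb) (hact : IsActive S Z x act) (hτ0 : 0 ≤ τ)
    (hτ : τ ≤ 1 / 100) {J : List ℕ} (hJ : ∀ i ∈ J, i < n) (hJne : J ≠ [])
    (hcard : Z.card + J.length ≤ t) :
    |energy bits lb m act J - m * ((1 / 2) ^ Z.card * cellEnergy f Z x (toCoords n J))|
      ≤ 9 * τ * (m * ((1 / 2) ^ Z.card * cellEnergy f Z x (toCoords n J))) := by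
  set W := Z ∪ toCoords n J with hW
  have hWt : W.card ≤ t := by
    have h1 : W.card ≤ _ := Finset.card_union_le Z (toCoords n J)
    have h2 := card_toCoords_le (n := n) J
    omega
  have hWne : W.Nonempty := by
    obtain ⟨i, hi⟩ := List.exists_mem_of_ne_nil J hJne
    exact ⟨⟨i, hJ i hi⟩, by simp [hW, toCoords, hi]⟩
  obtain ⟨hA1, hAf⟩ := hrep W hWne hWt
  have hm' : (0:ℝ) < m := by exact_mod_cast hm
  set A : ℝ := m * ((1 / 2) ^ Z.card * cellEnergy f Z x (toCoords n J)) with hA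
  -- the energy with the true conditional means
  set E' : ℝ := ∑ s, onCell Z x (fun u => 1 * cavg W f u ^ 2) (S s) with hE'
  have hE : |E' - A| ≤ τ * A := by
    have h1 := hA1.onCell_of_subset (x := x) (Z := Z) Finset.subset_union_left
      (fun u => cavg W f u ^ 2) (fun u v huv => by rw [cavg_congr huv])
    have e0 : ∀ u, |cavg W f u ^ 2| = cavg W f u ^ 2 := fun u => abs_of_nonneg (sq_nonneg _)
    simp only [e0] at h1
    have e : cavg Z (fun u => 1 * cavg W f u ^ 2) x = cellEnergy f Z x (toCoords n J) := by
      simp only [cellEnergy, cavg, one_mul, hW, patch_union]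
    rw [e] at h1
    exact h1
  have hE0 : 0 ≤ E' := Finset.sum_nonneg fun s _ => by
    simp only [onCell, one_mul]; split_ifs; exacts [sq_nonneg _, le_rfl]
  have hen : |energy bits lb m act J - E'| ≤ 7 * τ * E' := by
    rw [energy, Finset.sum_range, hE', ← Finset.sum_sub_distrib, Finset.mul_sum]
    refine (Finset.abs_sum_le_sum_abs _ _).trans (Finset.sum_le_sum fun s _ => ?_)
    by_cases hsx : ∀ j ∈ Z, S s j = x j
    · rw [if_pos ((hact s).2 hsx), onCell, if_pos hsx, one_mul, groupCount,
        groupSum_eq hs.bits_eq hact hs.lb_eq hJ s hsx,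
        groupSum_eq hs.bits_eq hact (φ := fun _ => 1) (fun _ => rfl) hJ s hsx]
      have h1 := hAf (S s)
      have h2 := hA1 (S s)
      rw [bExp_onCell] at h1 h2
      rw [cavg, bExp_const, mul_one] at h2
      refine ratio_sq_bounds (b := m * (1 / 2) ^ W.card) (cavg_nonneg h0 _) (by positivity)
        hτ0 hτ ?_ h2
      rw [mul_assoc]
      exact h1
    · rw [if_neg (fun h => hsx ((hact s).1 h)), onCell, if_neg hsx]
      simp
  rw [abs_le] at hE hen ⊢
  have h1 : τ * E' ≤ τ * ((1 + τ) * A) := mul_le_mul_of_nonneg_left (by linarith [hE.2]) hτ0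
  have hA0 : 0 ≤ A := by nlinarith [hE.1, hE.2]
  have h2 : τ * (τ * A) ≤ 1 / 100 * (τ * A) :=
    mul_le_mul_of_nonneg_right hτ (by positivity)
  have h3 : 0 ≤ τ * A := by positivity
  constructor <;> linarith [hE.1, hE.2, hen.1, hen.2]

/-! ### The selected coordinates explain most of the variance -/

theorem tuple_length {n N K D : ℕ} (c : ℕ) : (tuple bits lb m n N K D act c).length = D := by
  simp [tuple]

/-- Maximizing the empirical energy is as good, up to sampling errors, as choosing the junta that
`SubmodularFun.exists_junta_approx` provides: the variance that a set of coordinates leaves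
unexplained is the second moment of the function minus the energy of the set. -/
theorem bExp_sub_cavg_selected_le (hn : 0 < n) (hm : 0 < m) (hf : SubmodularFun f)
    (h0 : ∀ x, 0 ≤ f x) (hrep : Representative τ t f S) (hs : StoresSample f S bits lb)
    (hact : IsActive S Z x act) (hN : 0 < N) (hτN : τ * (4 * N) ≤ 1) (hτ0 : 0 ≤ τ)
    (hτ : τ ≤ 1 / 100) {D K k : ℕ} {α κ : ℝ} (hZ : Z.card + 2 ≤ t) (hZD : Z.card + D ≤ t)
    (hD : 0 < D) (hDk : 8 * k ≤ D * α) (hk : 1 ≤ k) (hα : 0 < α) (hκ : 0 < κ) (hκ1 : κ ≤ 1)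
    (hκN : 12 ≤ κ ^ 16 * N) (hK : t + 4 * N ≤ K) {M : ℝ} (hM : ∀ y, f (patch Z x y) ≤ M) :
    bExp (1 / 2) (fun y => (f (patch Z x y)
        - cavg (toCoords n (selected bits lb m n N K D act)) (fun y => f (patch Z x y)) y) ^ 2)
      ≤ (4 * κ + α + K * (1 / 2) ^ k / 2 + 18 * τ) * M ^ 2 := by
  set g : (Fin n → Bool) → ℝ := fun y => f (patch Z x y) with hg
  have hgsub : SubmodularFun g := hf.comp_patch Z x
  have hg0 : ∀ y, 0 ≤ g y := fun y => h0 _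
  have hM0 : 0 ≤ M := (h0 _).trans (hM ⊥)
  set L := detectedList bits lb m n N act n with hL
  set V := toCoords n L with hV
  have hμM : cavg Z f x ≤ M := (bExp_mono half_nonneg' half_le_one' hM).trans (bExp_const M).le
  have hVcard : V.card ≤ K := by
    have : V.card ≤ Z.card + 4 * N := card_detected_le hn hm hf h0 hrep hs hZ hact hN hτN
    omega
  have hnotV : ∀ i : Fin n, i ∉ V → ¬ Detected bits lb m n N act i := by
    intro i hi hd
    apply hi
    simp only [hV, toCoords, Finset.mem_filter, Finset.mem_univ, true_and]
    exact mem_detectedList.2 ⟨i.2, hd⟩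
  have hNpos : (0:ℝ) < N := by exact_mod_cast hN
  have hsmall : ∀ c : ℝ, |c| * N ≤ 12 * cavg Z f x → |c| ≤ κ ^ 16 * M := by
    intro c hc
    have h1 : |c| * N ≤ κ ^ 16 * M * N := by
      have h2 := mul_le_mul_of_nonneg_right hκN hM0
      linarith
    exact le_of_mul_le_mul_right h1 hNpos
  have hμ0 := cavg_nonneg (J := Z) h0 x
  obtain ⟨J, hJV, hJcard, hJ⟩ := hgsub.exists_junta_approx hg0 hM V hα hκ hκ1 hk
    (fun i hi => by
      by_cases hiZ : i ∈ Z
      · rw [bExp_congr (marg_patch_of_mem Z x hiZ), bExp_const, abs_zero]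
        positivity
      · have h1 := abs_cellCorr_le_of_not_detected hn hm h0 hrep hs hZ hact hN hτN i.2
          (Nat.lt_succ_self n) (ne_of_gt i.2) (hnotV i hi)
        rw [cellCorr, bExp_mul_parity_last (fun y => f (patch Z x y)) Z x hiZ, abs_div, abs_neg,
          abs_of_pos (by norm_num : (0:ℝ) < 2)] at h1
        exact hsmall _ (by linarith))
    (fun i hi j hij => by
      by_cases hiZ : i ∈ Z
      · have : ∀ y, marg j (marg i g) y = 0 := fun y => by
          rw [marg, marg_patch_of_mem Z x hiZ, marg_patch_of_mem Z x hiZ, sub_zero]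
        rw [bExp_congr this, bExp_const, abs_zero]
        positivity
      by_cases hjZ : j ∈ Z
      · have : ∀ y, marg j (marg i g) y = 0 := fun y => by
          rw [marg_comm, marg, marg_patch_of_mem Z x hjZ, marg_patch_of_mem Z x hjZ, sub_zero]
        rw [bExp_congr this, bExp_const, abs_zero]
        positivity
      · have h1 := abs_cellCorr_le_of_not_detected hn hm h0 hrep hs hZ hact hN hτN i.2
          (j.2.trans (Nat.lt_succ_self n)) (fun h => hij (Fin.ext h)) (hnotV i hi)
        rw [cellCorr, bExp_mul_parity_pair (fun y => f (patch Z x y)) Z x hiZ hjZ hij, abs_div,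
          abs_of_pos (by norm_num : (0:ℝ) < 4)] at h1
        exact hsmall _ (by linarith))
  have hJD : J.card ≤ D := by
    have h1 : (J.card : ℝ) * α ≤ D * α := hJcard.trans hDk
    exact_mod_cast le_of_mul_le_mul_right h1 hα
  have hLlen : L.length ≤ K := by
    have hnodup : L.Nodup := by
      rw [hL, detectedList]; exact List.Nodup.filter _ List.nodup_range
    have e : L.length = V.card := by
      rw [← List.toFinset_card_of_nodup hnodup, ← Finset.card_map Fin.valEmbedding]
      congr 1
      ext i
      simp only [List.mem_toFinset, Finset.mem_map, hV, toCoords, Finset.mem_filter,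
        Finset.mem_univ, true_and, Fin.valEmbedding_apply]
      constructor
      · intro hi
        exact ⟨⟨i, (mem_detectedList.1 hi).1⟩, hi, rfl⟩
      · rintro ⟨j, hj, rfl⟩
        exact hj
    omega
  obtain ⟨c, hcK, hc⟩ := exists_tuple (bits := bits) (lb := lb) (m := m) (n := n) (N := N)
    (K := K) (D := D) (act := act) (by omega) hLlen (J.toList.map Fin.val) (by simpa using hJD)
    (fun i hi => by
      rw [List.mem_map] at hi
      obtain ⟨j, hj, rfl⟩ := hi
      have := hJV (Finset.mem_toList.1 hj)
      simpa [hV, toCoords] using this)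
  set J' := tuple bits lb m n N K D act c with hJ'
  have hJJ' : J ⊆ toCoords n J' := by
    intro j hj
    simp only [toCoords, Finset.mem_filter, Finset.mem_univ, true_and]
    exact hc _ (List.mem_map.2 ⟨j, Finset.mem_toList.2 hj, rfl⟩)
  have htne : ∀ c, tuple bits lb m n N K D act c ≠ [] := by
    intro c h
    have := tuple_length (bits := bits) (lb := lb) (m := m) (act := act) (n := n) (N := N)
      (K := K) (D := D) c
    rw [h] at this
    simp at this
    omega
  have hen : ∀ c, _ := fun c => abs_energy_sub_le hm h0 hrep hs hact hτ0 hτ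
    (J := tuple bits lb m n N K D act c) (fun i hi => tuple_lt hn hi) (htne c)
    (by rw [tuple_length]; exact hZD)
  have hmax := (argmax_spec (fun c => energy bits lb m act (tuple bits lb m n N K D act c))
    (K ^ D)).1 c hcK
  set b := argmax (fun c => energy bits lb m act (tuple bits lb m n N K D act c)) (K ^ D)
  have hb := hen b
  have hc' := hen c
  have hsel : selected bits lb m n N K D act = tuple bits lb m n N K D act b := rfl
  rw [hsel]
  have hm' : (0:ℝ) < m := by exact_mod_cast hm
  set a : ℝ := m * (1 / 2) ^ Z.card with ha
  have hapos : 0 < a := by positivity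
  simp only [← mul_assoc, ← ha] at hb hc'
  have hcell : ∀ J, cellEnergy f Z x J ≤ M ^ 2 := by
    intro J
    refine (bExp_mono half_nonneg' half_le_one' fun y => ?_).trans (bExp_const (M ^ 2)).le
    exact pow_le_pow_left₀ (cavg_nonneg hg0 _) (cavg_le hM y) 2
  set eb := cellEnergy f Z x (toCoords n (tuple bits lb m n N K D act b)) with heb
  set ec := cellEnergy f Z x (toCoords n (tuple bits lb m n N K D act c)) with hec
  have h1 : ec - 18 * τ * M ^ 2 ≤ eb := by
    rw [abs_le] at hb hc'
    have h2 : a * (ec - 9 * τ * (ec + eb)) ≤ a * eb := by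
      linarith [hb.2, hc'.1]
    have h3 := le_of_mul_le_mul_left h2 hapos
    have hx : eb ≤ M ^ 2 := hcell _
    have hy : ec ≤ M ^ 2 := hcell _
    have h4 : τ * (ec + eb) ≤ τ * (2 * M ^ 2) :=
      mul_le_mul_of_nonneg_left (by linarith) hτ0
    linarith
  have h2 : bExp (1 / 2) (fun y => cavg J g y ^ 2) ≤ ec := bExp_cavg_sq_mono hJJ'
  rw [bExp_sub_cavg_sq] at hJ ⊢
  have h3 : (V.card : ℝ) * (1 / 2) ^ k / 2 * M ^ 2 ≤ K * (1 / 2) ^ k / 2 * M ^ 2 := by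
    have : (V.card : ℝ) ≤ K := by exact_mod_cast hVcard
    gcongr
  have h4 : bExp (1 / 2) (fun y => cavg (toCoords n (tuple bits lb m n N K D act b)) g y ^ 2)
      = eb := rfl
  rw [h4]
  linarith

end Guarantee

section Learning

variable {n m : ℕ} {f : (Fin n → Bool) → ℝ} {S : Fin m → Fin n → Bool} {bits : ℕ → ℕ → ℕ}
  {lb : ℕ → ℝ} {x : Fin n → Bool} {τ : ℝ} {t : ℕ}

/-! ### The decision tree grown by the algorithm -/

/-- The last level of the tree, in place of the first one. -/
theorem runTree_succ' (sel : Finset (Fin n) → (Fin n → Bool) → Finset (Fin n)) (R : ℕ)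
    (Z : Finset (Fin n)) (x : Fin n → Bool) :
    runTree sel (R + 1) Z x = runTree sel R Z x ∪ sel (runTree sel R Z x) x := by
  induction R generalizing Z with
  | zero => rfl
  | succ R ih => rw [runTree, ih]; rfl

/-- The indicator of the examples in the subcube of the points that agree with `x` on `Z`. -/
def cellActive (bits : ℕ → ℕ → ℕ) (Z : Finset (Fin n)) (x : Fin n → Bool) (s : ℕ) : ℕ :=
  if ∀ j ∈ Z, bits s j = (x j).toNat then 1 else 0

/-- The coordinates that the algorithm queries on the subcube of the points that agree with `x`
on `Z`. -/
noncomputable def cellSelected (bits : ℕ → ℕ → ℕ) (lb : ℕ → ℝ) (m N K D : ℕ)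
    (Z : Finset (Fin n)) (x : Fin n → Bool) : Finset (Fin n) :=
  toCoords n (selected bits lb m n N K D (cellActive bits Z x))

theorem isActive_cellActive (hs : StoresSample f S bits lb) (Z : Finset (Fin n)) :
    IsActive S Z x (cellActive bits Z x) := by
  intro s
  have : (∀ j ∈ Z, bits s j = (x j).toNat) ↔ ∀ j ∈ Z, S s j = x j := by
    refine forall₂_congr fun j _ => ?_
    have := j.2
    rw [hs.bits_eq s j (by omega), ← bitVal_fin x, bitVal_eq_iff]
  simp only [cellActive, this]
  split_ifs with h
  · exact iff_of_true rfl h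
  · exact iff_of_false id h

theorem active_eq_cellActive {l : List ℕ} (hl : ∀ i ∈ l, i < n) :
    active bits (bitVal x) l = cellActive bits (toCoords n l) x := by
  funext s
  have : (∀ i ∈ l, bits s i = bitVal x i) ↔ ∀ j ∈ toCoords n l, bits s j = (x j).toNat := by
    constructor
    · intro h j hj
      rw [← bitVal_fin]
      exact h j (by simpa [toCoords] using hj)
    · intro h i hi
      have := h ⟨i, hl i hi⟩ (by simpa [toCoords] using hi)
      rwa [← bitVal_fin] at this
  simp only [active, cellActive, this]

theorem queried_lt (hn : 0 < n) {N K D : ℕ} {y : ℕ → ℕ} (r : ℕ) :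
    ∀ i ∈ queried bits lb m n N K D y r, i < n := by
  induction r with
  | zero => simp [queried]
  | succ r ih =>
    intro i hi
    rw [queried, List.mem_append] at hi
    rcases hi with hi | hi
    · exact ih i hi
    · exact tuple_lt hn hi

/-- The algorithm follows the branch of `x` in a decision tree. -/
theorem toCoords_queried (hn : 0 < n) {N K D : ℕ} (r : ℕ) :
    toCoords n (queried bits lb m n N K D (bitVal x) r)
      = runTree (cellSelected bits lb m N K D) r ∅ x := by
  induction r with
  | zero => simp [queried, runTree, toCoords]
  | succ r ih =>
    rw [runTree_succ', queried, toCoords_append, ih, cellSelected,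
      active_eq_cellActive (queried_lt hn r), ih]

theorem card_cellSelected_le {N K D : ℕ} (Z : Finset (Fin n)) :
    (cellSelected bits lb m N K D Z x).card ≤ D :=
  (card_toCoords_le _).trans (tuple_length _).le

theorem card_runTree_le {N K D : ℕ} (r : ℕ) :
    (runTree (cellSelected bits lb m N K D) r ∅ x).card ≤ r * D := by
  induction r with
  | zero => simp [runTree]
  | succ r ih =>
    rw [runTree_succ', add_mul, one_mul]
    exact (Finset.card_union_le _ _).trans (add_le_add ih (card_cellSelected_le _))

/-! ### Choice of the parameters -/

/-- The number `D` of coordinates queried per round.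

The parameters are functions of a number `U` with `2 ^ (-U) ≤ 2 ^ (-18) ε γ`. Each round has to
explain all but a fraction of order `2 ^ (-2U)` of the variance, so that
`SubmodularFun.exists_junta_approx` is used with `α` of this order, `κ = 2 ^ (-2U)` and
`k = 40 U`. Marginals are detected if they exceed a fraction `1 / N` of the mean, where
`N = 2 ^ (33U)` is larger than `12 κ ^ (-16)`. The sample has accuracy `τ = 2 ^ (-34U)`, which is
less than `1 / (4N)`, and `K = 2 ^ (34U)` bounds the number of detected coordinates. After `4U`
rounds the error probability `(4 / 5) ^ (4U)` is less than `2 ^ (-U)`. -/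
def roundSize (U : ℕ) : ℕ := U * 2 ^ (2 * U + 4)

/-- The number of coordinates on which the sample has to be representative. -/
def cellSize (U : ℕ) : ℕ := 4 * U * roundSize U + 3

/-- The number of examples, if `2 ^ l` is at least `2 n`. -/
def sampleSize (U l : ℕ) : ℕ := l * 2 ^ (2 * cellSize U + 70 * U)

theorem sq_le_two_pow {U : ℕ} (hU : 4 ≤ U) : U ^ 2 ≤ 2 ^ U := by
  induction U, hU using Nat.le_induction with
  | base => norm_num
  | succ U hU ih => rw [pow_succ 2]; nlinarith

theorem cellSize_le {U : ℕ} (hU : 18 ≤ U) : cellSize U ≤ 2 ^ (4 * U) := by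
  have h1 : U ^ 2 ≤ 2 ^ U := sq_le_two_pow (by omega)
  have h2 : (2:ℕ) ^ 18 ≤ 2 ^ U := Nat.pow_le_pow_right (by norm_num) hU
  have e : cellSize U = 64 * U ^ 2 * (2 ^ U) ^ 2 + 3 := by
    rw [cellSize, roundSize, pow_add, pow_mul']; ring
  rw [e, pow_mul']
  generalize (2:ℕ) ^ U = P at *
  have h3 : 64 * U ^ 2 * P ^ 2 ≤ 64 * P * P ^ 2 := by gcongr
  have h4 : (64 * P + 3) * P ^ 2 ≤ P ^ 2 * P ^ 2 := by
    refine Nat.mul_le_mul_right _ ?_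
    nlinarith
  nlinarith [Nat.one_le_pow 2 P (by omega)]

/-- `bExp_sub_cavg_selected_le` for the parameters of the algorithm. -/
theorem selected_guarantee (hn : 0 < n) (hm : 0 < m) (hf : SubmodularFun f) (h0 : ∀ x, 0 ≤ f x)
    {U : ℕ} (hU : 18 ≤ U)
    (hrep : Representative ((1 / 2) ^ (34 * U)) (cellSize U) f S)
    (hs : StoresSample f S bits lb) (Z : Finset (Fin n)) (x : Fin n → Bool) (M : ℝ)
    (hZ : Z.card + roundSize U ≤ 4 * U * roundSize U) (hM : ∀ y, f (patch Z x y) ≤ M) :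
    bExp (1 / 2) (fun y => (f (patch Z x y)
        - cavg (cellSelected bits lb m (2 ^ (33 * U)) (2 ^ (34 * U)) (roundSize U) Z x)
          (fun y => f (patch Z x y)) y) ^ 2)
      ≤ 32 * (1 / 2) ^ (2 * U) * M ^ 2 := by
  have h18 : (2:ℝ) ^ 18 ≤ 2 ^ U := pow_le_pow_right₀ (by norm_num) hU
  have h18' : (2:ℕ) ^ 18 ≤ 2 ^ U := Nat.pow_le_pow_right (by norm_num) hU
  have hp : ∀ a b : ℕ, ((1:ℝ) / 2) ^ (a * U + b) = (1 / 2) ^ b * ((1 / 2) ^ U) ^ a := by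
    intro a b; rw [pow_add, pow_mul']; ring
  set q : ℝ := (1 / 2) ^ U with hq
  have hqpos : 0 < q := by positivity
  have hq18 : q ≤ (1 / 2) ^ 18 := pow_le_pow_of_le_one (by norm_num) (by norm_num) hU
  have hq1 : q ≤ 1 := hq18.trans (by norm_num)
  have hqU : q * 2 ^ U = 1 := by rw [hq, ← mul_pow]; norm_num
  have hm1 : ∀ k, ((1:ℝ) / 2) ^ (k * U) * 2 ^ (k * U) = 1 := by
    intro k; rw [← mul_pow]; norm_num
  have h2U : 2 ≤ roundSize U := by
    rw [roundSize]
    have : 1 ≤ 2 ^ (2 * U + 4) := Nat.one_le_two_pow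
    nlinarith
  have htau : ((1:ℝ) / 2) ^ (34 * U) = q ^ 34 := by rw [hq, ← pow_mul, mul_comm]
  have hU0 : 0 < U := by omega
  have h34 : ((1:ℝ) / 2) ^ (34 * U) ≤ q ^ 2 * (1 / 2) ^ 18 := by
    have : q ^ 34 = q ^ 2 * q * q ^ 31 := by ring
    rw [htau, this]
    have h31 : q ^ 31 ≤ 1 := pow_le_one₀ hqpos.le hq1
    have := mul_le_mul_of_nonneg_left hq18 (by positivity : 0 ≤ q ^ 2)
    have := mul_le_mul_of_nonneg_left h31 (by positivity : 0 ≤ q ^ 2 * q)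
    linarith
  have hcell : cellSize U = 4 * U * roundSize U + 3 := rfl
  have hmain := bExp_sub_cavg_selected_le (K := 2 ^ (34 * U)) (D := roundSize U) (k := 40 * U)
    (N := 2 ^ (33 * U)) (α := 20 * q ^ 2) (κ := q ^ 2) hn hm hf h0 hrep hs
    (isActive_cellActive hs Z) (by positivity)
    (by
      push_cast
      have e : (2:ℝ) ^ (33 * U) * q ^ 33 = 1 := by
        rw [hq, ← pow_mul, mul_comm U, mul_comm]; exact hm1 33
      have : ((1:ℝ) / 2) ^ (34 * U) * (4 * 2 ^ (33 * U)) = 4 * q * (2 ^ (33 * U) * q ^ 33) := by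
        rw [htau]; ring
      rw [this, e]
      linarith [hq18, (by norm_num : (4:ℝ) * (1 / 2) ^ 18 ≤ 1)])
    (by positivity)
    (h34.trans (by
      have : q ^ 2 ≤ 1 := pow_le_one₀ hqpos.le hq1
      nlinarith [(by norm_num : ((1:ℝ) / 2) ^ 18 ≤ 1 / 100)]))
    (by omega) (by omega) (by omega)
    (by
      rw [roundSize]
      push_cast
      have e : (2:ℝ) ^ (2 * U + 4) * q ^ 2 = 16 := by
        have : (2:ℝ) ^ (2 * U + 4) * q ^ 2 = 16 * (q * 2 ^ U) ^ 2 := by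
          rw [pow_add, pow_mul']; ring
        rw [this, hqU]; norm_num
      have : (U:ℝ) * 2 ^ (2 * U + 4) * (20 * q ^ 2) = 20 * U * (2 ^ (2 * U + 4) * q ^ 2) := by ring
      rw [this, e]
      linarith)
    (by omega) (by positivity) (by positivity) (pow_le_one₀ hqpos.le hq1)
    (by
      push_cast
      have e : (q ^ 2) ^ 16 * (2:ℝ) ^ (33 * U) = (q * 2 ^ U) ^ 32 * 2 ^ U := by
        rw [pow_mul']; ring
      rw [e, hqU]
      linarith [(by norm_num : (12:ℝ) ≤ 2 ^ 18)])
    (by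
      have h1 := cellSize_le hU
      have h2 : (2:ℕ) ^ (4 * U) ≤ 2 ^ (33 * U) := Nat.pow_le_pow_right (by norm_num) (by omega)
      have h3 : (2:ℕ) ^ (34 * U) = 2 ^ U * 2 ^ (33 * U) := by rw [← pow_add]; congr 1; ring
      have h4 : 5 * 2 ^ (33 * U) ≤ 2 ^ U * 2 ^ (33 * U) :=
        Nat.mul_le_mul_right _ (by omega)
      omega) hM
  refine hmain.trans (mul_le_mul_of_nonneg_right ?_ (sq_nonneg M))
  have e1 : ((2 ^ (34 * U) : ℕ) : ℝ) * (1 / 2) ^ (40 * U) / 2 ≤ q ^ 2 := by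
    push_cast
    have : (2:ℝ) ^ (34 * U) * (1 / 2) ^ (40 * U) = (q * 2 ^ U) ^ 34 * q ^ 6 := by
      rw [pow_mul', pow_mul' (1 / 2 : ℝ)]; ring
    rw [this, hqU]
    have h6 : q ^ 6 = q ^ 2 * q ^ 4 := by ring
    have h4 : q ^ 4 ≤ 1 := pow_le_one₀ hqpos.le hq1
    nlinarith [sq_nonneg q]
  have e2 : ((1:ℝ) / 2) ^ (2 * U) = q ^ 2 := by rw [pow_mul']
  rw [e2]
  have e3 : 0 ≤ q ^ 2 := sq_nonneg q
  linarith [(by norm_num : (18:ℝ) * (1 / 2) ^ 18 ≤ 1)]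

/-- The number of examples suffices for `uniformProb_not_representative_le`. -/
theorem sampleSize_large (hn : 0 < n) {U l : ℕ} (hU : 18 ≤ U) (hl : 2 * n ≤ 2 ^ l) :
    12 * (2 * n : ℝ) ^ cellSize U ≤ Real.exp (sampleSize U l
      * ((1 / 2) ^ (34 * U)) ^ 2 * (1 / 2) ^ cellSize U / 16) := by
  set t := cellSize U with ht
  have hl1 : 1 ≤ l := by
    rcases l with - | l
    · simp at hl; omega
    · omega
  have e : (sampleSize U l : ℝ) * ((1 / 2) ^ (34 * U)) ^ 2 * (1 / 2) ^ t / 16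
      = l * 2 ^ t * (2 ^ (2 * U) / 16) := by
    rw [sampleSize, ← ht]
    push_cast
    rw [← pow_mul, show 2 * t + 70 * U = t + t + (34 * U * 2 + 2 * U) by ring, pow_add, pow_add,
      pow_add]
    have h1 : (2:ℝ) ^ (34 * U * 2) * (1 / 2) ^ (34 * U * 2) = 1 := by rw [← mul_pow]; norm_num
    have h2 : (2:ℝ) ^ t * (1 / 2) ^ t = 1 := by rw [← mul_pow]; norm_num
    linear_combination (l * 2 ^ t * 2 ^ (2 * U) / 16 * (2 ^ t * (1 / 2) ^ t) : ℝ) * h1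
      + (l * 2 ^ t * 2 ^ (2 * U) / 16 : ℝ) * h2
  rw [e]
  have h1 : (4 + l * t : ℝ) ≤ l * 2 ^ t * (2 ^ (2 * U) / 16) := by
    have h2 : (t + 1 : ℝ) ≤ 2 ^ t := by exact_mod_cast Nat.lt_two_pow_self
    have h3 : (2:ℝ) ^ 36 ≤ 2 ^ (2 * U) := pow_le_pow_right₀ (by norm_num) (by omega)
    have hl1' : (1:ℝ) ≤ l := by exact_mod_cast hl1
    have h4 : (4:ℝ) ≤ 2 ^ (2 * U) / 16 := by norm_num at h3 ⊢; linarith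
    have h5 : (l:ℝ) * (t + 1) * 4 ≤ l * 2 ^ t * (2 ^ (2 * U) / 16) := by gcongr
    have h6 : 0 ≤ (l:ℝ) * t := by positivity
    nlinarith
  calc 12 * (2 * n : ℝ) ^ t ≤ 2 ^ 4 * ((2:ℝ) ^ l) ^ t := by
        have : (2 * n : ℝ) ≤ 2 ^ l := by exact_mod_cast hl
        gcongr
        norm_num
    _ = 2 ^ (4 + l * t) := by rw [pow_add, pow_mul]
    _ ≤ Real.exp 1 ^ (4 + l * t) := by
        refine pow_le_pow_left₀ (by norm_num) ?_ _
        linarith [Real.add_one_le_exp 1]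
    _ = Real.exp (4 + l * t) := by rw [← Real.exp_nat_mul]; push_cast; ring_nf
    _ ≤ _ := Real.exp_le_exp.2 h1

/-! ### The prediction is correct at most points -/

/-- If `y` is close to the mean `μ`, then the empirical mean `s / c`, increased by the factor
`1 + γ / 4`, lies between `y` and `(1 + γ) y`. -/
theorem prediction_correct {γ τ μ c a s y : ℝ} (hγ : 0 < γ) (hγ1 : γ ≤ 1) (hμ : 0 ≤ μ)
    (ha : 0 < a) (hτ : τ ≤ γ / 100) (hs : |s - a * μ| ≤ τ * (a * μ))
    (hc : |c - a| ≤ τ * a) (hy : |y - μ| ≤ γ / 8 * μ) :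
    y ≤ (1 + γ / 4) * (s / c) ∧ (1 + γ / 4) * (s / c) ≤ (1 + γ) * y := by
  rw [abs_le] at hs hc hy
  have hτa : τ * a ≤ γ / 100 * a := mul_le_mul_of_nonneg_right hτ ha.le
  have hτaμ : τ * (a * μ) ≤ γ / 100 * (a * μ) := mul_le_mul_of_nonneg_right hτ (by positivity)
  have hcpos : 0 < c := by nlinarith
  have haμ : 0 ≤ a * μ := by positivity
  have hγaμ : 0 ≤ γ * (a * μ) := by positivity
  have hγ2 : γ * (γ * (a * μ)) ≤ 1 * (γ * (a * μ)) := mul_le_mul_of_nonneg_right hγ1 hγaμ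
  have hγ20 : 0 ≤ γ * (γ * (a * μ)) := by positivity
  have hclo : (1 - γ / 100) * a ≤ c := by linarith
  have hchi : c ≤ (1 + γ / 100) * a := by linarith
  constructor
  · rw [← mul_div_assoc, le_div_iff₀ hcpos]
    have h1 : y * c ≤ (1 + γ / 8) * μ * ((1 + γ / 100) * a) := by
      refine (mul_le_mul_of_nonneg_right (by linarith [hy.2] : y ≤ (1 + γ / 8) * μ)
        hcpos.le).trans (mul_le_mul_of_nonneg_left hchi (by positivity))
    have h2 : (1 + γ / 4) * ((1 - γ / 100) * (a * μ)) ≤ (1 + γ / 4) * s :=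
      mul_le_mul_of_nonneg_left (by linarith [hs.1]) (by linarith)
    linarith
  · rw [← mul_div_assoc, div_le_iff₀ hcpos]
    have h1 : (1 + γ) * ((1 - γ / 8) * μ) * ((1 - γ / 100) * a) ≤ (1 + γ) * y * c := by
      refine (mul_le_mul_of_nonneg_left hclo ?_).trans (mul_le_mul_of_nonneg_right ?_ hcpos.le)
      · exact mul_nonneg (by linarith) (mul_nonneg (by linarith) hμ)
      · exact mul_le_mul_of_nonneg_left (by linarith [hy.1]) (by linarith)
    have h2 : (1 + γ / 4) * s ≤ (1 + γ / 4) * ((1 + γ / 100) * (a * μ)) :=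
      mul_le_mul_of_nonneg_left (by linarith [hs.2]) (by linarith)
    have h3 : γ * (γ * (γ * (a * μ))) ≤ 1 * (γ * (γ * (a * μ))) :=
      mul_le_mul_of_nonneg_right hγ1 hγ20
    have h4 : 0 ≤ γ * (γ * (γ * (a * μ))) := by positivity
    linarith

/-- On a representative sample the hypothesis is a multiplicative approximation. -/
theorem multApprox_prediction (hn : 0 < n) (hm : 0 < m) (hf : SubmodularFun f)
    (h0 : ∀ x, 0 ≤ f x) {γ ε : ℝ} (hγ : 0 < γ) (hγ1 : γ ≤ 1) (hε : 0 < ε) (hε1 : ε ≤ 1) {L U : ℕ}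
    (hU : U = L + 18) (hL : 1 ≤ 2 ^ L * (ε * γ))
    (hrep : Representative ((1 / 2) ^ (34 * U)) (cellSize U) f S)
    (hs : StoresSample f S bits lb) :
    MultApprox (1 + γ) ε f (fun x =>
      prediction bits lb m n (2 ^ (33 * U)) (2 ^ (34 * U)) (roundSize U) (4 * U) γ
        (bitVal x)) := by
  classical
  have hU18 : 18 ≤ U := by omega
  set τ : ℝ := (1 / 2) ^ (34 * U) with hτ
  set sel : Finset (Fin n) → (Fin n → Bool) → Finset (Fin n) :=
    cellSelected bits lb m (2 ^ (33 * U)) (2 ^ (34 * U)) (roundSize U) with hsel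
  have hqL : ((1:ℝ) / 2) ^ L ≤ ε * γ := by
    have e : ((1:ℝ) / 2) ^ L * 2 ^ L = 1 := by rw [← mul_pow]; norm_num
    have := mul_le_mul_of_nonneg_left hL (by positivity : (0:ℝ) ≤ (1 / 2) ^ L)
    rw [← mul_assoc, e] at this
    linarith
  have hqL0 : (0:ℝ) < (1 / 2) ^ L := by positivity
  have hεγ : ε * γ ≤ γ := by nlinarith
  have hεγ' : ε * γ ≤ ε := by nlinarith
  have hτγ : τ ≤ γ / 100 := by
    have h1 : τ ≤ (1 / 2) ^ (L + 18) := by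
      rw [hτ]
      exact pow_le_pow_of_le_one (by norm_num) (by norm_num) (by omega)
    rw [pow_add] at h1
    have : ((1:ℝ) / 2) ^ 18 ≤ 1 / 100 := by norm_num
    nlinarith
  have hbad := bExp_runTree_bad_le (f := f) (sel := sel) hf h0
    (fun Z x y hxy => by
      have : cellActive bits Z x = cellActive bits Z y := by
        funext s
        have : (∀ j ∈ Z, bits s j = (x j).toNat) ↔ ∀ j ∈ Z, bits s j = (y j).toNat :=
          forall₂_congr fun j hj => by rw [hxy j hj]
        simp only [cellActive, this]
      simp only [hsel, cellSelected, this])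
    (D := roundSize U) (T := 4 * U * roundSize U) (fun Z x => card_cellSelected_le Z)
    (β := 32 * (1 / 2) ^ (2 * U)) (ρ := ε * γ ^ 2 / 2 ^ 24) (η := γ / 8) (by positivity)
    (by positivity) (by positivity) (by linarith)
    (fun Z x M hZ hM => selected_guarantee hn hm hf h0 hU18 hrep hs Z x M hZ hM)
    (4 * U) ∅ ⊥ (by simp)
  have hempty : ∀ y : Fin n → Bool, patch ∅ ⊥ y = y := fun y => by ext i; simp [patch]
  simp only [hempty] at hbad
  -- `ρ = ε γ² / 2 ^ 24` balances the variance left by a round and the accuracy `η = γ / 8`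
  have hsmall : ((4:ℝ) / 5) ^ (4 * U) + 5 * (32 * (1 / 2) ^ (2 * U) / (ε * γ ^ 2 / 2 ^ 24)
      + 8192 * (ε * γ ^ 2 / 2 ^ 24) / (γ / 8) ^ 2) ≤ ε := by
    have h1 : ((4:ℝ) / 5) ^ (4 * U) ≤ ε / 4 := by
      rw [pow_mul]
      have h2 : (((4:ℝ) / 5) ^ 4) ^ U ≤ (1 / 2) ^ U :=
        pow_le_pow_left₀ (by positivity) (by norm_num) _
      have h3 : ((1:ℝ) / 2) ^ U = (1 / 2) ^ L * (1 / 2) ^ 18 := by rw [hU, pow_add]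
      have : ((1:ℝ) / 2) ^ 18 ≤ 1 / 4 := by norm_num
      nlinarith
    have h2 : 8192 * (ε * γ ^ 2 / 2 ^ 24) / (γ / 8) ^ 2 = ε / 32 := by
      field_simp
      norm_num
    have h3 : 32 * (1 / 2) ^ (2 * U) / (ε * γ ^ 2 / 2 ^ 24) ≤ ε / 32 := by
      rw [div_le_iff₀ (by positivity)]
      have h4 : ((1:ℝ) / 2) ^ (2 * U) = ((1 / 2) ^ L) ^ 2 * (1 / 2) ^ 36 := by
        rw [hU, ← pow_mul, ← pow_add]; congr 1; ring
      have h5 : (((1:ℝ) / 2) ^ L) ^ 2 ≤ (ε * γ) ^ 2 := pow_le_pow_left₀ hqL0.le hqL 2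
      rw [h4]
      have h6 : 0 ≤ (ε * γ) ^ 2 := by positivity
      norm_num
      linarith
    rw [h2]
    linarith
  have hgood : ∀ x, |f x - cavg (runTree sel (4 * U) ∅ x) f x|
      ≤ γ / 8 * cavg (runTree sel (4 * U) ∅ x) f x →
      f x ≤ prediction bits lb m n (2 ^ (33 * U)) (2 ^ (34 * U)) (roundSize U) (4 * U) γ (bitVal x)
      ∧ prediction bits lb m n (2 ^ (33 * U)) (2 ^ (34 * U)) (roundSize U) (4 * U) γ (bitVal x)
        ≤ (1 + γ) * f x := by
    intro x hx
    rw [prediction, active_eq_cellActive (queried_lt hn _), toCoords_queried hn]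
    set Z := runTree sel (4 * U) ∅ x with hZ
    have hcard : Z.card ≤ 4 * U * roundSize U := card_runTree_le _
    have hcell : cellSize U = 4 * U * roundSize U + 3 := rfl
    have hact : IsActive S Z x (cellActive bits Z x) := isActive_cellActive hs Z
    have h1 := hrep.activeSum hn hs (by omega) hact
    have h2 := hrep.activeCount hn (by omega) hact
    rw [← mul_assoc] at h1
    have hm' : (0:ℝ) < m := by exact_mod_cast hm
    exact prediction_correct hγ hγ1 (cavg_nonneg h0 x) (by positivity) hτγ h1 h2 hx
  have hprob : uniformProb (fun x => ¬ (f x ≤ prediction bits lb m n (2 ^ (33 * U)) (2 ^ (34 * U))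
      (roundSize U) (4 * U) γ (bitVal x)
      ∧ prediction bits lb m n (2 ^ (33 * U)) (2 ^ (34 * U)) (roundSize U) (4 * U) γ (bitVal x)
        ≤ (1 + γ) * f x)) ≤ ε := by
    refine le_trans ?_ (hbad.trans hsmall)
    rw [uniformProb_cube]
    refine bExp_mono half_nonneg' half_le_one' fun x => ?_
    split_ifs with h3 h4 h4
    · exact le_rfl
    · exact zero_le_one
    · exact absurd (hgood x h4) h3
    · exact le_rfl
  have hcompl := one_sub_uniformProb_not_le (fun x => f x ≤ prediction bits lb m n (2 ^ (33 * U))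
      (2 ^ (34 * U)) (roundSize U) (4 * U) γ (bitVal x)
      ∧ prediction bits lb m n (2 ^ (33 * U)) (2 ^ (34 * U)) (roundSize U) (4 * U) γ (bitVal x)
        ≤ (1 + γ) * f x)
  rw [MultApprox]
  linarith

/-- The hypothesis is a multiplicative approximation with probability at least `2/3`. -/
theorem uniformProb_multApprox (hn : 0 < n) (hf : SubmodularFun f)
    (h0 : ∀ x, 0 ≤ f x) {γ ε : ℝ} (hγ : 0 < γ) (hγ1 : γ ≤ 1) (hε : 0 < ε) (hε1 : ε ≤ 1)
    {L U l : ℕ} (hU : U = L + 18) (hL : 1 ≤ 2 ^ L * (ε * γ)) (hl : 2 * n ≤ 2 ^ l)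
    (hm : m = sampleSize U l) (bits : (Fin m → Fin n → Bool) → ℕ → ℕ → ℕ)
    (lb : (Fin m → Fin n → Bool) → ℕ → ℝ) (hs : ∀ S, StoresSample f S (bits S) (lb S)) :
    2 / 3 ≤ uniformProb (fun S : Fin m → Fin n → Bool => MultApprox (1 + γ) ε f (fun x =>
      prediction (bits S) (lb S) m n (2 ^ (33 * U)) (2 ^ (34 * U)) (roundSize U) (4 * U) γ
        (bitVal x))) := by
  have hm0 : 0 < m := by
    rw [hm, sampleSize]
    have : 0 < l := by
      rcases l with - | l
      · simp at hl; omega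
      · omega
    positivity
  have h1 := uniformProb_not_representative_le (m := m) hf h0
    (τ := (1 / 2) ^ (34 * U)) (by positivity) (pow_le_one₀ (by norm_num) (by norm_num))
    (cellSize U) (by
      rw [hm]
      exact sampleSize_large hn (by omega) hl)
  have h2 := one_sub_uniformProb_not_le (fun S : Fin m → Fin n → Bool =>
    Representative ((1 / 2) ^ (34 * U)) (cellSize U) f S)
  have h3 := uniformProb_mono (fun S hS => multApprox_prediction (S := S) hn hm0 hf h0 hγ hγ1 hε hε1
    hU hL hS (hs S))
  linarith

end Learning

/-! ### Programs with counting loops -/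

namespace RealRAM

/-- The entry `0` of the natural array `a`. -/
def NExp.var (a : ℕ) : NExp := .get a (.const 0)

/-- Equality of naturals. -/
def BExp.eqNat (e₁ e₂ : NExp) : BExp := .conj (.neg (.ltNat e₁ e₂)) (.neg (.ltNat e₂ e₁))

/-- Programs whose loops are counting loops: `iter v B p` executes `p` with the counter `v` running
through `0, …, b - 1`, where `b` is entry `0` of the natural array `B`. -/
inductive Prog where
  | skip
  | setNat (a : ℕ) (i e : NExp)
  | setReal (a : ℕ) (i : NExp) (e : RExp)
  | seq (p q : Prog)
  | ite (b : BExp) (p q : Prog)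
  | iter (v B : ℕ) (p : Prog)

/-- `F (k - 1) (… (F 0 x))`. -/
def stages {α : Type} (F : ℕ → α → α) : ℕ → α → α
  | 0, x => x
  | k + 1, x => F k (stages F k x)

namespace Prog

/-- Execute a list of programs one after the other. -/
def block : List Prog → Prog
  | [] => skip
  | p :: l => seq p (block l)

/-- Translation into the language of the machine. -/
def compile : Prog → Cmd
  | skip => .skip
  | setNat a i e => .setNat a i e
  | setReal a i e => .setReal a i e
  | seq p q => .seq p.compile q.compile
  | ite b p q => .ite b p.compile q.compile
  | iter v B p => .seq (.setNat v (.const 0) (.const 0))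
      (.loop (.ltNat (.var v) (.var B))
        (.seq p.compile (.setNat v (.const 0) (.add (.var v) (.const 1)))))

/-- The natural arrays that a program writes to. -/
def natWrites : Prog → List ℕ
  | skip => []
  | setNat a _ _ => [a]
  | setReal _ _ _ => []
  | seq p q => p.natWrites ++ q.natWrites
  | ite _ p q => p.natWrites ++ q.natWrites
  | iter v _ p => v :: p.natWrites

/-- The real arrays that a program writes to. -/
def realWrites : Prog → List ℕ
  | skip => []
  | setNat _ _ _ => []
  | setReal a _ _ => [a]
  | seq p q => p.realWrites ++ q.realWrites
  | ite _ p q => p.realWrites ++ q.realWrites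
  | iter _ _ p => p.realWrites

/-- The arrays that hold the numbers of iterations of the loops. -/
def bounds : Prog → List ℕ
  | seq p q => p.bounds ++ q.bounds
  | ite _ p q => p.bounds ++ q.bounds
  | iter _ B p => B :: p.bounds
  | _ => []

/-- The program does not change the numbers of iterations of its loops, and the body of a loop does
not change its counter. -/
def WellFormed : Prog → Bool
  | seq p q => p.WellFormed && q.WellFormed && q.bounds.all fun B => decide (B ∉ p.natWrites)
  | ite _ p q => p.WellFormed && q.WellFormed
  | iter v B p => p.WellFormed && decide (v ∉ p.natWrites)
      && (B :: p.bounds).all fun B' => decide (B' ≠ v ∧ B' ∉ p.natWrites)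
  | _ => true

/-- The nesting depth of the loops bounded by one of the variables in `l`. -/
def depth (l : List ℕ) : Prog → ℕ
  | seq p q => max (p.depth l) (q.depth l)
  | ite _ p q => max (p.depth l) (q.depth l)
  | iter _ B p => if B ∈ l then p.depth l + 1 else p.depth l
  | _ => 0

/-- The nesting depth of the loops bounded by none of the variables in `l`. -/
def codepth (l : List ℕ) : Prog → ℕ
  | seq p q => max (p.codepth l) (q.codepth l)
  | ite _ p q => max (p.codepth l) (q.codepth l)
  | iter _ B p => if B ∈ l then p.codepth l else p.codepth l + 1
  | _ => 0

/-- The number of operations in the text of the program. -/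
def size : Prog → ℕ
  | skip => 1
  | setNat _ i e => i.cost + e.cost + 1
  | setReal _ i e => i.cost + e.cost + 1
  | seq p q => p.size + q.size
  | ite b p q => b.cost + 1 + (p.size + q.size)
  | iter _ _ p => p.size + 12

end Prog

section Semantics

variable {n : ℕ}

@[simp] theorem State.putNat_nat_self (s : State n) (a i v : ℕ) :
    (s.putNat a i v).nat a = Function.update (s.nat a) i v := by
  simp [State.putNat]

@[simp] theorem State.putNat_nat_of_ne (s : State n) {a b : ℕ} (i v : ℕ) (h : b ≠ a) :
    (s.putNat a i v).nat b = s.nat b := by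
  simp [State.putNat, h]

@[simp] theorem State.putNat_real (s : State n) (a i v : ℕ) : (s.putNat a i v).real = s.real := rfl

@[simp] theorem State.putReal_real_self (s : State n) (a i : ℕ) (v : ℝ) :
    (s.putReal a i v).real a = Function.update (s.real a) i v := by
  simp [State.putReal]

@[simp] theorem State.putReal_real_of_ne (s : State n) {a b : ℕ} (i : ℕ) (v : ℝ) (h : b ≠ a) :
    (s.putReal a i v).real b = s.real b := by
  simp [State.putReal, h]

@[simp] theorem State.putReal_nat (s : State n) (a i : ℕ) (v : ℝ) :
    (s.putReal a i v).nat = s.nat := rfl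

@[simp] theorem State.putNat_examples (s : State n) (a i v : ℕ) :
    (s.putNat a i v).examples = s.examples := rfl

@[simp] theorem NExp.val_var (s : State n) (a : ℕ) : (NExp.var a).val s = s.nat a 0 := rfl

@[simp] theorem BExp.holds_eqNat (s : State n) (e₁ e₂ : NExp) :
    (BExp.eqNat e₁ e₂).holds s ↔ e₁.val s = e₂.val s := by
  simp only [BExp.eqNat, BExp.holds]
  omega

namespace Prog

open Classical in
/-- The final configuration. -/
noncomputable def eval : Prog → State n → State n
  | skip, s => s
  | setNat a i e, s => s.putNat a (i.val s) (e.val s)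
  | setReal a i e, s => s.putReal a (i.val s) (e.val s)
  | seq p q, s => q.eval (p.eval s)
  | ite b p q, s => if b.holds s then p.eval s else q.eval s
  | iter v B p, s =>
      stages (fun i s' => (p.eval s').putNat v 0 (i + 1)) (s.nat B 0) (s.putNat v 0 0)

theorem eval_nat {p : Prog} {a : ℕ} (h : a ∉ p.natWrites) (s : State n) :
    (p.eval s).nat a = s.nat a := by
  induction p generalizing s with
  | skip => rfl
  | setNat b i e =>
    rw [eval, State.putNat_nat_of_ne]
    simpa [natWrites] using h
  | setReal b i e => rfl
  | seq p q ihp ihq =>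
    simp only [natWrites, List.mem_append, not_or] at h
    rw [eval, ihq h.2, ihp h.1]
  | ite b p q ihp ihq =>
    simp only [natWrites, List.mem_append, not_or] at h
    rw [eval]
    split_ifs
    exacts [ihp h.1 s, ihq h.2 s]
  | iter v B p ih =>
    simp only [natWrites, List.mem_cons, not_or] at h
    rw [eval]
    generalize s.nat B 0 = k
    induction k with
    | zero => rw [stages, State.putNat_nat_of_ne _ _ _ h.1]
    | succ k ihk => rw [stages, State.putNat_nat_of_ne _ _ _ h.1, ih h.2, ihk]

theorem eval_real {p : Prog} {a : ℕ} (h : a ∉ p.realWrites) (s : State n) :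
    (p.eval s).real a = s.real a := by
  induction p generalizing s with
  | skip => rfl
  | setNat b i e => rfl
  | setReal b i e =>
    rw [eval, State.putReal_real_of_ne]
    simpa [realWrites] using h
  | seq p q ihp ihq =>
    simp only [realWrites, List.mem_append, not_or] at h
    rw [eval, ihq h.2, ihp h.1]
  | ite b p q ihp ihq =>
    simp only [realWrites, List.mem_append, not_or] at h
    rw [eval]
    split_ifs
    exacts [ihp h.1 s, ihq h.2 s]
  | iter v B p ih =>
    rw [eval]
    generalize s.nat B 0 = k
    induction k with
    | zero => rw [stages, State.putNat_real]
    | succ k ihk => rw [stages, State.putNat_real, ih h, ihk]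

theorem eval_examples (p : Prog) (s : State n) : (p.eval s).examples = s.examples := by
  induction p generalizing s with
  | skip => rfl
  | setNat b i e => rfl
  | setReal b i e => rfl
  | seq p q ihp ihq => rw [eval, ihq, ihp]
  | ite b p q ihp ihq => rw [eval]; split_ifs; exacts [ihp s, ihq s]
  | iter v B p ih =>
    rw [eval]
    generalize s.nat B 0 = k
    induction k with
    | zero => rfl
    | succ k ihk => rw [stages, State.putNat_examples, ih, ihk]

/-- Reasoning about a counting loop with an invariant; arrays that are not written to in the body
are as they were before the loop. -/
theorem eval_iter {p : Prog} {v B : ℕ} {s : State n}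
    (Inv : ℕ → State n → Prop) (h0 : Inv 0 (s.putNat v 0 0))
    (hstep : ∀ i s', i < s.nat B 0 → s'.nat v 0 = i →
      (∀ a, a ≠ v → a ∉ p.natWrites → s'.nat a = s.nat a) →
      (∀ a, a ∉ p.realWrites → s'.real a = s.real a) →
      Inv i s' → Inv (i + 1) ((p.eval s').putNat v 0 (i + 1))) :
    Inv (s.nat B 0) ((iter v B p).eval s) := by
  rw [eval]
  have key : ∀ k ≤ s.nat B 0,
      let s' := stages (fun i s' => (p.eval s').putNat v 0 (i + 1)) k (s.putNat v 0 0)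
      s'.nat v 0 = k ∧ (∀ a, a ≠ v → a ∉ p.natWrites → s'.nat a = s.nat a) ∧
      (∀ a, a ∉ p.realWrites → s'.real a = s.real a) ∧ Inv k s' := by
    intro k
    induction k with
    | zero =>
      intro _
      exact ⟨by simp [stages], fun a ha _ => by simp [stages, ha], fun a _ => rfl, h0⟩
    | succ k ih =>
      intro hk
      obtain ⟨h1, h2, h3, h4⟩ := ih (by omega)
      refine ⟨by simp [stages], fun a ha ha' => ?_, fun a ha => ?_, ?_⟩
      · rw [stages, State.putNat_nat_of_ne _ _ _ ha, eval_nat ha', h2 a ha ha']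
      · rw [stages, State.putNat_real, eval_real ha, h3 a ha]
      · exact hstep k _ (by omega) h1 h2 h3 h4
  exact (key _ le_rfl).2.2.2

/-- The last `j` iterations of a counting loop. -/
theorem exec_loop {p : Prog} {v B : ℕ} (hv : v ∉ p.natWrites) (hB : B ≠ v)
    (hB' : B ∉ p.natWrites) {T b : ℕ} (P : State n → Prop) (hP : ∀ s i, P s → P (s.putNat v 0 i))
    (hp : ∀ s, P s → P (p.eval s) ∧ ∃ k, Exec p.compile s (p.eval s) k ∧ k ≤ T) (j i : ℕ)
    (hij : i + j = b) (s : State n) (hs : P s) (hsv : s.nat v 0 = i) (hsB : s.nat B 0 = b) :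
    ∃ k, Exec (.loop (.ltNat (.var v) (.var B))
        (.seq p.compile (.setNat v (.const 0) (.add (.var v) (.const 1))))) s
        (stages (fun i' s' => (p.eval s').putNat v 0 (i + i' + 1)) j s) k ∧ k ≤ j * (T + 12) + 6 := by
  induction j generalizing i s with
  | zero =>
    refine ⟨6, ?_, by omega⟩
    have h : ¬ (BExp.ltNat (.var v) (.var B)).holds s := by
      simp only [BExp.holds, NExp.val_var]; omega
    exact Exec.loopFalse (p := .seq p.compile _) h
  | succ j ih =>
    obtain ⟨hs', k, hk, hkT⟩ := hp s hs
    set s₁ := (p.eval s).putNat v 0 (i + 1) with hs₁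
    obtain ⟨k', hk', hkT'⟩ := ih (i + 1) (by omega) s₁ (hP _ _ hs') (by simp [hs₁])
      (by rw [hs₁, State.putNat_nat_of_ne _ _ _ hB, eval_nat hB', hsB])
    have hset : Exec (.setNat v (.const 0) (.add (.var v) (.const 1))) (p.eval s) s₁ 6 := by
      have := Exec.setNat v (.const 0) (.add (.var v) (.const 1)) (p.eval s)
      have e : (NExp.add (.var v) (.const 1)).val (p.eval s) = i + 1 := by
        simp [NExp.val, eval_nat hv, hsv]
      rw [e] at this
      exact this
    have hstages : ∀ j, stages (fun i' s' => (p.eval s').putNat v 0 (i + i' + 1)) (j + 1) s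
        = stages (fun i' s' => (p.eval s').putNat v 0 (i + 1 + i' + 1)) j s₁ := by
      intro j
      induction j with
      | zero => rfl
      | succ j ihj =>
        rw [stages, ihj, stages]
        congr 1
        omega
    have h : (BExp.ltNat (.var v) (.var B)).holds s := by
      simp only [BExp.holds, NExp.val_var]; omega
    rw [hstages]
    refine ⟨_, Exec.loopTrue h (Exec.seq hk hset) hk', ?_⟩
    have : (BExp.ltNat (.var v) (.var B)).cost = 5 := rfl
    rw [this]
    linarith

/-- Running time: the number of steps is polynomial in a bound `A` for the numbers of iterations of
some of the loops and a bound `W` for those of the others. -/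
theorem exec (l : List ℕ) {A W : ℕ} (hA : 1 ≤ A) (hW : 1 ≤ W) (p : Prog) (hp : p.WellFormed = true)
    (s : State n) (hb : ∀ B ∈ p.bounds, s.nat B 0 + 1 ≤ if B ∈ l then A else W) :
    ∃ k, Exec p.compile s (p.eval s) k ∧ k ≤ p.size * (A ^ p.depth l * W ^ p.codepth l) := by
  have hpow : ∀ {a b c d : ℕ}, a ≤ b → c ≤ d → A ^ a * W ^ c ≤ A ^ b * W ^ d := fun h h' =>
    Nat.mul_le_mul (Nat.pow_le_pow_right hA h) (Nat.pow_le_pow_right hW h')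
  induction p generalizing s with
  | skip => exact ⟨_, Exec.skip s, by simp [size, depth, codepth]⟩
  | setNat a i e => exact ⟨_, Exec.setNat a i e s, by simp [size, depth, codepth]⟩
  | setReal a i e => exact ⟨_, Exec.setReal a i e s, by simp [size, depth, codepth]⟩
  | seq p q ihp ihq =>
    simp only [WellFormed, Bool.and_eq_true, List.all_eq_true, decide_eq_true_eq] at hp
    simp only [bounds, List.mem_append] at hb
    obtain ⟨k, hk, hk'⟩ := ihp hp.1.1 s fun B hB => hb B (Or.inl hB)
    obtain ⟨k₂, hk₂, hk₂'⟩ := ihq hp.1.2 (p.eval s) fun B hB => by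
      rw [eval_nat (hp.2 B hB)]; exact hb B (Or.inr hB)
    refine ⟨k + k₂, Exec.seq hk hk₂, ?_⟩
    rw [size, depth, codepth, add_mul]
    exact add_le_add
      (hk'.trans (Nat.mul_le_mul_left _ (hpow (le_max_left _ _) (le_max_left _ _))))
      (hk₂'.trans (Nat.mul_le_mul_left _ (hpow (le_max_right _ _) (le_max_right _ _))))
  | ite b p q ihp ihq =>
    simp only [WellFormed, Bool.and_eq_true] at hp
    simp only [bounds, List.mem_append] at hb
    have hpos : ∀ a c : ℕ, 1 ≤ A ^ a * W ^ c := fun a c =>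
      Nat.mul_pos (Nat.pow_pos hA) (Nat.pow_pos hW)
    rw [eval, size, depth, codepth]
    have h1 := Nat.mul_le_mul_left (b.cost + 1)
      (hpos (max (p.depth l) (q.depth l)) (max (p.codepth l) (q.codepth l)))
    split_ifs with h
    · obtain ⟨k, hk, hk'⟩ := ihp hp.1 s fun B hB => hb B (Or.inl hB)
      refine ⟨_, Exec.iteTrue h hk, ?_⟩
      have := hk'.trans (Nat.mul_le_mul_left _
        (hpow (le_max_left _ (q.depth l)) (le_max_left _ (q.codepth l))))
      have := Nat.zero_le (q.size * (A ^ max (p.depth l) (q.depth l)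
        * W ^ max (p.codepth l) (q.codepth l)))
      linarith
    · obtain ⟨k, hk, hk'⟩ := ihq hp.2 s fun B hB => hb B (Or.inr hB)
      refine ⟨_, Exec.iteFalse h hk, ?_⟩
      have := hk'.trans (Nat.mul_le_mul_left _
        (hpow (le_max_right (p.depth l) _) (le_max_right (p.codepth l) _)))
      have := Nat.zero_le (p.size * (A ^ max (p.depth l) (q.depth l)
        * W ^ max (p.codepth l) (q.codepth l)))
      linarith
  | iter v B p ih =>
    simp only [WellFormed, Bool.and_eq_true, List.all_eq_true, decide_eq_true_eq] at hp
    obtain ⟨⟨hp, hv⟩, hB⟩ := hp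
    simp only [bounds] at hb
    have hB1 := hB B (by simp)
    obtain ⟨k, hk, hk'⟩ := exec_loop hv hB1.1 hB1.2
      (fun s : State n => ∀ B ∈ p.bounds, s.nat B 0 + 1 ≤ if B ∈ l then A else W)
      (fun s i hs B' hB' => by
        rw [State.putNat_nat_of_ne _ _ _ (hB B' (by simp [hB'])).1]; exact hs B' hB')
      (fun s hs => ⟨fun B' hB' => by
        rw [eval_nat (hB B' (by simp [hB'])).2]; exact hs B' hB', ih hp s hs⟩)
      (s.nat B 0) 0 (Nat.zero_add _) (s.putNat v 0 0)
      (fun B' hB' => by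
        rw [State.putNat_nat_of_ne _ _ _ (hB B' (by simp [hB'])).1]; exact hb B' (by simp [hB']))
      (by simp) (by rw [State.putNat_nat_of_ne _ _ _ hB1.1])
    have hset : Exec (.setNat v (.const 0) (.const 0)) s (s.putNat v 0 0) 3 :=
      Exec.setNat v (.const 0) (.const 0) s
    refine ⟨3 + k, ?_, ?_⟩
    · have := Exec.seq hset hk
      simp only [zero_add] at this
      exact this
    · have hpos : 1 ≤ A ^ p.depth l * W ^ p.codepth l :=
        Nat.mul_pos (Nat.pow_pos hA) (Nat.pow_pos hW)
      have hBb := hb B (by simp)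
      set X := A ^ p.depth l * W ^ p.codepth l with hX
      have h1 : 3 + k ≤ (s.nat B 0 + 1) * ((p.size + 12) * X) := by
        have : p.size * X + 12 ≤ (p.size + 12) * X := by nlinarith
        have := Nat.mul_le_mul_left (s.nat B 0) this
        nlinarith
      rw [size, depth, codepth]
      split_ifs with h
      · rw [if_pos h] at hBb
        refine h1.trans ((Nat.mul_le_mul_right _ hBb).trans (le_of_eq ?_))
        rw [hX, pow_succ]; ring
      · rw [if_neg h] at hBb
        refine h1.trans ((Nat.mul_le_mul_right _ hBb).trans (le_of_eq ?_))
        rw [hX, pow_succ]; ring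

end Prog

end Semantics

end RealRAM

/-! ### The program that evaluates the hypothesis -/

namespace RealRAM

namespace Mem

/-- Natural array: the point at which the hypothesis is evaluated. -/
abbrev point : ℕ := 1
/-- Natural variable: number `m` of examples. -/
abbrev numEx : ℕ := 2
/-- Natural variable: `n + 1`. -/
abbrev dimSucc : ℕ := 3
/-- Natural variable: reciprocal `N` of the detection threshold. -/
abbrev thr : ℕ := 4
/-- Natural variable: bound `K` for the number of detected coordinates. -/
abbrev base : ℕ := 5
/-- Natural variable: number `D` of coordinates queried per round. -/
abbrev width : ℕ := 6
/-- Natural variable: number `R` of rounds. -/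
abbrev rounds : ℕ := 7
/-- Natural variable: number `K ^ D` of tuples. -/
abbrev codes : ℕ := 8
/-- Natural variable: bound `R D` for the number of queried coordinates. -/
abbrev maxLen : ℕ := 9
/-- Natural array: the bits of the examples. -/
abbrev bits : ℕ := 10
/-- Natural array: the position in `bits` at which the example starts. -/
abbrev start : ℕ := 11
/-- Natural array: `1` at the active examples. -/
abbrev act : ℕ := 12
/-- Natural array: the detected coordinates. -/
abbrev det : ℕ := 13
/-- Natural array: the queried coordinates, followed by a tuple that is being tested. -/
abbrev lst : ℕ := 14
/-- Natural variable: number of queried coordinates. -/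
abbrev len : ℕ := 15
/-- Natural variable: number of detected coordinates. -/
abbrev detLen : ℕ := 16
/-- Natural variable: coordinate. -/
abbrev i : ℕ := 17
/-- Natural variable: coordinate that is paired with `i`. -/
abbrev j : ℕ := 18
/-- Natural variable: index of an example. -/
abbrev ex : ℕ := 19
/-- Natural variable: index of an example that is compared with `ex`. -/
abbrev ex' : ℕ := 20
/-- Natural variable: position in `lst` or in `det`. -/
abbrev pos : ℕ := 21
/-- Natural variable: code of the candidate tuple. -/
abbrev cand : ℕ := 22
/-- Natural variable: round. -/
abbrev round : ℕ := 23
/-- Natural variable: loop counter. -/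
abbrev cnt : ℕ := 24
/-- Natural variable: outcome of a test. -/
abbrev flag : ℕ := 25
/-- Natural variable: code of the tuple to be decoded. -/
abbrev code : ℕ := 26
/-- Natural variable: code of the best tuple so far. -/
abbrev best : ℕ := 27
/-- Natural variable: remainder. -/
abbrev rem : ℕ := 28
/-- Natural variable: quotient. -/
abbrev quo : ℕ := 29

/-- Real array: labels of the examples. -/
abbrev lab : ℕ := 1
/-- Real variable: sum of the labels of the active examples. -/
abbrev tot : ℕ := 2
/-- Real variable: correlation. -/
abbrev cor : ℕ := 3
/-- Real variable: sum of the labels in a group of examples. -/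
abbrev gsum : ℕ := 4
/-- Real variable: number of examples in a group. -/
abbrev gcnt : ℕ := 5
/-- Real variable: energy. -/
abbrev en : ℕ := 6
/-- Real variable: largest energy so far. -/
abbrev top : ℕ := 7
/-- Real variable: number of active examples. -/
abbrev num : ℕ := 8

end Mem

variable {n : ℕ}

/-- The bits of the examples stored in the memory. -/
def State.bitsOf (s : State n) (k i : ℕ) : ℕ := s.nat Mem.bits (s.nat Mem.start k + i)

/-- The list stored in the array `lst` from position `o` to position `o + k - 1`. -/
def State.segment (s : State n) (o k : ℕ) : List ℕ :=
  (List.range k).map fun p => s.nat Mem.lst (o + p)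

theorem State.bitsOf_congr {s s' : State n} (h1 : s'.nat Mem.bits = s.nat Mem.bits)
    (h2 : s'.nat Mem.start = s.nat Mem.start) : s'.bitsOf = s.bitsOf := by
  funext k i
  rw [State.bitsOf, State.bitsOf, h1, h2]

theorem State.segment_congr {s s' : State n} (h : s'.nat Mem.lst = s.nat Mem.lst) (o k : ℕ) :
    s'.segment o k = s.segment o k := by
  rw [State.segment, State.segment, h]

theorem State.forall_segment {s : State n} {o k : ℕ} {P : ℕ → Prop} :
    (∀ i ∈ s.segment o k, P i) ↔ ∀ p < k, P (s.nat Mem.lst (o + p)) := by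
  simp [State.segment]

/-- Bit `i` of example `k`. -/
def NExp.bit (k i : NExp) : NExp := .get Mem.bits (.add (.get Mem.start k) i)

theorem NExp.val_bit (s : State n) (k i : NExp) :
    (NExp.bit k i).val s = s.bitsOf (k.val s) (i.val s) := rfl

/-- The entry `0` of the real array `a`. -/
def RExp.var (a : ℕ) : RExp := .get a (.const 0)

theorem RExp.val_var (s : State n) (a : ℕ) : (RExp.var a).val s = s.real a 0 := rfl

namespace Prog

theorem eval_block_nil (s : State n) : (block []).eval s = s := rfl
theorem eval_block_cons (p : Prog) (l : List Prog) (s : State n) :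
    (block (p :: l)).eval s = (block l).eval (p.eval s) := rfl
theorem eval_skip (s : State n) : skip.eval s = s := rfl
theorem eval_setNat (a : ℕ) (i e : NExp) (s : State n) :
    (setNat a i e).eval s = s.putNat a (i.val s) (e.val s) := rfl
theorem eval_setReal (a : ℕ) (i : NExp) (e : RExp) (s : State n) :
    (setReal a i e).eval s = s.putReal a (i.val s) (e.val s) := rfl

/-- Assign to entry `0` of a natural array. -/
def letNat (a : ℕ) (e : NExp) : Prog := setNat a (.const 0) e

/-- Assign to entry `0` of a real array. -/
def letReal (a : ℕ) (e : RExp) : Prog := setReal a (.const 0) e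

theorem eval_letNat (a : ℕ) (e : NExp) (s : State n) :
    (letNat a e).eval s = s.putNat a 0 (e.val s) := rfl
theorem eval_letReal (a : ℕ) (e : RExp) (s : State n) :
    (letReal a e).eval s = s.putReal a 0 (e.val s) := rfl

open Classical in
theorem eval_ite (b : BExp) (p q : Prog) (s : State n) :
    (ite b p q).eval s = if b.holds s then p.eval s else q.eval s := rfl

/-! ### Active examples -/

open Mem

/-- One step of the test whether an example agrees with the point on all queried coordinates. -/
def markStep : Prog :=
  ite (.conj (.ltNat (.var pos) (.var len))
      (.neg (.eqNat (.bit (.var ex) (.get lst (.var pos))) (.get point (.get lst (.var pos))))))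
    (setNat act (.var ex) (.const 0)) skip

/-- Mark one example as active or not. -/
def markOne : Prog := block [setNat act (.var ex) (.const 1), iter pos maxLen markStep]

/-- Mark the active examples. -/
def mark : Prog := iter ex numEx markOne

theorem eval_markOne (s : State n) (hlen : s.nat len 0 ≤ s.nat maxLen 0) :
    (markOne.eval s).nat act = Function.update (s.nat act) (s.nat ex 0)
      (active s.bitsOf (s.nat point) (s.segment 0 (s.nat len 0)) (s.nat ex 0)) := by
  classical
  simp only [markOne, eval_block_cons, eval_block_nil, eval_setNat, NExp.val_var, NExp.val]
  set s₁ := s.putNat act (s.nat ex 0) 1 with hs₁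
  have key := eval_iter (s := s₁) (v := pos) (B := maxLen) (p := markStep) (fun k s' =>
    s'.nat act = Function.update (s.nat act) (s.nat ex 0)
      (if ∀ p < k, p < s.nat len 0 → s.bitsOf (s.nat ex 0) (s.nat lst p)
        = s.nat point (s.nat lst p) then 1 else 0)) (by simp +decide [hs₁]) (by
    intro k s' hk hv hn _ hI
    have e1 : s'.nat len = s.nat len := (hn _ (by decide) (by decide)).trans (by simp +decide [hs₁])
    have e2 : s'.nat ex = s.nat ex := (hn _ (by decide) (by decide)).trans (by simp +decide [hs₁])
    have e3 : s'.nat lst = s.nat lst := (hn _ (by decide) (by decide)).trans (by simp +decide [hs₁])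
    have e4 : s'.nat point = s.nat point :=
      (hn _ (by decide) (by decide)).trans (by simp +decide [hs₁])
    have e5 : s'.bitsOf = s.bitsOf := State.bitsOf_congr
      ((hn _ (by decide) (by decide)).trans (by simp +decide [hs₁]))
      ((hn _ (by decide) (by decide)).trans (by simp +decide [hs₁]))
    rw [State.putNat_nat_of_ne _ _ _ (by decide), markStep, eval_ite, eval_skip, eval_setNat]
    simp only [BExp.holds, BExp.holds_eqNat, NExp.val_var, NExp.val_bit, NExp.val, hv, e1, e2, e3,
      e4, e5]
    split_ifs with h1 h2 h2
    · exact absurd (h2 k (by omega) h1.1) h1.2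
    · rw [State.putNat_nat_self, hI, Function.update_idem]
    · rw [hI, if_pos (fun p hp => h2 p (by omega))]
    · rw [hI, if_neg]
      refine fun h => h2 fun p hp hp' => ?_
      rcases Nat.lt_succ_iff_lt_or_eq.1 hp with hp | rfl
      · exact h p hp hp'
      · by_contra hne
        exact h1 ⟨hp', hne⟩)
  rw [key, active]
  have e : s₁.nat maxLen 0 = s.nat maxLen 0 := by simp +decide [hs₁]
  congr 1
  refine if_congr ?_ rfl rfl
  rw [State.forall_segment, e]
  constructor
  · intro h p hp
    rw [zero_add]
    exact h p (by omega) hp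
  · intro h p _ hp
    have := h p hp
    rwa [zero_add] at this

/-- The program `mark` computes the function `active`. -/
theorem eval_mark (s : State n) (hlen : s.nat len 0 ≤ s.nat maxLen 0) :
    ∀ k < s.nat numEx 0, (mark.eval s).nat act k
      = active s.bitsOf (s.nat point) (s.segment 0 (s.nat len 0)) k := by
  refine eval_iter (s := s) (v := ex) (B := numEx) (p := markOne) (fun r s' =>
    ∀ k < r, s'.nat act k = active s.bitsOf (s.nat point) (s.segment 0 (s.nat len 0)) k)
    (by simp) ?_
  intro r s' hr hv hn _ hI k hk
  have e1 : s'.nat len = s.nat len := hn _ (by decide) (by decide)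
  have e2 : s'.nat maxLen = s.nat maxLen := hn _ (by decide) (by decide)
  have e3 : s'.nat lst = s.nat lst := hn _ (by decide) (by decide)
  have e4 : s'.nat point = s.nat point := hn _ (by decide) (by decide)
  have e5 : s'.bitsOf = s.bitsOf := State.bitsOf_congr (hn _ (by decide) (by decide))
    (hn _ (by decide) (by decide))
  rw [State.putNat_nat_of_ne _ _ _ (by decide), eval_markOne s' (by rw [e1, e2]; exact hlen), hv, e1,
    e4, e5, State.segment_congr e3]
  rcases Nat.lt_succ_iff_lt_or_eq.1 hk with hk | rfl
  · rw [Function.update_of_ne (by omega), hI k hk]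
  · rw [Function.update_self]

/-- One step of a sum over the active examples. -/
def sumStep (a : ℕ) (w : RExp) : Prog :=
  ite (.eqNat (.get act (.var ex)) (.const 1)) (letReal a (.add (.var a) w)) skip

/-- The sum of `w` over the active examples. -/
def sumActive (a : ℕ) (w : RExp) : Prog := block [letReal a (.ofNat (.const 0)),
  iter ex numEx (sumStep a w)]

theorem eval_sumActive {a : ℕ} {w : RExp} (s : State n) (ha : a ≠ lab) (φ : ℕ → ℝ)
    (hw : ∀ s' : State n, s'.real lab = s.real lab → w.val s' = φ (s'.nat ex 0)) :
    ((sumActive a w).eval s).real a 0 = activeSum φ (s.nat numEx 0) (s.nat act) := by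
  classical
  simp only [sumActive, eval_block_cons, eval_block_nil, eval_letReal]
  set s₁ := s.putReal a 0 (RExp.val s (.ofNat (.const 0))) with hs₁
  refine eval_iter (s := s₁) (v := ex) (B := numEx) (p := sumStep a w) (fun k s' =>
    s'.real a 0 = activeSum φ k (s.nat act)) (by simp [hs₁, RExp.val, NExp.val, activeSum]) ?_
  intro k s' hk hv hn hr hI
  have e1 : s'.nat act = s.nat act := hn _ (by decide) (by simp [sumStep, natWrites, letReal])
  have e2 : s'.real lab = s.real lab := (hr _ (by
    simp only [sumStep, realWrites, letReal, List.append_nil, List.mem_singleton]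
    exact ha.symm)).trans (by rw [hs₁, State.putReal_real_of_ne _ _ _ ha.symm])
  rw [State.putNat_real, sumStep, eval_ite, eval_skip, eval_letReal]
  simp only [BExp.holds_eqNat, NExp.val_var, NExp.val, hv, e1]
  rw [activeSum, Finset.sum_range_succ, ← activeSum]
  split_ifs with h1
  · rw [State.putReal_real_self, Function.update_self, RExp.val, RExp.val_var, hI, hw s' e2, hv]
  · rw [hI, add_zero]

/-! ### Detected coordinates -/

/-- One step of the computation of a correlation. -/
def corrStep : Prog :=
  ite (.eqNat (.get act (.var ex)) (.const 1))
    (ite (.eqNat (.bit (.var ex) (.var i)) (.bit (.var ex) (.var j)))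
      (letReal cor (.add (.var cor) (.get lab (.var ex))))
      (letReal cor (.sub (.var cor) (.get lab (.var ex))))) skip

/-- The correlation of the labels with a pair of bits. -/
def correlate : Prog := block [letReal cor (.ofNat (.const 0)), iter ex numEx corrStep]

theorem eval_correlate (s : State n) : (correlate.eval s).real cor 0
    = corrSum s.bitsOf (s.real lab) (s.nat numEx 0) (s.nat act) (s.nat i 0) (s.nat j 0) := by
  classical
  simp only [correlate, eval_block_cons, eval_block_nil, eval_letReal]
  set s₁ := s.putReal cor 0 (RExp.val s (.ofNat (.const 0))) with hs₁
  refine eval_iter (s := s₁) (v := ex) (B := numEx) (p := corrStep) (fun k s' =>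
    s'.real cor 0 = corrSum s.bitsOf (s.real lab) k (s.nat act) (s.nat i 0) (s.nat j 0))
    (by simp [hs₁, RExp.val, NExp.val, corrSum]) ?_
  intro k s' hk hv hn hr hI
  have e1 : s'.nat act = s.nat act := hn _ (by decide) (by decide)
  have e2 : s'.real lab = s.real lab := (hr _ (by decide)).trans (by simp +decide [hs₁])
  have e3 : s'.nat i = s.nat i := hn _ (by decide) (by decide)
  have e4 : s'.nat j = s.nat j := hn _ (by decide) (by decide)
  have e5 : s'.bitsOf = s.bitsOf := State.bitsOf_congr (hn _ (by decide) (by decide))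
    (hn _ (by decide) (by decide))
  rw [State.putNat_real, corrStep]
  simp only [eval_ite, eval_skip, eval_letReal, BExp.holds_eqNat, NExp.val_var, NExp.val_bit,
    NExp.val, RExp.val, RExp.val_var, hv, e1, e2, e3, e4, e5]
  rw [corrSum, Finset.sum_range_succ, ← corrSum]
  split_ifs with h1 h2
  · rw [State.putReal_real_self, Function.update_self, hI]
  · rw [State.putReal_real_self, Function.update_self, hI, sub_eq_add_neg]
  · rw [hI, add_zero]

/-- One step of the test whether a coordinate is detected. -/
def detectStep : Prog := block [correlate,
  ite (.conj (.neg (.eqNat (.var j) (.var i)))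
      (.neg (.conj (.neg (.ltReal (.var tot) (.mul (.ofNat (.var thr)) (.var cor))))
        (.neg (.ltReal (.var tot) (.mul (.ofNat (.var thr))
          (.sub (.ofNat (.const 0)) (.var cor))))))))
    (letNat flag (.const 1)) skip]

/-- Test whether a coordinate is detected. -/
def detect : Prog := block [letNat flag (.const 0), iter j dimSucc detectStep]

theorem eval_detect (s : State n) (h1 : s.nat dimSucc 0 = n + 1)
    (htot : s.real tot 0 = activeSum (s.real lab) (s.nat numEx 0) (s.nat act)) :
    (detect.eval s).nat flag 0 = 1 ↔ Detected s.bitsOf (s.real lab) (s.nat numEx 0) n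
      (s.nat thr 0) (s.nat act) (s.nat i 0) := by
  classical
  simp only [detect, eval_block_cons, eval_block_nil, eval_letNat]
  set s₁ := s.putNat flag 0 (NExp.val s (.const 0)) with hs₁
  have key := eval_iter (s := s₁) (v := j) (B := dimSucc) (p := detectStep) (fun k s' =>
    s'.nat flag 0 = 1 ↔ ∃ j' < k, j' ≠ s.nat i 0
      ∧ (s.real tot 0 < s.nat thr 0 * corrSum s.bitsOf (s.real lab) (s.nat numEx 0) (s.nat act)
          (s.nat i 0) j'
        ∨ s.real tot 0 < s.nat thr 0 * -corrSum s.bitsOf (s.real lab) (s.nat numEx 0) (s.nat act)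
          (s.nat i 0) j')) (by simp +decide [hs₁, NExp.val]) (by
    intro k s' hk hv hn hr hI
    have e0 : s'.nat numEx = s.nat numEx :=
      (hn _ (by decide) (by decide)).trans (by simp +decide [hs₁])
    have e1 : s'.nat act = s.nat act := (hn _ (by decide) (by decide)).trans (by simp +decide [hs₁])
    have e2 : s'.real lab = s.real lab := hr _ (by decide)
    have e3 : s'.nat i = s.nat i := (hn _ (by decide) (by decide)).trans (by simp +decide [hs₁])
    have e5 : s'.bitsOf = s.bitsOf := State.bitsOf_congr
      ((hn _ (by decide) (by decide)).trans (by simp +decide [hs₁]))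
      ((hn _ (by decide) (by decide)).trans (by simp +decide [hs₁]))
    have e6 : s'.nat thr = s.nat thr := (hn _ (by decide) (by decide)).trans (by simp +decide [hs₁])
    have e7 : s'.real tot = s.real tot := hr _ (by decide)
    have hc := eval_correlate s'
    rw [e0, e1, e2, e3, e5, hv] at hc
    have c1 : (correlate.eval s').nat i = s.nat i := (eval_nat (by decide) _).trans e3
    have c2 : (correlate.eval s').nat j = s'.nat j := eval_nat (by decide) _
    have c3 : (correlate.eval s').nat thr = s.nat thr := (eval_nat (by decide) _).trans e6
    have c4 : (correlate.eval s').real tot = s.real tot := (eval_real (by decide) _).trans e7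
    have c5 : (correlate.eval s').nat flag = s'.nat flag := eval_nat (by decide) _
    rw [State.putNat_nat_of_ne _ _ _ (by decide), detectStep]
    simp only [eval_block_cons, eval_block_nil, eval_ite, eval_skip, eval_letNat, BExp.holds,
      BExp.holds_eqNat, NExp.val_var, NExp.val, RExp.val, RExp.val_var, hc, c1, c2, c3, c4, hv,
      Nat.cast_zero, zero_sub]
    split_ifs with h
    · rw [State.putNat_nat_self, Function.update_self]
      exact iff_of_true rfl ⟨k, by omega, h.1, by tauto⟩
    · rw [c5, hI]
      constructor
      · rintro ⟨j', hj', hj''⟩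
        exact ⟨j', by omega, hj''⟩
      · rintro ⟨j', hj', hj''⟩
        rcases Nat.lt_succ_iff_lt_or_eq.1 hj' with hj' | rfl
        · exact ⟨j', hj', hj''⟩
        · exact absurd ⟨hj''.1, by tauto⟩ h)
  rw [key, Detected, htot]
  have e : s₁.nat dimSucc 0 = n + 1 := by rw [hs₁, State.putNat_nat_of_ne _ _ _ (by decide), h1]
  rw [e]

/-- Append the coordinate to the list of detected coordinates, if it is detected. -/
def listStep : Prog := block [detect,
  ite (.eqNat (.var flag) (.const 1))
    (block [setNat det (.var detLen) (.var i), letNat detLen (.add (.var detLen) (.const 1))]) skip]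

/-- Clear the beginning of the list of detected coordinates. -/
def clear : Prog := iter pos base (setNat det (.var pos) (.const 0))

/-- List the detected coordinates. -/
def listDetected : Prog := block [clear, letNat detLen (.const 0), iter i 0 listStep]

theorem eval_clear (s : State n) : ∀ d < s.nat base 0, (clear.eval s).nat det d = 0 := by
  refine eval_iter (s := s) (v := pos) (B := base) (p := setNat det (.var pos) (.const 0))
    (fun k s' => ∀ d < k, s'.nat det d = 0) (by simp) ?_
  intro k s' hk hv hn hr hI d hd
  rw [State.putNat_nat_of_ne _ _ _ (by decide), eval_setNat, State.putNat_nat_self, NExp.val_var, hv,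
    NExp.val]
  rcases Nat.lt_succ_iff_lt_or_eq.1 hd with hd | rfl
  · rw [Function.update_of_ne (by omega), hI d hd]
  · rw [Function.update_self]

/-- The program `listDetected` leaves the list of detected coordinates in `det`, followed by zeros. -/
theorem eval_listDetected (s : State n) (h0 : s.nat 0 0 = n) (h1 : s.nat dimSucc 0 = n + 1)
    (htot : s.real tot 0 = activeSum (s.real lab) (s.nat numEx 0) (s.nat act)) :
    ∀ d < s.nat base 0, (listDetected.eval s).nat det d
      = (detectedList s.bitsOf (s.real lab) (s.nat numEx 0) n (s.nat thr 0) (s.nat act) n).getD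
        d 0 := by
  classical
  simp only [listDetected, eval_block_cons, eval_block_nil, eval_letNat]
  set s₁ := (clear.eval s).putNat detLen 0 (NExp.val (clear.eval s) (.const 0)) with hs₁
  have hs₁n : ∀ a, a ≠ pos → a ≠ det → a ≠ detLen → s₁.nat a = s.nat a := by
    intro a ha ha' ha''
    rw [hs₁, State.putNat_nat_of_ne _ _ _ ha'', eval_nat]
    simp [clear, natWrites, ha, ha']
  have hs₁r : s₁.real = s.real := by
    funext a
    rw [hs₁, State.putNat_real, eval_real]
    simp [clear, realWrites]
  have key := eval_iter (s := s₁) (v := i) (B := 0) (p := listStep) (fun k s' =>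
    s'.nat detLen 0 = (detectedList s.bitsOf (s.real lab) (s.nat numEx 0) n (s.nat thr 0)
      (s.nat act) k).length ∧
    ∀ d < s.nat base 0, s'.nat det d = (detectedList s.bitsOf (s.real lab) (s.nat numEx 0) n
      (s.nat thr 0) (s.nat act) k).getD d 0) (by
    refine ⟨?_, fun d hd => ?_⟩
    · rw [State.putNat_nat_of_ne _ _ _ (by decide), hs₁, State.putNat_nat_self]
      simp [NExp.val, detectedList]
    · rw [State.putNat_nat_of_ne _ _ _ (by decide), hs₁, State.putNat_nat_of_ne _ _ _ (by decide),
        eval_clear s d hd]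
      simp [detectedList]) (by
    intro k s' hk hv hn hr ⟨hI1, hI2⟩
    have e0 : s'.nat numEx = s.nat numEx :=
      (hn _ (by decide) (by decide)).trans (hs₁n _ (by decide) (by decide) (by decide))
    have e1 : s'.nat act = s.nat act :=
      (hn _ (by decide) (by decide)).trans (hs₁n _ (by decide) (by decide) (by decide))
    have e2 : s'.real lab = s.real lab := (hr _ (by decide)).trans (by rw [hs₁r])
    have e5 : s'.bitsOf = s.bitsOf := State.bitsOf_congr
      ((hn _ (by decide) (by decide)).trans (hs₁n _ (by decide) (by decide) (by decide)))
      ((hn _ (by decide) (by decide)).trans (hs₁n _ (by decide) (by decide) (by decide)))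
    have e6 : s'.nat thr = s.nat thr :=
      (hn _ (by decide) (by decide)).trans (hs₁n _ (by decide) (by decide) (by decide))
    have e7 : s'.real tot = s.real tot := (hr _ (by decide)).trans (by rw [hs₁r])
    have e8 : s'.nat dimSucc = s.nat dimSucc :=
      (hn _ (by decide) (by decide)).trans (hs₁n _ (by decide) (by decide) (by decide))
    have hd := eval_detect s' (by rw [e8, h1]) (by rw [e0, e1, e2, e7, htot])
    rw [e0, e1, e2, e5, e6, hv] at hd
    have c1 : (detect.eval s').nat i = s'.nat i := eval_nat (by decide) _
    have c2 : (detect.eval s').nat detLen = s'.nat detLen := eval_nat (by decide) _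
    have c3 : (detect.eval s').nat det = s'.nat det := eval_nat (by decide) _
    have hsucc : detectedList s.bitsOf (s.real lab) (s.nat numEx 0) n (s.nat thr 0) (s.nat act)
        (k + 1) = detectedList s.bitsOf (s.real lab) (s.nat numEx 0) n (s.nat thr 0) (s.nat act) k
          ++ if (detect.eval s').nat flag 0 = 1 then [k] else [] := by
      rw [detectedList, List.range_succ, List.filter_append, ← detectedList]
      congr 1
      split_ifs with h
      · simp [hd.1 h]
      · have h' := mt hd.2 h
        simp [h']
    rw [State.putNat_nat_of_ne _ _ _ (by decide), State.putNat_nat_of_ne _ _ _ (by decide), hsucc,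
      listStep]
    simp only [eval_block_cons, eval_block_nil, eval_ite, eval_skip, eval_letNat, eval_setNat,
      BExp.holds_eqNat, NExp.val_var, NExp.val, c1, hv]
    set Ld := detectedList s.bitsOf (s.real lab) (s.nat numEx 0) n (s.nat thr 0) (s.nat act) k
    split_ifs with h
    · refine ⟨?_, fun d hd => ?_⟩
      · rw [State.putNat_nat_self, Function.update_self, State.putNat_nat_of_ne _ _ _ (by decide), c2,
          hI1]
        simp
      · rw [State.putNat_nat_of_ne _ _ _ (by decide), State.putNat_nat_self, c2, c3, hI1]
        by_cases hdl : d = Ld.length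
        · rw [hdl, Function.update_self]
          simp
        · rw [Function.update_of_ne hdl, hI2 d hd]
          rcases lt_or_gt_of_ne hdl with h' | h'
          · rw [List.getD_append _ _ _ _ h']
          · rw [List.getD_eq_default _ _ h'.le, List.getD_eq_default]
            simp; omega
    · rw [List.append_nil, c2, c3]
      exact ⟨hI1, hI2⟩)
  have e : s₁.nat 0 0 = n := by rw [hs₁n _ (by decide) (by decide) (by decide), h0]
  rw [e] at key
  exact key.2

end Prog

end RealRAM

/-! ### Dependence on the set of active examples -/

section Congr

variable {bits : ℕ → ℕ → ℕ} {lb : ℕ → ℝ} {m n N K D : ℕ} {act act' : ℕ → ℕ}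

theorem activeSum_congr (h : ∀ s < m, act s = act' s) :
    activeSum lb m act = activeSum lb m act' :=
  Finset.sum_congr rfl fun s hs => by rw [h s (Finset.mem_range.1 hs)]

theorem corrSum_congr (h : ∀ s < m, act s = act' s) :
    corrSum bits lb m act = corrSum bits lb m act' := by
  funext i j
  exact Finset.sum_congr rfl fun s hs => by rw [h s (Finset.mem_range.1 hs)]

theorem tuple_congr (h : ∀ s < m, act s = act' s) :
    tuple bits lb m n N K D act = tuple bits lb m n N K D act' := by
  have : Detected bits lb m n N act = Detected bits lb m n N act' := by
    funext i
    simp only [Detected, activeSum_congr h, corrSum_congr h]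
  funext c
  rw [tuple, tuple, detectedList, detectedList, this]

theorem energy_congr (h : ∀ s < m, act s = act' s) :
    energy bits lb m act = energy bits lb m act' := by
  have : ∀ lb J s, groupSum bits lb m act J s = groupSum bits lb m act' J s := fun lb J s =>
    Finset.sum_congr rfl fun s hs => by rw [h s (Finset.mem_range.1 hs)]
  funext J
  simp only [energy, groupCount, this]
  exact Finset.sum_congr rfl fun s hs => by rw [h s (Finset.mem_range.1 hs)]

theorem selected_congr (h : ∀ s < m, act s = act' s) :
    selected bits lb m n N K D act = selected bits lb m n N K D act' := by
  simp only [selected, tuple_congr h, energy_congr h]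

theorem energy_nonneg (J : List ℕ) : 0 ≤ energy bits lb m act J :=
  Finset.sum_nonneg fun s _ => by
    split_ifs
    exacts [mul_self_nonneg _, le_rfl]

end Congr

namespace RealRAM

namespace Prog

open Mem

variable {n : ℕ}

/-! ### Tuples of detected coordinates -/

/-- One subtraction of a division with remainder. -/
def divStep : Prog :=
  ite (.neg (.ltNat (.var rem) (.var base)))
    (block [letNat rem (.sub (.var rem) (.var base)), letNat quo (.add (.var quo) (.const 1))]) skip

/-- Division with remainder, by repeated subtraction. -/
def divide : Prog := block [letNat quo (.const 0), iter cnt codes divStep]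

theorem eval_divide (s : State n) (hK : 0 < s.nat base 0) (hr : s.nat rem 0 < s.nat codes 0) :
    (divide.eval s).nat rem 0 = s.nat rem 0 % s.nat base 0 ∧
    (divide.eval s).nat quo 0 = s.nat rem 0 / s.nat base 0 := by
  classical
  simp only [divide, eval_block_cons, eval_block_nil, eval_letNat]
  set s₁ := s.putNat quo 0 (NExp.val s (.const 0)) with hs₁
  have key := eval_iter (s := s₁) (v := cnt) (B := codes) (p := divStep) (fun k s' =>
    s'.nat rem 0 + s.nat base 0 * s'.nat quo 0 = s.nat rem 0 ∧
    (s'.nat rem 0 < s.nat base 0 ∨ s'.nat quo 0 = k)) (by simp +decide [hs₁, NExp.val]) (by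
    intro k s' hk hv hn _ ⟨hI1, hI2⟩
    have e1 : s'.nat base = s.nat base :=
      (hn _ (by decide) (by decide)).trans (by simp +decide [hs₁])
    simp only [State.putNat_nat_of_ne _ _ _ (by decide : rem ≠ cnt),
      State.putNat_nat_of_ne _ _ _ (by decide : quo ≠ cnt), divStep, eval_ite, eval_skip,
      eval_block_cons, eval_block_nil, eval_letNat, BExp.holds, NExp.val, NExp.val_var, e1, not_lt]
    split_ifs with h
    · rw [State.putNat_nat_of_ne _ _ _ (by decide : rem ≠ quo)]
      simp only [State.putNat_nat_self, Function.update_self,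
        State.putNat_nat_of_ne _ _ _ (by decide : quo ≠ rem)]
      have hq : s'.nat quo 0 = k := hI2.resolve_left (by omega)
      refine ⟨?_, Or.inr (by rw [hq])⟩
      rw [mul_add]
      omega
    · exact ⟨hI1, Or.inl (by omega)⟩)
  have e : s₁.nat codes 0 = s.nat codes 0 := by rw [hs₁, State.putNat_nat_of_ne _ _ _ (by decide)]
  rw [e] at key
  obtain ⟨h1, h2⟩ := key
  have h3 : ((iter cnt codes divStep).eval s₁).nat rem 0 < s.nat base 0 := by
    rcases h2 with h2 | h2
    · exact h2
    · rw [h2] at h1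
      have := Nat.le_mul_of_pos_left (s.nat codes 0) hK
      omega
  have := (Nat.div_mod_unique hK).2 ⟨h1, h3⟩
  exact ⟨this.2.symm, this.1.symm⟩

/-- Decode one digit. -/
def decodeStep : Prog := block [divide,
  setNat lst (.add (.var len) (.var pos)) (.get det (.var rem)), letNat rem (.var quo)]

/-- Write the tuple with a given code behind the list of queried coordinates. -/
def decode : Prog := block [letNat rem (.var code), iter pos width decodeStep]

theorem eval_decode (s : State n) (hK : 0 < s.nat base 0) (hc : s.nat code 0 < s.nat codes 0) :
    (∀ p < s.nat width 0, (decode.eval s).nat lst (s.nat len 0 + p)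
      = s.nat det (s.nat code 0 / s.nat base 0 ^ p % s.nat base 0)) ∧
    ∀ p < s.nat len 0, (decode.eval s).nat lst p = s.nat lst p := by
  classical
  simp only [decode, eval_block_cons, eval_block_nil, eval_letNat]
  set s₁ := s.putNat rem 0 (NExp.val s (.var code)) with hs₁
  have key := eval_iter (s := s₁) (v := pos) (B := width) (p := decodeStep) (fun k s' =>
    s'.nat rem 0 = s.nat code 0 / s.nat base 0 ^ k ∧
    (∀ p < k, s'.nat lst (s.nat len 0 + p)
      = s.nat det (s.nat code 0 / s.nat base 0 ^ p % s.nat base 0)) ∧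
    ∀ p < s.nat len 0, s'.nat lst p = s.nat lst p) (by simp +decide [hs₁]) (by
    intro k s' hk hv hn _ ⟨hI1, hI2, hI3⟩
    have e1 : s'.nat base = s.nat base :=
      (hn _ (by decide) (by decide)).trans (by simp +decide [hs₁])
    have e2 : s'.nat codes = s.nat codes :=
      (hn _ (by decide) (by decide)).trans (by simp +decide [hs₁])
    have e3 : s'.nat det = s.nat det := (hn _ (by decide) (by decide)).trans (by simp +decide [hs₁])
    have e4 : s'.nat len = s.nat len := (hn _ (by decide) (by decide)).trans (by simp +decide [hs₁])
    obtain ⟨hd1, hd2⟩ := eval_divide s' (by rwa [e1]) (by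
      rw [hI1, e2]
      exact (Nat.div_le_self _ _).trans_lt hc)
    rw [e1, hI1] at hd1 hd2
    have c1 : (divide.eval s').nat len = s.nat len := (eval_nat (by decide) _).trans e4
    have c2 : (divide.eval s').nat det = s.nat det := (eval_nat (by decide) _).trans e3
    have c3 : (divide.eval s').nat lst = s'.nat lst := eval_nat (by decide) _
    have c4 : (divide.eval s').nat pos 0 = k := by rw [eval_nat (by decide), hv]
    simp only [State.putNat_nat_of_ne _ _ _ (by decide : rem ≠ pos),
      State.putNat_nat_of_ne _ _ _ (by decide : lst ≠ pos), decodeStep, eval_block_cons,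
      eval_block_nil, eval_letNat, eval_setNat, NExp.val, NExp.val_var, hd1, hd2, c1, c2, c3, c4,
      State.putNat_nat_self, State.putNat_nat_of_ne _ _ _ (by decide : lst ≠ rem),
      State.putNat_nat_of_ne _ _ _ (by decide : quo ≠ lst), Function.update_self]
    refine ⟨by rw [Nat.div_div_eq_div_mul, pow_succ], fun p hp => ?_, fun p hp => ?_⟩
    · rcases Nat.lt_succ_iff_lt_or_eq.1 hp with hp | rfl
      · rw [Function.update_of_ne (by omega), hI2 p hp]
      · rw [Function.update_self]
    · rw [Function.update_of_ne (by omega), hI3 p hp])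
  have e : s₁.nat width 0 = s.nat width 0 := by rw [hs₁, State.putNat_nat_of_ne _ _ _ (by decide)]
  rw [e] at key
  exact key.2

/-- The program `decode` writes the function `tuple` behind the list of queried coordinates. -/
theorem segment_decode (s : State n) (hK : 0 < s.nat base 0) (hc : s.nat code 0 < s.nat codes 0)
    {lb : ℕ → ℝ} {bt : ℕ → ℕ → ℕ} {m N : ℕ} {a : ℕ → ℕ}
    (hdet : ∀ d < s.nat base 0, s.nat det d = (detectedList bt lb m n N a n).getD d 0) :
    (decode.eval s).segment (s.nat len 0) (s.nat width 0)
      = tuple bt lb m n N (s.nat base 0) (s.nat width 0) a (s.nat code 0) ∧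
    ∀ p < s.nat len 0, (decode.eval s).nat lst p = s.nat lst p := by
  obtain ⟨h1, h2⟩ := eval_decode s hK hc
  refine ⟨List.map_congr_left fun p hp => ?_, h2⟩
  rw [h1 p (List.mem_range.1 hp), hdet _ (Nat.mod_lt _ hK)]

/-! ### The energy -/

/-- Compare two examples at one coordinate of the tuple. -/
def matchStep : Prog :=
  ite (.eqNat (.bit (.var ex') (.get lst (.add (.var len) (.var pos))))
      (.bit (.var ex) (.get lst (.add (.var len) (.var pos))))) skip (letNat flag (.const 0))

/-- Test whether an active example agrees with another example on the tuple. -/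
def matchTuple : Prog := block [letNat flag (.get act (.var ex')), iter pos width matchStep]

theorem eval_matchTuple (s : State n) : (matchTuple.eval s).nat flag 0 = 1 ↔
    s.nat act (s.nat ex' 0) = 1 ∧ ∀ i ∈ s.segment (s.nat len 0) (s.nat width 0),
      s.bitsOf (s.nat ex' 0) i = s.bitsOf (s.nat ex 0) i := by
  classical
  simp only [matchTuple, eval_block_cons, eval_block_nil, eval_letNat]
  set s₁ := s.putNat flag 0 (NExp.val s (.get act (.var ex'))) with hs₁
  have key := eval_iter (s := s₁) (v := pos) (B := width) (p := matchStep) (fun k s' =>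
    s'.nat flag 0 = 1 ↔ s.nat act (s.nat ex' 0) = 1 ∧ ∀ p < k,
      s.bitsOf (s.nat ex' 0) (s.nat lst (s.nat len 0 + p))
        = s.bitsOf (s.nat ex 0) (s.nat lst (s.nat len 0 + p)))
    (by simp +decide [hs₁, NExp.val]) (by
    intro k s' hk hv hn _ hI
    have e1 : s'.nat len = s.nat len := (hn _ (by decide) (by decide)).trans (by simp +decide [hs₁])
    have e2 : s'.nat ex = s.nat ex := (hn _ (by decide) (by decide)).trans (by simp +decide [hs₁])
    have e3 : s'.nat lst = s.nat lst := (hn _ (by decide) (by decide)).trans (by simp +decide [hs₁])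
    have e4 : s'.nat ex' = s.nat ex' :=
      (hn _ (by decide) (by decide)).trans (by simp +decide [hs₁])
    have e5 : s'.bitsOf = s.bitsOf := State.bitsOf_congr
      ((hn _ (by decide) (by decide)).trans (by simp +decide [hs₁]))
      ((hn _ (by decide) (by decide)).trans (by simp +decide [hs₁]))
    rw [State.putNat_nat_of_ne _ _ _ (by decide), matchStep, eval_ite, eval_skip, eval_letNat]
    simp only [BExp.holds_eqNat, NExp.val_var, NExp.val_bit, NExp.val, hv, e1, e2, e3, e4, e5]
    split_ifs with h
    · rw [hI]
      refine and_congr_right fun _ => ⟨fun h' p hp => ?_, fun h' p hp => h' p (by omega)⟩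
      rcases Nat.lt_succ_iff_lt_or_eq.1 hp with hp | rfl
      exacts [h' p hp, h]
    · rw [State.putNat_nat_self, Function.update_self]
      exact iff_of_false zero_ne_one fun h' => h (h'.2 k (by omega)))
  rw [key, State.forall_segment]
  have e : s₁.nat width 0 = s.nat width 0 := by simp +decide [hs₁]
  rw [e]

/-- Add one example to the statistics of a group. -/
def groupStep : Prog := block [matchTuple,
  ite (.eqNat (.var flag) (.const 1))
    (block [letReal gsum (.add (.var gsum) (.get lab (.var ex'))),
      letReal gcnt (.add (.var gcnt) (.ofNat (.const 1)))]) skip]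

/-- The statistics of the group of an example. -/
def group : Prog := block [letReal gsum (.ofNat (.const 0)), letReal gcnt (.ofNat (.const 0)),
  iter ex' numEx groupStep]

theorem eval_group (s : State n) :
    (group.eval s).real gsum 0 = groupSum s.bitsOf (s.real lab) (s.nat numEx 0) (s.nat act)
      (s.segment (s.nat len 0) (s.nat width 0)) (s.nat ex 0) ∧
    (group.eval s).real gcnt 0 = groupCount s.bitsOf (s.nat numEx 0) (s.nat act)
      (s.segment (s.nat len 0) (s.nat width 0)) (s.nat ex 0) := by
  classical
  simp only [group, eval_block_cons, eval_block_nil, eval_letReal]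
  set s₁ := (s.putReal gsum 0 (RExp.val s (.ofNat (.const 0)))).putReal gcnt 0
    (RExp.val (s.putReal gsum 0 (RExp.val s (.ofNat (.const 0)))) (.ofNat (.const 0))) with hs₁
  refine eval_iter (s := s₁) (v := ex') (B := numEx) (p := groupStep) (fun k s' =>
    s'.real gsum 0 = groupSum s.bitsOf (s.real lab) k (s.nat act)
      (s.segment (s.nat len 0) (s.nat width 0)) (s.nat ex 0) ∧
    s'.real gcnt 0 = groupCount s.bitsOf k (s.nat act)
      (s.segment (s.nat len 0) (s.nat width 0)) (s.nat ex 0))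
    (by simp +decide [hs₁, RExp.val, NExp.val, groupSum, groupCount]) ?_
  intro k s' hk hv hn hr ⟨hI1, hI2⟩
  have e0 : s'.nat width = s.nat width := hn _ (by decide) (by decide)
  have e1 : s'.nat act = s.nat act := hn _ (by decide) (by decide)
  have e2 : s'.real lab = s.real lab := (hr _ (by decide)).trans (by simp +decide [hs₁])
  have e3 : s'.nat lst = s.nat lst := hn _ (by decide) (by decide)
  have e4 : s'.nat len = s.nat len := hn _ (by decide) (by decide)
  have e6 : s'.nat ex = s.nat ex := hn _ (by decide) (by decide)
  have e5 : s'.bitsOf = s.bitsOf := State.bitsOf_congr (hn _ (by decide) (by decide))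
    (hn _ (by decide) (by decide))
  have hm := eval_matchTuple s'
  rw [State.segment_congr e3, e0, e1, e4, e5, e6, hv] at hm
  have c1 : (matchTuple.eval s').real = s'.real := by
    funext a
    exact eval_real (by simp [matchTuple, matchStep, block, realWrites, letNat]) _
  have c2 : (matchTuple.eval s').nat ex' 0 = k := by rw [eval_nat (by decide), hv]
  simp only [State.putNat_real, groupStep, eval_block_cons, eval_block_nil, eval_ite, eval_skip,
    eval_letReal, BExp.holds_eqNat, NExp.val, NExp.val_var, hm, RExp.val, RExp.val_var, c1,
    c2, e2]
  simp only [groupCount, groupSum, Finset.sum_range_succ]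
  rw [← groupSum, ← groupSum, ← groupCount]
  split_ifs with h
  · rw [State.putReal_real_of_ne _ _ _ (by decide : gsum ≠ gcnt)]
    simp only [State.putReal_real_self, Function.update_self,
      State.putReal_real_of_ne _ _ _ (by decide : gcnt ≠ gsum), c1, hI1, hI2, Nat.cast_one]
    exact ⟨trivial, trivial⟩
  · rw [c1, hI1, hI2, add_zero, add_zero]
    exact ⟨rfl, rfl⟩

/-- Add the contribution of one example to the energy. -/
def energyStep : Prog := block [group,
  ite (.eqNat (.get act (.var ex)) (.const 1))
    (letReal en (.add (.var en)
      (.mul (.div (.var gsum) (.var gcnt)) (.div (.var gsum) (.var gcnt))))) skip]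

/-- The energy of a tuple. -/
def computeEnergy : Prog := block [letReal en (.ofNat (.const 0)), iter ex numEx energyStep]

/-- The program `computeEnergy` computes the function `energy`. -/
theorem eval_computeEnergy (s : State n) :
    (computeEnergy.eval s).real en 0 = energy s.bitsOf (s.real lab) (s.nat numEx 0) (s.nat act)
      (s.segment (s.nat len 0) (s.nat width 0)) := by
  classical
  simp only [computeEnergy, eval_block_cons, eval_block_nil, eval_letReal]
  set s₁ := s.putReal en 0 (RExp.val s (.ofNat (.const 0))) with hs₁
  set J := s.segment (s.nat len 0) (s.nat width 0) with hJ
  refine eval_iter (s := s₁) (v := ex) (B := numEx) (p := energyStep) (fun k s' =>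
    s'.real en 0 = ∑ r ∈ Finset.range k, if s.nat act r = 1 then
      groupSum s.bitsOf (s.real lab) (s.nat numEx 0) (s.nat act) J r
        / groupCount s.bitsOf (s.nat numEx 0) (s.nat act) J r
        * (groupSum s.bitsOf (s.real lab) (s.nat numEx 0) (s.nat act) J r
        / groupCount s.bitsOf (s.nat numEx 0) (s.nat act) J r) else 0)
    (by simp +decide [hs₁, RExp.val, NExp.val]) ?_
  intro k s' hk hv hn hr hI
  have e0 : s'.nat width = s.nat width := hn _ (by decide) (by decide)
  have e1 : s'.nat act = s.nat act := hn _ (by decide) (by decide)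
  have e2 : s'.real lab = s.real lab := (hr _ (by decide)).trans (by simp +decide [hs₁])
  have e3 : s'.nat lst = s.nat lst := hn _ (by decide) (by decide)
  have e4 : s'.nat len = s.nat len := hn _ (by decide) (by decide)
  have e6 : s'.nat numEx = s.nat numEx := hn _ (by decide) (by decide)
  have e5 : s'.bitsOf = s.bitsOf := State.bitsOf_congr (hn _ (by decide) (by decide))
    (hn _ (by decide) (by decide))
  obtain ⟨hg1, hg2⟩ := eval_group s'
  rw [State.segment_congr e3, e0, e1, e4, e5, e6, hv, ← hJ] at hg1 hg2
  rw [e2] at hg1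
  have c1 : (group.eval s').nat act = s.nat act := (eval_nat (by decide) _).trans e1
  have c2 : (group.eval s').nat ex 0 = k := by rw [eval_nat (by decide), hv]
  have c3 : (group.eval s').real en = s'.real en := eval_real (by decide) _
  simp only [State.putNat_real, energyStep, eval_block_cons, eval_block_nil, eval_ite, eval_skip,
    eval_letReal, BExp.holds_eqNat, NExp.val, NExp.val_var, RExp.val, RExp.val_var, c1, c2, c3,
    hg1, hg2]
  rw [Finset.sum_range_succ]
  split_ifs with h
  · rw [State.putReal_real_self, Function.update_self, hI]
  · rw [c3, hI, add_zero]

/-! ### The best tuple -/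

/-- Compare one tuple with the best tuple so far. -/
def searchStep : Prog := block [letNat code (.var cand), decode, computeEnergy,
  ite (.ltReal (.var top) (.var en)) (block [letReal top (.var en), letNat best (.var cand)]) skip]

/-- Find the best tuple, and write it behind the list of queried coordinates. -/
def search : Prog := block [letReal top (.sub (.ofNat (.const 0)) (.ofNat (.const 1))),
  letNat best (.const 0), iter cand codes searchStep, letNat code (.var best), decode]

/-- The program `search` writes the function `selected` behind the list of queried coordinates. -/
theorem eval_search (s : State n) (hK : 0 < s.nat base 0)
    (hcodes : s.nat codes 0 = s.nat base 0 ^ s.nat width 0) {N : ℕ}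
    (hdet : ∀ d < s.nat base 0, s.nat det d = (detectedList s.bitsOf (s.real lab) (s.nat numEx 0) n
      N (s.nat act) n).getD d 0) :
    (search.eval s).segment (s.nat len 0) (s.nat width 0)
      = selected s.bitsOf (s.real lab) (s.nat numEx 0) n N (s.nat base 0) (s.nat width 0)
        (s.nat act) ∧
    ∀ p < s.nat len 0, (search.eval s).nat lst p = s.nat lst p := by
  classical
  simp only [search, eval_block_cons, eval_block_nil, eval_letReal, eval_letNat]
  set s₀ := s.putReal top 0 (RExp.val s (.sub (.ofNat (.const 0)) (.ofNat (.const 1)))) with hs₀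
  set s₁ := s₀.putNat best 0 (NExp.val s₀ (.const 0)) with hs₁
  set A : ℕ → List ℕ := tuple s.bitsOf (s.real lab) (s.nat numEx 0) n N (s.nat base 0)
    (s.nat width 0) (s.nat act) with hA
  set e : ℕ → ℝ := fun c => energy s.bitsOf (s.real lab) (s.nat numEx 0) (s.nat act) (A c) with he
  have key := eval_iter (s := s₁) (v := cand) (B := codes) (p := searchStep) (fun k s' =>
    s'.nat best 0 = argmax e k ∧ s'.real top 0 = (if k = 0 then -1 else e (argmax e k)) ∧
    ∀ p < s.nat len 0, s'.nat lst p = s.nat lst p) (by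
      simp +decide [hs₁, hs₀, RExp.val, NExp.val, argmax]) (by
    intro k s' hk hv hn hr ⟨hI1, hI2, hI3⟩
    have hn' : ∀ a, a ≠ cand → a ≠ best → a ∉ searchStep.natWrites → s'.nat a = s.nat a := by
      intro a ha ha' ha''
      rw [hn a ha ha'', hs₁, State.putNat_nat_of_ne _ _ _ ha', hs₀, State.putReal_nat]
    have e2 : s'.real lab = s.real lab := (hr _ (by decide)).trans (by simp +decide [hs₁, hs₀])
    set s₂ := s'.putNat code 0 (NExp.val s' (.var cand)) with hs₂
    have hs₂n : ∀ a, a ≠ code → s₂.nat a = s'.nat a := fun a ha => by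
      rw [hs₂, State.putNat_nat_of_ne _ _ _ ha]
    have f1 : s₂.nat base = s.nat base :=
      (hs₂n _ (by decide)).trans (hn' _ (by decide) (by decide) (by decide))
    have f2 : s₂.nat codes = s.nat codes :=
      (hs₂n _ (by decide)).trans (hn' _ (by decide) (by decide) (by decide))
    have f3 : s₂.nat det = s.nat det :=
      (hs₂n _ (by decide)).trans (hn' _ (by decide) (by decide) (by decide))
    have f4 : s₂.nat len = s.nat len :=
      (hs₂n _ (by decide)).trans (hn' _ (by decide) (by decide) (by decide))
    have f5 : s₂.nat width = s.nat width :=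
      (hs₂n _ (by decide)).trans (hn' _ (by decide) (by decide) (by decide))
    have f6 : s₂.nat code 0 = k := by rw [hs₂, State.putNat_nat_self, Function.update_self,
      NExp.val_var, hv]
    have f7 : s₂.nat lst = s'.nat lst := hs₂n _ (by decide)
    have hk' : k < s.nat codes 0 := by
      have : s₁.nat codes = s.nat codes := by
        rw [hs₁, State.putNat_nat_of_ne _ _ _ (by decide), hs₀, State.putReal_nat]
      rwa [this] at hk
    obtain ⟨hd1, hd2⟩ := segment_decode s₂ (by rwa [f1]) (by rwa [f2, f6])
      (by rw [f1, f3]; exact hdet)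
    rw [f1, f4, f5, f6] at hd1
    rw [f4, f7] at hd2
    set s₃ := decode.eval s₂ with hs₃
    have g1 : s₃.nat len = s.nat len := (eval_nat (by decide) _).trans f4
    have g2 : s₃.nat width = s.nat width := (eval_nat (by decide) _).trans f5
    have g3 : s₃.nat act = s.nat act := (eval_nat (by decide) _).trans
      ((hs₂n _ (by decide)).trans (hn' _ (by decide) (by decide) (by decide)))
    have g4 : s₃.nat numEx = s.nat numEx := (eval_nat (by decide) _).trans
      ((hs₂n _ (by decide)).trans (hn' _ (by decide) (by decide) (by decide)))
    have g5 : s₃.bitsOf = s.bitsOf := State.bitsOf_congr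
      ((eval_nat (by decide) _).trans
        ((hs₂n _ (by decide)).trans (hn' _ (by decide) (by decide) (by decide))))
      ((eval_nat (by decide) _).trans
        ((hs₂n _ (by decide)).trans (hn' _ (by decide) (by decide) (by decide))))
    have g6 : s₃.real lab = s.real lab := by
      rw [hs₃, eval_real (by decide), hs₂, State.putNat_real, e2]
    have hE := eval_computeEnergy s₃
    rw [g1, g2, g3, g4, g5, g6, hd1] at hE
    set s₄ := computeEnergy.eval s₃ with hs₄
    have i1 : s₄.nat cand 0 = k := by
      rw [hs₄, eval_nat (by decide), hs₃, eval_nat (by decide), hs₂n _ (by decide), hv]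
    have i2 : s₄.nat best = s'.nat best := by
      rw [hs₄, eval_nat (by decide), hs₃, eval_nat (by decide), hs₂n _ (by decide)]
    have i3 : s₄.nat lst = s₃.nat lst := by rw [hs₄, eval_nat (by decide)]
    have i4 : s₄.real top = s'.real top := by
      rw [hs₄, eval_real (by decide), hs₃, eval_real (by decide), hs₂, State.putNat_real]
    have hE' : s₄.real en 0 = e k := hE
    have h4 : ∀ p < s.nat len 0, s₄.nat lst p = s.nat lst p := fun p hp => by
      rw [i3, hd2 p hp, hI3 p hp]
    rw [State.putNat_nat_of_ne _ _ _ (by decide), State.putNat_nat_of_ne _ _ _ (by decide),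
      State.putNat_real, show searchStep.eval s' = (ite (.ltReal (.var top) (.var en))
        (block [letReal top (.var en), letNat best (.var cand)]) skip).eval s₄ from rfl]
    simp only [eval_block_cons, eval_block_nil, eval_letNat, eval_ite, eval_skip, eval_letReal,
      BExp.holds, RExp.val_var, i4, hI2, hE', NExp.val_var, State.putReal_nat, i1]
    have hcond : (if k = 0 then -1 else e (argmax e k)) < e k ↔ k = 0 ∨ e (argmax e k) < e k := by
      split_ifs with h0
      · have : 0 ≤ e k := energy_nonneg _
        exact iff_of_true (by linarith) (Or.inl h0)
      · simp [h0]
    simp only [hcond]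
    have hsucc : argmax e (k + 1) = if k = 0 ∨ e (argmax e k) < e k then k else argmax e k := by
      rw [argmax]
      rcases Nat.eq_zero_or_pos k with rfl | hk0
      · simp [argmax]
      · simp [hk0.ne']
    rw [hsucc, if_neg (Nat.succ_ne_zero k)]
    split_ifs with h
    · refine ⟨by simp, by simp, fun p hp => ?_⟩
      rw [State.putNat_nat_of_ne _ _ _ (by decide), State.putReal_nat, h4 p hp]
    · rw [i2, i4, hI1, hI2, if_neg (by tauto)]
      exact ⟨rfl, rfl, h4⟩)
  have e0 : s₁.nat codes 0 = s.nat codes 0 := by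
    rw [hs₁, State.putNat_nat_of_ne _ _ _ (by decide), hs₀, State.putReal_nat]
  rw [e0] at key
  set s₅ := (iter cand codes searchStep).eval s₁ with hs₅
  set s₆ := s₅.putNat code 0 (NExp.val s₅ (.var best)) with hs₆
  obtain ⟨hk1, -, hk3⟩ := key
  have hn' : ∀ a, a ≠ code → a ≠ best → a ∉ (iter cand codes searchStep).natWrites →
      s₆.nat a = s.nat a := by
    intro a ha ha' ha''
    rw [hs₆, State.putNat_nat_of_ne _ _ _ ha, hs₅, eval_nat ha'', hs₁,
      State.putNat_nat_of_ne _ _ _ ha', hs₀, State.putReal_nat]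
  have f1 : s₆.nat base = s.nat base := hn' _ (by decide) (by decide) (by decide)
  have f2 : s₆.nat codes = s.nat codes := hn' _ (by decide) (by decide) (by decide)
  have f3 : s₆.nat det = s.nat det := hn' _ (by decide) (by decide) (by decide)
  have f4 : s₆.nat len = s.nat len := hn' _ (by decide) (by decide) (by decide)
  have f5 : s₆.nat width = s.nat width := hn' _ (by decide) (by decide) (by decide)
  have f6 : s₆.nat code 0 = argmax e (s.nat codes 0) := by
    rw [hs₆, State.putNat_nat_self, Function.update_self, NExp.val_var, hk1]
  have f7 : s₆.nat lst = s₅.nat lst := by rw [hs₆, State.putNat_nat_of_ne _ _ _ (by decide)]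
  have hpos : 0 < s.nat codes 0 := by rw [hcodes]; exact Nat.pow_pos hK
  obtain ⟨hd1, hd2⟩ := segment_decode s₆ (by rwa [f1])
    (by rw [f2, f6]; exact (argmax_spec e _).2 hpos) (by rw [f1, f3]; exact hdet)
  rw [f1, f4, f5, f6, hcodes] at hd1
  rw [f4, f7] at hd2
  exact ⟨hd1, fun p hp => (hd2 p hp).trans (hk3 p hp)⟩

end Prog

end RealRAM

namespace RealRAM

namespace Prog

open Mem

variable {n : ℕ}

/-! ### Rounds and the prediction -/

/-- One round of queries. -/
def roundStep : Prog := block [mark, sumActive tot (.get lab (.var ex)), listDetected, search,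
  letNat len (.add (.var len) (.var width))]

/-- The program that evaluates the hypothesis. -/
def predict : Prog := block [letNat len (.const 0), iter round rounds roundStep, mark,
  sumActive tot (.get lab (.var ex)), sumActive num (.ofNat (.const 1)),
  setReal 0 (.const 0) (.mul
    (.add (.ofNat (.const 1)) (.div (.get 0 (.const 0)) (.ofNat (.const 4))))
    (.div (.var tot) (.var num)))]

/-- The coordinates queried in the next round. -/
noncomputable def nextQueries (s : State n) (l : List ℕ) : List ℕ :=
  selected s.bitsOf (s.real lab) (s.nat numEx 0) n (s.nat thr 0) (s.nat base 0)
    (s.nat width 0) (active s.bitsOf (s.nat point) l)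

theorem State.segment_add (s : State n) (a b : ℕ) :
    s.segment 0 (a + b) = s.segment 0 a ++ s.segment a b := by
  simp [State.segment, List.range_add]

theorem eval_roundStep (s : State n) (h0 : s.nat 0 0 = n) (h1 : s.nat dimSucc 0 = n + 1)
    (hK : 0 < s.nat base 0) (hcodes : s.nat codes 0 = s.nat base 0 ^ s.nat width 0)
    (hlen : s.nat len 0 ≤ s.nat maxLen 0) :
    (roundStep.eval s).nat len 0 = s.nat len 0 + s.nat width 0 ∧
    (roundStep.eval s).segment 0 (s.nat len 0 + s.nat width 0)
      = s.segment 0 (s.nat len 0) ++ nextQueries s (s.segment 0 (s.nat len 0)) := by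
  simp only [roundStep, eval_block_cons, eval_block_nil, eval_letNat]
  have hm := eval_mark s hlen
  set s₁ := mark.eval s with hs₁
  have ht := eval_sumActive (a := tot) (w := .get lab (.var ex)) s₁ (by decide) (s.real lab)
    (fun s' hs' => by
      rw [RExp.val, NExp.val_var, hs', hs₁, eval_real (by decide)])
  set s₂ := (sumActive tot (.get lab (.var ex))).eval s₁ with hs₂
  have hn : ∀ a, a ∉ mark.natWrites → a ≠ ex → s₂.nat a = s.nat a := by
    intro a ha ha'
    rw [hs₂, eval_nat (by simpa [sumActive, natWrites, block, letReal, sumStep] using ha'), hs₁,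
      eval_nat ha]
  have f1 : s₂.nat 0 = s.nat 0 := hn _ (by decide) (by decide)
  have f2 : s₂.nat dimSucc = s.nat dimSucc := hn _ (by decide) (by decide)
  have f3 : s₂.nat base = s.nat base := hn _ (by decide) (by decide)
  have f4 : s₂.nat width = s.nat width := hn _ (by decide) (by decide)
  have f5 : s₂.nat codes = s.nat codes := hn _ (by decide) (by decide)
  have f6 : s₂.nat numEx = s.nat numEx := hn _ (by decide) (by decide)
  have f7 : s₂.nat thr = s.nat thr := hn _ (by decide) (by decide)
  have f8 : s₂.nat len = s.nat len := hn _ (by decide) (by decide)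
  have f9 : s₂.nat lst = s.nat lst := hn _ (by decide) (by decide)
  have f10 : s₂.bitsOf = s.bitsOf :=
    State.bitsOf_congr (hn _ (by decide) (by decide)) (hn _ (by decide) (by decide))
  have f11 : s₂.real lab = s.real lab := by
    rw [hs₂, eval_real (by decide), hs₁, eval_real (by decide)]
  have f12 : s₂.nat act = s₁.nat act := by rw [hs₂, eval_nat (by decide)]
  have f13 : s₁.nat numEx = s.nat numEx := by rw [hs₁, eval_nat (by decide)]
  have hd := eval_listDetected s₂ (by rw [f1, h0]) (by rw [f2, h1]) (by
    rw [ht, f11, f6, f12, f13])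
  set s₃ := listDetected.eval s₂ with hs₃
  have g1 : s₃.nat base = s₂.nat base := eval_nat (by decide) _
  have g2 : s₃.nat width = s₂.nat width := eval_nat (by decide) _
  have g3 : s₃.nat codes = s₂.nat codes := eval_nat (by decide) _
  have g4 : s₃.nat numEx = s₂.nat numEx := eval_nat (by decide) _
  have g5 : s₃.nat len = s₂.nat len := eval_nat (by decide) _
  have g6 : s₃.nat lst = s₂.nat lst := eval_nat (by decide) _
  have g7 : s₃.bitsOf = s₂.bitsOf :=
    State.bitsOf_congr (eval_nat (by decide) _) (eval_nat (by decide) _)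
  have g8 : s₃.real lab = s₂.real lab := eval_real (by decide) _
  have g9 : s₃.nat act = s₂.nat act := eval_nat (by decide) _
  obtain ⟨hse1, hse2⟩ := eval_search s₃ (N := s.nat thr 0) (by rwa [g1, f3])
    (by rw [g3, f5, g1, f3, g2, f4, hcodes]) (by
      rw [g1, g7, g8, g4, g9]
      rw [f7] at hd
      exact hd)
  rw [g5, f8, g2, f4, g7, f10, g8, f11, g4, f6, g1, f3, g9, f12, selected_congr hm] at hse1
  rw [g5, f8, g6, f9] at hse2
  set s₄ := search.eval s₃ with hs₄
  have i1 : s₄.nat len = s.nat len := by rw [hs₄, eval_nat (by decide), g5, f8]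
  have i2 : s₄.nat width = s.nat width := by rw [hs₄, eval_nat (by decide), g2, f4]
  refine ⟨?_, ?_⟩
  · rw [State.putNat_nat_self, Function.update_self, NExp.val, NExp.val_var, NExp.val_var, i1, i2]
  · rw [State.segment_congr (State.putNat_nat_of_ne _ _ _ (by decide)), State.segment_add, hse1]
    congr 1
    refine List.map_congr_left fun p hp => ?_
    rw [zero_add, hse2 p (List.mem_range.1 hp)]

/-- The program `predict` computes the function `prediction`. -/
theorem eval_predict (s : State n) (h0 : s.nat 0 0 = n) (h1 : s.nat dimSucc 0 = n + 1)
    (hK : 0 < s.nat base 0) (hcodes : s.nat codes 0 = s.nat base 0 ^ s.nat width 0)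
    (hlen : s.nat rounds 0 * s.nat width 0 ≤ s.nat maxLen 0) :
    (predict.eval s).real 0 0 = prediction s.bitsOf (s.real lab) (s.nat numEx 0) n (s.nat thr 0)
      (s.nat base 0) (s.nat width 0) (s.nat rounds 0) (s.real 0 0) (s.nat point) := by
  simp only [predict, eval_block_cons, eval_block_nil, eval_letNat]
  set s₁ := s.putNat len 0 (NExp.val s (.const 0)) with hs₁
  have hs₁n : ∀ a, a ≠ len → s₁.nat a = s.nat a := fun a ha => by
    rw [hs₁, State.putNat_nat_of_ne _ _ _ ha]
  have key := eval_iter (s := s₁) (v := round) (B := rounds) (p := roundStep) (fun k s' =>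
    s'.nat len 0 = k * s.nat width 0 ∧ s'.segment 0 (k * s.nat width 0)
      = queried s.bitsOf (s.real lab) (s.nat numEx 0) n (s.nat thr 0) (s.nat base 0)
        (s.nat width 0) (s.nat point) k) (by
      refine ⟨?_, ?_⟩
      · rw [State.putNat_nat_of_ne _ _ _ (by decide)]
        simp [hs₁, NExp.val]
      · simp [State.segment, queried]) (by
    intro k s' hk hv hn hr ⟨hI1, hI2⟩
    have hn' : ∀ a, a ≠ round → a ≠ len → a ∉ roundStep.natWrites → s'.nat a = s.nat a :=
      fun a ha ha' ha'' => (hn a ha ha'').trans (hs₁n a ha')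
    have f1 : s'.nat 0 = s.nat 0 := hn' _ (by decide) (by decide) (by decide)
    have f2 : s'.nat dimSucc = s.nat dimSucc := hn' _ (by decide) (by decide) (by decide)
    have f3 : s'.nat base = s.nat base := hn' _ (by decide) (by decide) (by decide)
    have f4 : s'.nat width = s.nat width := hn' _ (by decide) (by decide) (by decide)
    have f5 : s'.nat codes = s.nat codes := hn' _ (by decide) (by decide) (by decide)
    have f6 : s'.nat numEx = s.nat numEx := hn' _ (by decide) (by decide) (by decide)
    have f7 : s'.nat thr = s.nat thr := hn' _ (by decide) (by decide) (by decide)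
    have f8 : s'.nat maxLen = s.nat maxLen := hn' _ (by decide) (by decide) (by decide)
    have f9 : s'.nat point = s.nat point := hn' _ (by decide) (by decide) (by decide)
    have f10 : s'.bitsOf = s.bitsOf := State.bitsOf_congr
      (hn' _ (by decide) (by decide) (by decide)) (hn' _ (by decide) (by decide) (by decide))
    have f11 : s'.real lab = s.real lab := (hr _ (by decide)).trans (by simp [hs₁])
    have hk' : k < s.nat rounds 0 := by
      rwa [hs₁n _ (by decide)] at hk
    have hle : k * s.nat width 0 ≤ s.nat maxLen 0 :=
      (Nat.mul_le_mul_right _ hk'.le).trans hlen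
    obtain ⟨hr1, hr2⟩ := eval_roundStep s' (by rw [f1, h0]) (by rw [f2, h1]) (by rwa [f3])
      (by rw [f5, f3, f4, hcodes]) (by rwa [hI1, f8])
    rw [hI1, f4] at hr1 hr2
    rw [hI2] at hr2
    have hnext : ∀ l, nextQueries s' l = nextQueries s l := fun l => by
      simp only [nextQueries, f3, f4, f6, f7, f9, f10, f11]
    rw [State.putNat_nat_of_ne _ _ _ (by decide), State.segment_congr (s := roundStep.eval s')
      (State.putNat_nat_of_ne _ _ _ (by decide)), add_mul, one_mul, hr1, hr2, hnext]
    exact ⟨rfl, rfl⟩)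
  rw [hs₁n _ (by decide)] at key
  obtain ⟨hl, hseg⟩ := key
  set s₂ := (iter round rounds roundStep).eval s₁ with hs₂
  have hn : ∀ a, a ≠ len → a ∉ (iter round rounds roundStep).natWrites → s₂.nat a = s.nat a :=
    fun a ha ha' => by rw [hs₂, eval_nat ha', hs₁n a ha]
  have hr : ∀ a, a ∉ (iter round rounds roundStep).realWrites → s₂.real a = s.real a :=
    fun a ha => by rw [hs₂, eval_real ha, hs₁, State.putNat_real]
  have f6 : s₂.nat numEx = s.nat numEx := hn _ (by decide) (by decide)
  have f8 : s₂.nat maxLen = s.nat maxLen := hn _ (by decide) (by decide)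
  have f9 : s₂.nat point = s.nat point := hn _ (by decide) (by decide)
  have f10 : s₂.bitsOf = s.bitsOf :=
    State.bitsOf_congr (hn _ (by decide) (by decide)) (hn _ (by decide) (by decide))
  have f11 : s₂.real lab = s.real lab := hr _ (by decide)
  have hm := eval_mark s₂ (by rw [hl, f8]; exact hlen)
  rw [hl, hseg, f6, f9, f10] at hm
  set s₃ := mark.eval s₂ with hs₃
  have g1 : s₃.real = s₂.real := by funext a; exact eval_real (List.not_mem_nil) _
  have g2 : s₃.nat numEx = s.nat numEx := (eval_nat (by decide) _).trans f6
  have ht := eval_sumActive (a := tot) (w := .get lab (.var ex)) s₃ (by decide) (s.real lab)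
    (fun s' hs' => by
      rw [RExp.val, NExp.val_var, hs', g1, f11])
  set s₄ := (sumActive tot (.get lab (.var ex))).eval s₃ with hs₄
  have hc := eval_sumActive (a := num) (w := .ofNat (.const 1)) s₄ (by decide) (fun _ => 1)
    (fun s' hs' => by simp [RExp.val, NExp.val])
  have i1 : s₄.nat numEx = s.nat numEx := (eval_nat (by decide) _).trans g2
  have i2 : s₄.nat act = s₃.nat act := eval_nat (by decide) _
  have i3 : s₄.real 0 = s.real 0 := by
    rw [hs₄, eval_real (by decide), g1, hr _ (by decide)]
  set s₅ := (sumActive num (.ofNat (.const 1))).eval s₄ with hs₅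
  have j1 : s₅.real 0 = s.real 0 := (eval_real (by decide) _).trans i3
  have j2 : s₅.real tot = s₄.real tot := eval_real (by decide) _
  rw [i1, i2, activeSum_congr hm] at hc
  rw [g2, activeSum_congr hm] at ht
  rw [eval_setReal]
  simp only [NExp.val, State.putReal_real_self, Function.update_self, RExp.val, RExp.val_var, hc,
    j1, j2, ht, prediction]
  push_cast
  ring

end Prog

end RealRAM

/-! ### The program that sets up the parameters -/

namespace RealRAM

namespace Mem

/-- Natural variable: exponent `L` of the power of two that exceeds `1 / (ε γ)`. -/
abbrev lg : ℕ := 30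
/-- Natural variable: the parameter `U` that determines the others. -/
abbrev par : ℕ := 31
/-- Natural variable: power of two. -/
abbrev pow : ℕ := 32
/-- Natural variable: an exponent `l` with `2 n ≤ 2 ^ l`. -/
abbrev ell : ℕ := 33
/-- Natural variable: exponent of a power of two. -/
abbrev expo : ℕ := 34
/-- Natural variable: exponent of a second power of two. -/
abbrev expo' : ℕ := 35
/-- Natural array: the example drawn last. -/
abbrev drawn : ℕ := 36
/-- Natural variable: position at which the next example is stored. -/
abbrev next : ℕ := 37

/-- Real variable: the label drawn last. -/
abbrev label : ℕ := 9

end Mem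

open Mem

variable {n : ℕ}

/-- The `k`-fold multiple of an expression. -/
def NExp.times (e : NExp) : ℕ → NExp
  | 0 => .const 0
  | k + 1 => .add (e.times k) e

theorem NExp.val_times (s : State n) (e : NExp) (k : ℕ) : (e.times k).val s = k * e.val s := by
  induction k with
  | zero => simp [NExp.times, NExp.val]
  | succ k ih => rw [NExp.times, NExp.val, ih]; ring

namespace Prog

theorem eval_letNat_zero (a b : ℕ) (e : NExp) (s : State n) :
    ((letNat a e).eval s).nat b 0 = if b = a then e.val s else s.nat b 0 := by
  rw [eval_letNat]
  split_ifs with h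
  · rw [h]; simp
  · rw [State.putNat_nat_of_ne _ _ _ h]

/-- Multiply `d` by `2 ^ e`. -/
def double (d e : ℕ) : Prog := iter cnt e (letNat d (.add (.var d) (.var d)))

theorem eval_double {d e : ℕ} (hd : d ≠ cnt) (a : ℕ) (s : State n) :
    ((double d e).eval s).nat a 0 = if a = d then s.nat d 0 * 2 ^ s.nat e 0
      else if a = cnt then s.nat e 0 else s.nat a 0 := by
  have key := eval_iter (s := s) (v := cnt) (B := e) (p := letNat d (.add (.var d) (.var d)))
    (fun k s' => s'.nat d 0 = s.nat d 0 * 2 ^ k ∧ s'.nat cnt 0 = k)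
    (by simp [State.putNat_nat_of_ne _ _ _ hd]) (by
    intro k s' hk hv hn hr ⟨hI, _⟩
    rw [State.putNat_nat_of_ne _ _ _ hd, eval_letNat, State.putNat_nat_self, Function.update_self,
      State.putNat_nat_self, Function.update_self, NExp.val, NExp.val_var, hI]
    exact ⟨by ring, rfl⟩)
  split_ifs with h1 h2
  · rw [h1]; exact key.1
  · rw [h2]; exact key.2
  · rw [double, eval_nat]
    simp [natWrites, letNat, h1, h2]

/-- Add `e · b` to `d`. -/
def accumulate (d e b : ℕ) : Prog := iter cnt e (letNat d (.add (.var d) (.var b)))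

theorem eval_accumulate {d e b : ℕ} (hd : d ≠ cnt) (hb : b ≠ d) (hb' : b ≠ cnt) (a : ℕ)
    (s : State n) : ((accumulate d e b).eval s).nat a 0
      = if a = d then s.nat d 0 + s.nat e 0 * s.nat b 0
        else if a = cnt then s.nat e 0 else s.nat a 0 := by
  have key := eval_iter (s := s) (v := cnt) (B := e) (p := letNat d (.add (.var d) (.var b)))
    (fun k s' => s'.nat d 0 = s.nat d 0 + k * s.nat b 0 ∧ s'.nat cnt 0 = k)
    (by simp [State.putNat_nat_of_ne _ _ _ hd]) (by
    intro k s' hk hv hn hr ⟨hI, _⟩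
    have e1 : s'.nat b = s.nat b := hn _ hb' (by simpa [letNat, natWrites] using hb)
    rw [State.putNat_nat_of_ne _ _ _ hd, eval_letNat, State.putNat_nat_self, Function.update_self,
      State.putNat_nat_self, Function.update_self, NExp.val, NExp.val_var, NExp.val_var, hI, e1]
    exact ⟨by ring, rfl⟩)
  split_ifs with h1 h2
  · rw [h1]; exact key.1
  · rw [h2]; exact key.2
  · rw [accumulate, eval_nat]
    simp [natWrites, letNat, h1, h2]

/-- Double `pow` unless it is at least `n`. -/
def logStep : Prog := ite (.ltNat (.var pow) (.var 0))
  (block [letNat pow (.add (.var pow) (.var pow)), letNat ell (.add (.var ell) (.const 1))]) skip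

theorem eval_log (hn : 0 < n) (s : State n) (h0 : s.nat 0 0 = n) (hp : s.nat pow 0 = 1)
    (he : s.nat ell 0 = 1) :
    2 * n ≤ 2 ^ ((iter cnt 0 logStep).eval s).nat ell 0 ∧
    2 ^ ((iter cnt 0 logStep).eval s).nat ell 0 < 4 * n := by
  classical
  have key := eval_iter (s := s) (v := cnt) (B := 0) (p := logStep)
    (fun k s' => 2 * s'.nat pow 0 = 2 ^ s'.nat ell 0 ∧
      2 ^ s'.nat ell 0 < 4 * n ∧ (n ≤ s'.nat pow 0 ∨ s'.nat ell 0 = k + 1))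
    (by
      simp +decide only [State.putNat_nat_of_ne, hp, he, zero_add, or_true, and_true, mul_one,
        pow_one, true_and]
      omega) (by
    intro k s' hk hv hn hr ⟨hI1, hI2, hI3⟩
    have e1 : s'.nat 0 0 = n := by rw [hn _ (by decide) (by decide), h0]
    simp only [State.putNat_nat_of_ne _ _ _ (by decide : pow ≠ cnt),
      State.putNat_nat_of_ne _ _ _ (by decide : ell ≠ cnt), logStep, eval_ite, eval_skip,
      BExp.holds, NExp.val_var, e1]
    split_ifs with h
    · simp only [eval_block_cons, eval_block_nil, eval_letNat_zero, NExp.val, NExp.val_var,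
        if_neg (by decide : pow ≠ ell), if_neg (by decide : ell ≠ pow), if_true]
      rw [pow_succ]
      refine ⟨by omega, by omega, Or.inr ?_⟩
      have := hI3.resolve_left (by omega)
      omega
    · exact ⟨hI1, hI2, Or.inl (by omega)⟩)
  rw [h0] at key
  obtain ⟨h1, h2, h3⟩ := key
  refine ⟨?_, h2⟩
  rcases h3 with h3 | h3
  · omega
  · rw [h3, pow_succ]
    have : n < 2 ^ n := Nat.lt_two_pow_self
    omega

/-- Compute all parameters from `n` and `L`. -/
def parameters : List Prog := [
  letNat par (.add (.var lg) (.const 18)),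
  letNat expo (.add (.times (.var par) 2) (.const 4)),
  letNat width (.var par), double width expo,
  letNat rounds (.times (.var par) 4), letNat maxLen (.const 0), accumulate maxLen rounds width,
  letNat expo (.times (.var par) 33), letNat thr (.const 1), double thr expo,
  letNat expo (.times (.var par) 34), letNat base (.const 1), double base expo,
  letNat expo' (.const 0), accumulate expo' expo width, letNat codes (.const 1),
  double codes expo', letNat dimSucc (.add (.var 0) (.const 1)),
  letNat expo (.add (.times (.add (.var maxLen) (.const 3)) 2) (.times (.var par) 70)),
  letNat pow (.const 1), letNat ell (.const 1), iter cnt 0 logStep,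
  letNat numEx (.var ell), double numEx expo]

theorem eval_parameters (hn : 0 < n) (s : State n) (h0 : s.nat 0 0 = n) {U : ℕ}
    (hU : U = s.nat lg 0 + 18) :
    ∃ l, 2 * n ≤ 2 ^ l ∧ 2 ^ l < 4 * n ∧
      ((block parameters).eval s).nat numEx 0 = sampleSize U l ∧
      ((block parameters).eval s).nat dimSucc 0 = n + 1 ∧
      ((block parameters).eval s).nat thr 0 = 2 ^ (33 * U) ∧
      ((block parameters).eval s).nat base 0 = 2 ^ (34 * U) ∧
      ((block parameters).eval s).nat width 0 = roundSize U ∧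
      ((block parameters).eval s).nat rounds 0 = 4 * U ∧
      ((block parameters).eval s).nat maxLen 0 = 4 * U * roundSize U ∧
      ((block parameters).eval s).nat codes 0 = 2 ^ (34 * U * roundSize U) := by
  have hlog : ∀ (s : State n) (a : ℕ), a ≠ cnt → a ∉ logStep.natWrites →
      ((iter cnt 0 logStep).eval s).nat a 0 = s.nat a 0 := fun s a ha ha' => by
    rw [eval_nat]
    simp [natWrites, ha, ha']
  simp only [parameters, eval_block_cons]
  generalize hs₁ : (letNat ell (.const 1)).eval _ = s₁
  obtain ⟨h1, h2⟩ := eval_log hn s₁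
    (by
      rw [← hs₁]
      simp +decide only [eval_letNat_zero, eval_double, eval_accumulate, if_false, h0])
    (by
      rw [← hs₁]
      simp +decide only [eval_letNat_zero, if_true, if_false, NExp.val])
    (by
      rw [← hs₁]
      simp +decide only [eval_letNat_zero, if_true, NExp.val])
  refine ⟨_, h1, h2, ?_⟩
  generalize hs₂ : (iter cnt 0 logStep).eval s₁ = s₂
  have hval : ∀ a, a ≠ cnt → a ∉ logStep.natWrites → s₂.nat a 0 = s₁.nat a 0 := fun a ha ha' => by
    rw [← hs₂, hlog s₁ a ha ha']
  have v2 : s₁.nat maxLen 0 = 4 * U * roundSize U := by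
    rw [← hs₁]
    simp +decide only [eval_letNat_zero, eval_double, eval_accumulate, if_true, if_false, NExp.val,
      NExp.val_times, NExp.val_var, ← hU, roundSize, zero_add]
  have v3 : s₁.nat expo 0 = 2 * (4 * U * roundSize U + 3) + 70 * U := by
    rw [← hs₁]
    simp +decide only [eval_letNat_zero, eval_double, eval_accumulate, if_true, if_false, NExp.val,
      NExp.val_times, NExp.val_var, ← hU, roundSize, zero_add]
  have v4 : s₁.nat dimSucc 0 = n + 1 := by
    rw [← hs₁]
    simp +decide only [eval_letNat_zero, eval_double, eval_accumulate, if_true, if_false, NExp.val,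
      NExp.val_times, NExp.val_var, h0]
  have v5 : s₁.nat thr 0 = 2 ^ (33 * U) := by
    rw [← hs₁]
    simp +decide only [eval_letNat_zero, eval_double, eval_accumulate, if_true, if_false, NExp.val,
      NExp.val_times, NExp.val_var, ← hU, one_mul]
  have v6 : s₁.nat base 0 = 2 ^ (34 * U) := by
    rw [← hs₁]
    simp +decide only [eval_letNat_zero, eval_double, eval_accumulate, if_true, if_false, NExp.val,
      NExp.val_times, NExp.val_var, ← hU, one_mul]
  have v7 : s₁.nat width 0 = roundSize U := by
    rw [← hs₁]
    simp +decide only [eval_letNat_zero, eval_double, eval_accumulate, if_true, if_false, NExp.val,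
      NExp.val_times, NExp.val_var, ← hU, roundSize]
  have v8 : s₁.nat rounds 0 = 4 * U := by
    rw [← hs₁]
    simp +decide only [eval_letNat_zero, eval_double, eval_accumulate, if_true, if_false, NExp.val,
      NExp.val_times, NExp.val_var, ← hU]
  have v9 : s₁.nat codes 0 = 2 ^ (34 * U * roundSize U) := by
    rw [← hs₁]
    simp +decide only [eval_letNat_zero, eval_double, eval_accumulate, if_true, if_false, NExp.val,
      NExp.val_times, NExp.val_var, ← hU, roundSize, zero_add, one_mul]
  simp +decide only [eval_block_nil, eval_letNat_zero, eval_double, if_true, if_false, NExp.val_var,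
    sampleSize, cellSize]
  rw [hval expo (by decide) (by decide), hval dimSucc (by decide) (by decide),
    hval thr (by decide) (by decide), hval base (by decide) (by decide),
    hval width (by decide) (by decide), hval rounds (by decide) (by decide),
    hval maxLen (by decide) (by decide), hval codes (by decide) (by decide),
    v2, v3, v4, v5, v6, v7, v8, v9]
  exact ⟨rfl, rfl, rfl, rfl, rfl, rfl, rfl, rfl⟩

end Prog

end RealRAM

namespace RealRAM

open Mem

variable {n : ℕ}

namespace Prog

/-- The numbers of iterations of all loops in a list of programs that are executed one after the
other are less than `A`, for the bounds in `l`, and less than `W`, for the other bounds. -/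
def BoundsLT (l : List ℕ) (A W : ℕ) : List Prog → State n → Prop
  | [], _ => True
  | p :: ps, s => (∀ B ∈ p.bounds, s.nat B 0 + 1 ≤ if B ∈ l then A else W)
      ∧ BoundsLT l A W ps (p.eval s)

theorem exec_block (l : List ℕ) {A W : ℕ} (hA : 1 ≤ A) (hW : 1 ≤ W) (ps : List Prog)
    (hps : ∀ p ∈ ps, p.WellFormed = true ∧ p.depth l ≤ 1 ∧ p.codepth l ≤ 1) (s : State n)
    (hb : BoundsLT l A W ps s) :
    ∃ k, Exec (block ps).compile s ((block ps).eval s) k ∧ k ≤ (block ps).size * (A * W) := by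
  induction ps generalizing s with
  | nil => exact ⟨1, Exec.skip s, by
      simp only [block, size, one_mul]
      exact Nat.mul_pos hA hW⟩
  | cons p ps ih =>
    obtain ⟨h1, h2, h3⟩ := hps p (by simp)
    obtain ⟨k, hk, hk'⟩ := exec l hA hW p h1 s hb.1
    obtain ⟨k', hk'', hk'''⟩ := ih (fun q hq => hps q (by simp [hq])) (p.eval s) hb.2
    refine ⟨k + k', Exec.seq hk hk'', ?_⟩
    rw [block, size, add_mul]
    refine add_le_add (hk'.trans (Nat.mul_le_mul_left _ ?_)) hk'''
    exact Nat.mul_le_mul ((Nat.pow_le_pow_right hA h2).trans (pow_one A).le)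
      ((Nat.pow_le_pow_right hW h3).trans (pow_one W).le)

theorem boundsLT_parameters (s : State n) (h0 : s.nat 0 0 = n) {U : ℕ}
    (hU : U = s.nat lg 0 + 18) {W : ℕ} (hW1 : 34 * U * roundSize U < W)
    (hW2 : 2 * cellSize U + 70 * U < W) :
    BoundsLT [0, dimSucc] (n + 2) W parameters s := by
  have e1 : ∀ d e, (double d e).bounds = [e] := fun _ _ => rfl
  have e2 : ∀ d e, (letNat d e).bounds = [] := fun _ _ => rfl
  have e3 : ∀ d e b, (accumulate d e b).bounds = [e] := fun _ _ _ => rfl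
  have e4 : (iter cnt 0 logStep).bounds = [0] := rfl
  have e5 : ∀ s : State n, ((iter cnt 0 logStep).eval s).nat expo 0 = s.nat expo 0 := fun s => by
    rw [eval_nat (by decide)]
  rw [cellSize] at hW2
  have eR : U * 2 ^ (2 * U + 4) = roundSize U := rfl
  simp +decide only [parameters, BoundsLT, e1, e2, e3, e4, e5, List.forall_mem_cons,
    List.not_mem_nil, false_imp_iff, implies_true, and_true, true_and, if_true, if_false,
    eval_letNat_zero, eval_double, eval_accumulate, NExp.val, NExp.val_times, NExp.val_var, ← hU,
    h0, zero_add, eR]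
  refine ⟨?_, ?_, ?_, ?_, ?_, ?_, ?_, ?_⟩
  all_goals omega

/-- Store the example drawn last. -/
def store : Prog := block [setNat start (.var ex) (.var next),
  iter i dimSucc (setNat bits (.add (.var next) (.var i)) (.get drawn (.var i))),
  setReal lab (.var ex) (.var label), letNat next (.add (.var next) (.var dimSucc)),
  letNat ex (.add (.var ex) (.const 1))]

theorem eval_store (s : State n) :
    (store.eval s).nat start = Function.update (s.nat start) (s.nat ex 0) (s.nat next 0) ∧
    (∀ p, (store.eval s).nat bits p = if s.nat next 0 ≤ p ∧ p < s.nat next 0 + s.nat dimSucc 0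
      then s.nat drawn (p - s.nat next 0) else s.nat bits p) ∧
    (store.eval s).real lab = Function.update (s.real lab) (s.nat ex 0) (s.real label 0) ∧
    (store.eval s).nat next 0 = s.nat next 0 + s.nat dimSucc 0 ∧
    (store.eval s).nat ex 0 = s.nat ex 0 + 1 := by
  set s₁ := s.putNat start (s.nat ex 0) (s.nat next 0) with hs₁
  have hs₁n : ∀ a, a ≠ start → s₁.nat a = s.nat a := fun a ha => by
    rw [hs₁, State.putNat_nat_of_ne _ _ _ ha]
  have key := eval_iter (s := s₁) (v := i) (B := dimSucc)
    (p := setNat bits (.add (.var next) (.var i)) (.get drawn (.var i))) (fun k s' =>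
      ∀ p, s'.nat bits p = if s.nat next 0 ≤ p ∧ p < s.nat next 0 + k
        then s.nat drawn (p - s.nat next 0) else s.nat bits p) (by
    intro p
    rw [if_neg (by omega), State.putNat_nat_of_ne _ _ _ (by decide), hs₁n _ (by decide)]) (by
    intro k s' hk hv hn hr hI p
    have e1 : s'.nat next = s.nat next :=
      (hn _ (by decide) (by decide)).trans (hs₁n _ (by decide))
    have e2 : s'.nat drawn = s.nat drawn :=
      (hn _ (by decide) (by decide)).trans (hs₁n _ (by decide))
    rw [State.putNat_nat_of_ne _ _ _ (by decide), eval_setNat, State.putNat_nat_self]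
    simp only [NExp.val, NExp.val_var, hv, e1, e2, Function.update_apply, hI p]
    split_ifs with h1 h2 h3 h4 h5
    all_goals first | rfl | omega | (subst h1; simp))
  rw [hs₁n _ (by decide)] at key
  simp only [store, eval_block_cons, eval_block_nil, eval_setNat, NExp.val_var, eval_setReal,
    eval_letNat, NExp.val, ← hs₁]
  set s₂ := (iter i dimSucc (setNat bits (.add (.var next) (.var i)) (.get drawn (.var i)))).eval s₁
    with hs₂
  have c : ∀ a, a ≠ i → a ≠ bits → s₂.nat a = s₁.nat a := fun a ha ha' => by
    rw [hs₂, eval_nat]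
    simp [natWrites, ha, ha']
  have c' : s₂.real = s.real := by
    funext a
    rw [hs₂, eval_real (by simp [realWrites]), hs₁, State.putNat_real]
  refine ⟨?_, ?_, ?_, ?_, ?_⟩
  · simp +decide only [State.putNat_nat_of_ne, State.putReal_nat, c, ne_eq]
    rw [hs₁, State.putNat_nat_self]
  · intro p
    simp +decide only [State.putNat_nat_of_ne, State.putReal_nat, ne_eq]
    exact key p
  · simp +decide only [State.putNat_real, State.putReal_real_self, c, c', hs₁n, ne_eq,
      RExp.val_var]
  · simp +decide only [State.putNat_nat_of_ne, State.putReal_nat, c, ne_eq,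
      State.putNat_nat_self, Function.update_self, hs₁n]
  · simp +decide only [State.putNat_nat_of_ne, State.putReal_nat, c, ne_eq,
      State.putNat_nat_self, Function.update_self, hs₁n]

end Prog

/-! ### Drawing the sample -/

open Prog

/-- Draw and store the examples. -/
def sampleLoop : Cmd := .loop (.ltNat (.var ex) (.var numEx)) (.seq (.draw drawn label)
  store.compile)

/-- The memory after `k` of the examples have been drawn. -/
structure HasDrawn {m : ℕ} (f : (Fin n → Bool) → ℝ) (S : Fin m → Fin n → Bool) (k : ℕ)
    (s : State n) : Prop where
  ex_eq : s.nat ex 0 = k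
  next_eq : s.nat next 0 = k * (n + 1)
  dim_eq : s.nat dimSucc 0 = n + 1
  num_eq : s.nat numEx 0 = m
  drawn_eq : s.nat drawn n = 0
  start_eq : ∀ r : Fin m, r.val < k → s.nat start r = r * (n + 1)
  bits_eq : ∀ r : Fin m, r.val < k → ∀ i < n + 1, s.nat bits (r * (n + 1) + i) = bitVal (S r) i
  lab_eq : ∀ r : Fin m, r.val < k → s.real lab r = f (S r)
  examples_eq : s.examples = (List.ofFn fun r => (S r, f (S r))).drop k

/-- The last `j` iterations of the loop. -/
theorem exec_sampleLoop {m : ℕ} {f : (Fin n → Bool) → ℝ} {S : Fin m → Fin n → Bool} (j k : ℕ)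
    (hjk : k + j = m) (s : State n) (hs : HasDrawn f S k s) :
    ∃ s' t, Exec sampleLoop s s' t ∧ t ≤ j * ((store.size + 7) * (n + 2)) + 6 ∧
      HasDrawn f S m s' ∧ (∀ a, a ≠ drawn → a ∉ store.natWrites → s'.nat a = s.nat a) ∧
      ∀ a, a ≠ label → a ∉ store.realWrites → s'.real a = s.real a := by
  induction j generalizing k s with
  | zero =>
    have h : ¬ (BExp.ltNat (.var ex) (.var numEx)).holds s := by
      simp only [BExp.holds, NExp.val_var, hs.ex_eq, hs.num_eq]; omega
    obtain rfl : k = m := by omega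
    exact ⟨s, 6, Exec.loopFalse (p := .seq (.draw drawn label) store.compile) h, by omega, hs,
      fun _ _ _ => rfl, fun _ _ _ => rfl⟩
  | succ j ih =>
    have hkm : k < m := by omega
    have h : (BExp.ltNat (.var ex) (.var numEx)).holds s := by
      simp only [BExp.holds, NExp.val_var, hs.ex_eq, hs.num_eq]; exact hkm
    have hex : s.examples = (S ⟨k, hkm⟩, f (S ⟨k, hkm⟩))
        :: (List.ofFn fun r => (S r, f (S r))).drop (k + 1) := by
      rw [hs.examples_eq, List.drop_eq_getElem_cons (by simpa using hkm)]
      simp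
    have hdraw := Exec.draw drawn label s _ _ _ hex
    set s₁ := ((s.putPoint drawn (S ⟨k, hkm⟩)).putReal label 0 (f (S ⟨k, hkm⟩))).setExamples
      ((List.ofFn fun r => (S r, f (S r))).drop (k + 1)) with hs₁
    have c1 : ∀ a, a ≠ drawn → s₁.nat a = s.nat a := fun a ha => by
      simp [hs₁, State.putPoint, State.putReal, State.setExamples, ha]
    have c2 : ∀ a, a ≠ label → s₁.real a = s.real a := fun a ha => by
      simp [hs₁, State.putPoint, State.putReal, State.setExamples, ha]
    have c3 : ∀ i < n + 1, s₁.nat drawn i = bitVal (S ⟨k, hkm⟩) i := fun i hi => by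
      simp only [hs₁, State.putPoint, State.putReal, State.setExamples, Function.update_self,
        bitVal]
      split_ifs with h
      · rfl
      · rw [show i = n by omega, hs.drawn_eq]
    have c4 : s₁.real label 0 = f (S ⟨k, hkm⟩) := by
      simp [hs₁, State.putPoint, State.putReal, State.setExamples]
    have c5 : s₁.examples = (List.ofFn fun r => (S r, f (S r))).drop (k + 1) := rfl
    obtain ⟨t, ht, ht'⟩ := exec [0, dimSucc] (A := n + 2) (W := 1) (by omega) le_rfl store
      (by decide) s₁ (fun B hB => by
        have : B = dimSucc := by simpa [store, block, bounds, letNat] using hB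
        subst this
        rw [c1 _ (by decide), hs.dim_eq]
        simp)
    have hdep : store.depth [0, dimSucc] = 1 := by decide
    rw [hdep, pow_one, one_pow, mul_one] at ht'
    obtain ⟨d1, d2, d3, d4, d5⟩ := eval_store s₁
    rw [c1 _ (by decide), c1 _ (by decide), c1 _ (by decide), hs.ex_eq, hs.next_eq] at d1
    rw [c1 next (by decide), c1 dimSucc (by decide), c1 bits (by decide), hs.next_eq, hs.dim_eq] at d2
    rw [c1 _ (by decide), c2 _ (by decide), hs.ex_eq, c4] at d3
    rw [c1 _ (by decide), c1 _ (by decide), hs.next_eq, hs.dim_eq] at d4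
    rw [c1 _ (by decide), hs.ex_eq] at d5
    have hnew : HasDrawn f S (k + 1) (store.eval s₁) := by
      refine ⟨d5, by rw [d4]; ring, ?_, ?_, ?_, fun r hr => ?_, fun r hr i hi => ?_, fun r hr => ?_,
        ?_⟩
      · rw [eval_nat (by decide), c1 _ (by decide), hs.dim_eq]
      · rw [eval_nat (by decide), c1 _ (by decide), hs.num_eq]
      · rw [eval_nat (by decide), c3 n (by omega)]
        simp [bitVal]
      · rw [d1]
        rcases Nat.lt_succ_iff_lt_or_eq.1 hr with hr | hr
        · rw [Function.update_of_ne (by omega), hs.start_eq r hr]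
        · rw [hr, Function.update_self]
      · rw [d2]
        rcases Nat.lt_succ_iff_lt_or_eq.1 hr with hr | hr
        · have : (r.val + 1) * (n + 1) ≤ k * (n + 1) := Nat.mul_le_mul_right _ hr
          rw [add_mul, one_mul] at this
          rw [if_neg (by omega), hs.bits_eq r hr i hi]
        · rw [if_pos (by rw [hr]; omega), hr, Nat.add_sub_cancel_left, c3 i hi]
          congr
          exact hr.symm
      · rw [d3]
        rcases Nat.lt_succ_iff_lt_or_eq.1 hr with hr | hr
        · rw [Function.update_of_ne (by omega), hs.lab_eq r hr]
        · rw [hr, Function.update_self]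
          congr 2
          exact Fin.ext hr.symm
      · rw [eval_examples, c5]
    obtain ⟨s', t', hs', ht'', hdr, hn, hr⟩ := ih (k + 1) (by omega) (store.eval s₁) hnew
    refine ⟨s', _, Exec.loopTrue h (Exec.seq hdraw ht) hs', ?_, hdr, fun a ha ha' => ?_,
      fun a ha ha' => ?_⟩
    · have : (BExp.ltNat (.var ex) (.var numEx)).cost = 5 := rfl
      rw [this]
      nlinarith
    · rw [hn a ha ha', eval_nat ha', c1 a ha]
    · rw [hr a ha ha', eval_real ha', c2 a ha]

end RealRAM

namespace RealRAM

open Mem Prog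

variable {n : ℕ}

/-! ### The learner -/

/-- `2 ^ L` is the first power of two that is at least `1 / q`. -/
def IsScale (q : ℝ) (L : ℕ) : Prop := 1 ≤ 2 ^ L * q ∧ (L = 0 ∨ 2 ^ L * q < 2)

theorem IsScale.le {q : ℝ} (hq : 0 < q) {L L' : ℕ} (h : IsScale q L) (h' : IsScale q L') :
    L' ≤ L := by
  by_contra hlt
  rcases h'.2 with h0 | h2
  · omega
  · have : (2:ℝ) ^ (L + 1) ≤ 2 ^ L' := pow_le_pow_right₀ (by norm_num) (by omega)
    rw [pow_succ] at this
    have := mul_le_mul_of_nonneg_right this hq.le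
    linarith [h.1]

theorem exists_isScale {q : ℝ} (hq : 0 < q) : ∃ L, IsScale q L := by
  have hex : ∃ L : ℕ, 1 ≤ 2 ^ L * q := by
    obtain ⟨L, hL⟩ := pow_unbounded_of_one_lt (1 / q) (by norm_num : (1:ℝ) < 2)
    exact ⟨L, by rw [div_lt_iff₀ hq] at hL; exact hL.le⟩
  classical
  refine ⟨Nat.find hex, Nat.find_spec hex, ?_⟩
  rcases Nat.eq_zero_or_pos (Nat.find hex) with h | h
  · exact Or.inl h
  · right
    have := Nat.find_min hex (Nat.sub_lt h one_pos)
    push Not at this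
    have e : (2:ℝ) ^ Nat.find hex = 2 * 2 ^ (Nat.find hex - 1) := by
      rw [← pow_succ', Nat.sub_add_cancel h]
    rw [e]
    linarith

/-- Double `pow`. -/
def scaleStep : Prog := block [letNat pow (.add (.var pow) (.var pow)),
  letNat lg (.add (.var lg) (.const 1))]

/-- Double `pow` until it is at least `1 / (ε γ)`. -/
def scaleLoop : Cmd := .loop (.ltReal (.mul (.ofNat (.var pow))
  (.mul (.get 0 (.const 1)) (.get 0 (.const 0)))) (.ofNat (.const 1))) scaleStep.compile

/-- The loop halts with the exponent of the scale in `lg`; `j` bounds the number of remaining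
iterations. -/
theorem exec_scaleLoop {q : ℝ} (j : ℕ) (s : State n) (hq : s.real 0 1 * s.real 0 0 = q)
    (hpow : s.nat pow 0 = 2 ^ s.nat lg 0) (hj : 1 ≤ 2 ^ (s.nat lg 0 + j) * q)
    (h2 : s.nat lg 0 = 0 ∨ 2 ^ s.nat lg 0 * q < 2) :
    ∃ s' t L, Exec scaleLoop s s' t ∧ t ≤ 27 * (L - s.nat lg 0) + 13 ∧ IsScale q L ∧
      s.nat lg 0 ≤ L ∧ s'.nat lg 0 = L ∧ (∀ a, a ∉ scaleStep.natWrites → s'.nat a = s.nat a) ∧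
      s'.real = s.real ∧ s'.examples = s.examples := by
  have hb : ∀ s : State n, (BExp.ltReal (.mul (.ofNat (.var pow))
      (.mul (.get 0 (.const 1)) (.get 0 (.const 0)))) (.ofNat (.const 1))).holds s
      ↔ (s.nat pow 0 : ℝ) * (s.real 0 1 * s.real 0 0) < 1 := fun s => by
    simp [BExp.holds, RExp.val, NExp.val]
  induction j generalizing s with
  | zero =>
    refine ⟨s, 13, s.nat lg 0, Exec.loopFalse (p := scaleStep.compile) ?_, by omega, ⟨hj, h2⟩, le_rfl,
      rfl, fun _ _ => rfl, rfl, rfl⟩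
    rw [hb, hq, hpow]
    push_cast
    exact not_lt.2 hj
  | succ j ih =>
    by_cases h : (s.nat pow 0 : ℝ) * (s.real 0 1 * s.real 0 0) < 1
    · have e1 : (scaleStep.eval s).nat lg 0 = s.nat lg 0 + 1 := by
        simp +decide only [scaleStep, eval_block_cons, eval_block_nil, eval_letNat_zero, NExp.val,
          NExp.val_var, if_true, if_false]
      have e2 : (scaleStep.eval s).nat pow 0 = s.nat pow 0 + s.nat pow 0 := by
        simp +decide only [scaleStep, eval_block_cons, eval_block_nil, eval_letNat_zero, NExp.val,
          NExp.val_var, if_true, if_false]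
      have e3 : (scaleStep.eval s).real = s.real := rfl
      obtain ⟨k, hk, hk'⟩ := exec [] (A := 1) (W := 1) le_rfl le_rfl scaleStep (by decide) s
        (fun B hB => by simp [scaleStep, block, bounds, letNat] at hB)
      have hk'' : k ≤ 14 := by simpa [scaleStep, block, size, letNat, NExp.cost, NExp.var] using hk'
      rw [hpow] at h e2
      rw [hq] at h
      push_cast at h
      obtain ⟨s', t, L, h3, h4, h5, h6, h7, h8, h9, h10⟩ := ih (scaleStep.eval s) (by rw [e3, hq])
        (by rw [e1, e2]; ring) (by rw [e1, add_assoc, add_comm 1 j]; exact hj)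
        (Or.inr (by rw [e1, pow_succ]; linarith))
      rw [e1] at h4 h6
      refine ⟨s', _, L, Exec.loopTrue ((hb s).2 (by rw [hpow, hq]; push_cast; exact h)) hk h3, ?_, h5,
        by omega, h7, fun a ha => by rw [h8 a ha, eval_nat ha], by rw [h9, e3],
        by rw [h10, eval_examples]⟩
      have : (BExp.ltReal (.mul (.ofNat (.var pow))
        (.mul (.get 0 (.const 1)) (.get 0 (.const 0)))) (.ofNat (.const 1))).cost = 12 := rfl
      rw [this]
      omega
    · refine ⟨s, 13, s.nat lg 0, Exec.loopFalse (p := scaleStep.compile) (by rwa [hb]), by omega,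
        ⟨?_, h2⟩, le_rfl, rfl, fun _ _ => rfl, rfl, rfl⟩
      rw [hq, hpow] at h
      push_cast at h
      exact not_lt.1 h

/-- The learning program: it determines the parameters, and stores the sample. -/
def learn : Cmd := .seq (letNat pow (.const 1)).compile (.seq scaleLoop
  (.seq (block parameters).compile
    (.seq (block [letNat ex (.const 0), letNat next (.const 0)]).compile sampleLoop)))

theorem exec_reset (s : State n) :
    Exec (block [letNat ex (.const 0), letNat next (.const 0)]).compile s
      ((block [letNat ex (.const 0), letNat next (.const 0)]).eval s) 7 :=
  Exec.seq (Exec.setNat ex (.const 0) (.const 0) s)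
    (Exec.seq (Exec.setNat next (.const 0) (.const 0) _) (Exec.skip _))

/-- The memory that the learner leaves. -/
structure HasLearnt {m : ℕ} (f : (Fin n → Bool) → ℝ) (S : Fin m → Fin n → Bool) (γ : ℝ) (U : ℕ)
    (s : State n) : Prop where
  sample : StoresSample f S s.bitsOf (s.real lab)
  dim_eq : s.nat 0 0 = n
  point_eq : s.nat point = fun _ => 0
  real_eq : s.real 0 0 = γ
  num_eq : s.nat numEx 0 = m
  dimSucc_eq : s.nat dimSucc 0 = n + 1
  thr_eq : s.nat thr 0 = 2 ^ (33 * U)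
  base_eq : s.nat base 0 = 2 ^ (34 * U)
  width_eq : s.nat width 0 = roundSize U
  rounds_eq : s.nat rounds 0 = 4 * U
  maxLen_eq : s.nat maxLen 0 = 4 * U * roundSize U
  codes_eq : s.nat codes 0 = 2 ^ (34 * U * roundSize U)

/-- The learner halts in a memory that stores the sample and the parameters. -/
theorem exec_learn (hn : 0 < n) {γ ε : ℝ} (hγ : 0 < γ) (hε : 0 < ε) {L U l m W : ℕ}
    (hL : IsScale (ε * γ) L) (hU : U = L + 18) (hl : 2 * n ≤ 2 ^ l) (hl' : 2 ^ l < 4 * n)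
    (hm : m = sampleSize U l) (hW1 : 34 * U * roundSize U < W)
    (hW2 : 2 * cellSize U + 70 * U < W) (f : (Fin n → Bool) → ℝ) (S : Fin m → Fin n → Bool) :
    ∃ s t, Exec learn (State.init γ ε (List.ofFn fun i => (S i, f (S i)))) s t ∧
      t ≤ 27 * L + (block parameters).size * ((n + 2) * W) + m * ((store.size + 7) * (n + 2)) + 32 ∧
      HasLearnt f S γ U s := by
  set s₀ : State n := State.init γ ε (List.ofFn fun i => (S i, f (S i))) with hs₀
  have hz : ∀ a, a ≠ 0 → s₀.nat a = fun _ => 0 := fun a ha => by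
    funext i
    simp [hs₀, State.init, ha]
  have hz0 : s₀.nat 0 0 = n := by simp [hs₀, State.init]
  have hr0 : s₀.real 0 0 = γ := by simp [hs₀, State.init]
  have hr1 : s₀.real 0 1 = ε := by simp [hs₀, State.init]
  set s₁ : State n := (letNat pow (.const 1)).eval s₀ with hs₁
  have x₁ : Exec (letNat pow (.const 1)).compile s₀ s₁ 3 :=
    Exec.setNat pow (.const 0) (.const 1) s₀
  have hlg : s₁.nat lg 0 = 0 := by
    rw [hs₁, eval_letNat_zero, if_neg (by decide), hz _ (by decide)]
  have hq : (0:ℝ) < ε * γ := mul_pos hε hγ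
  obtain ⟨s₂, t₂, L', x₂, ht₂, hL', -, hlg₂, hn₂, hr₂, hex₂⟩ := exec_scaleLoop (q := ε * γ) L s₁
    (by rw [hs₁, eval_letNat, State.putNat_real, hr0, hr1])
    (by rw [hlg, hs₁, eval_letNat_zero, if_pos rfl]; rfl) (by rw [hlg, zero_add]; exact hL.1)
    (Or.inl hlg)
  obtain rfl : L' = L := le_antisymm (hL.le hq hL') (hL'.le hq hL)
  rw [hlg, Nat.sub_zero] at ht₂
  have hn₂' : ∀ a, a ∉ scaleStep.natWrites → a ≠ pow → s₂.nat a = s₀.nat a := fun a ha ha' => by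
    rw [hn₂ a ha, hs₁, eval_letNat, State.putNat_nat_of_ne _ _ _ ha']
  have hr₂' : s₂.real = s₀.real := hr₂
  have h02 : s₂.nat 0 0 = n := by rw [hn₂' _ (by decide) (by decide), hz0]
  have hU₂ : U = s₂.nat lg 0 + 18 := by rw [hlg₂, hU]
  obtain ⟨t₃, x₃, ht₃⟩ := exec_block [0, dimSucc] (A := n + 2) (W := W) (by omega) (by omega)
    parameters (by decide) s₂ (boundsLT_parameters s₂ h02 hU₂ hW1 hW2)
  obtain ⟨l', hl₁, hl₂, p1, p2, p3, p4, p5, p6, p7, p8⟩ := eval_parameters hn s₂ h02 hU₂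
  obtain rfl : l' = l := by
    have h1 : 2 ^ l' < 2 ^ (l + 1) := by rw [pow_succ]; omega
    have h2 : 2 ^ l < 2 ^ (l' + 1) := by rw [pow_succ]; omega
    have := (Nat.pow_lt_pow_iff_right (by norm_num)).1 h1
    have := (Nat.pow_lt_pow_iff_right (by norm_num)).1 h2
    omega
  generalize hs₃ : (block parameters).eval s₂ = s₃ at x₃ p1 p2 p3 p4 p5 p6 p7 p8
  have x₄ := exec_reset s₃
  generalize hs₄ : (block [letNat ex (.const 0), letNat next (.const 0)]).eval s₃ = s₄ at x₄
  have hn₄ : ∀ a, a ≠ ex → a ≠ next → s₄.nat a = s₃.nat a := fun a ha ha' => by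
    rw [← hs₄, eval_nat]
    simp [block, letNat, natWrites, ha, ha']
  have hn₃ : ∀ a, a ∉ (block parameters).natWrites → s₃.nat a = s₂.nat a := fun a ha => by
    rw [← hs₃, eval_nat ha]
  have hr₄ : s₄.real = s₀.real := by
    have : s₃.real = s₂.real := by
      funext a
      have : (block parameters).realWrites = [] := by decide
      rw [← hs₃, eval_real (by simp [this])]
    rw [← hr₂', ← this]
    funext a
    rw [← hs₄, eval_real (by simp [block, letNat, realWrites])]
  have hdrawn : HasDrawn f S 0 s₄ := by
    refine ⟨?_, ?_, ?_, ?_, ?_, fun r hr => absurd hr (Nat.not_lt_zero _),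
      fun r hr => absurd hr (Nat.not_lt_zero _), fun r hr => absurd hr (Nat.not_lt_zero _), ?_⟩
    · rw [← hs₄]
      simp +decide only [eval_block_cons, eval_block_nil, eval_letNat_zero, NExp.val, if_true,
        if_false]
    · rw [← hs₄, zero_mul]
      simp +decide only [eval_block_cons, eval_block_nil, eval_letNat_zero, NExp.val, if_true]
    · rw [hn₄ _ (by decide) (by decide), p2]
    · rw [hn₄ _ (by decide) (by decide), p1, hm]
    · rw [hn₄ _ (by decide) (by decide), hn₃ _ (by decide), hn₂' _ (by decide) (by decide),
        hz _ (by decide)]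
    · rw [← hs₄, eval_examples, ← hs₃, eval_examples, hex₂, hs₁, eval_examples, List.drop_zero]
      rfl
  obtain ⟨s₅, t₅, x₅, ht₅, hd₅, hn₅, hr₅⟩ := exec_sampleLoop m 0 (zero_add m) s₄ hdrawn
  have x₃₅ := Exec.seq x₃ (Exec.seq x₄ x₅)
  have x₁₅ := Exec.seq x₁ (Exec.seq x₂ x₃₅)
  rw [← learn] at x₁₅
  refine ⟨s₅, _, x₁₅, ?_, ?_⟩
  · generalize (block parameters).size * ((n + 2) * W) = a at ht₃ ⊢
    generalize m * ((store.size + 7) * (n + 2)) = b at ht₅ ⊢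
    omega
  have hpar : ∀ a, a ≠ drawn → a ∉ store.natWrites → a ≠ ex → a ≠ next → s₅.nat a = s₃.nat a :=
    fun a h1 h2 h3 h4 => by rw [hn₅ a h1 h2, hn₄ a h3 h4]
  refine ⟨⟨fun r i hi => ?_, fun r => hd₅.lab_eq r r.2⟩, ?_, ?_, ?_, ?_, ?_, ?_, ?_, ?_, ?_, ?_, ?_⟩
  · rw [State.bitsOf, hd₅.start_eq r r.2, hd₅.bits_eq r r.2 i hi]
  · rw [hpar _ (by decide) (by decide) (by decide) (by decide), hn₃ _ (by decide), h02]
  · rw [hpar _ (by decide) (by decide) (by decide) (by decide), hn₃ _ (by decide),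
      hn₂' _ (by decide) (by decide), hz _ (by decide)]
  · rw [hr₅ _ (by decide) (by decide), hr₄, hr0]
  · exact hd₅.num_eq
  · exact hd₅.dim_eq
  all_goals rw [hpar _ (by decide) (by decide) (by decide) (by decide)]; assumption

/-- Evaluation of the hypothesis. -/
theorem exec_predict {γ : ℝ} {U m W : ℕ} {f : (Fin n → Bool) → ℝ} {S : Fin m → Fin n → Bool}
    {s : State n} (hs : HasLearnt f S γ U s) (hW1 : m < W) (hW2 : 2 ^ (34 * U) < W)
    (hW3 : 4 * U * roundSize U < W) (hW4 : 2 ^ (34 * U * roundSize U) < W) (hU : 0 < U)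
    (x : Fin n → Bool) :
    ∃ s' t, Exec predict.compile (s.query x) s' t ∧ t ≤ predict.size * ((n + 2) ^ 2 * W ^ 5) ∧
      s'.real 0 0 = prediction s.bitsOf (s.real lab) m n (2 ^ (33 * U)) (2 ^ (34 * U))
        (roundSize U) (4 * U) γ (bitVal x) := by
  have hq : ∀ a, a ≠ point → (s.query x).nat a = s.nat a := fun a ha => by
    simp [State.query, State.putPoint, State.setExamples, ha]
  have hqr : (s.query x).real = s.real := rfl
  have hqb : (s.query x).bitsOf = s.bitsOf :=
    State.bitsOf_congr (hq _ (by decide)) (hq _ (by decide))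
  have hqp : (s.query x).nat point = bitVal x := by
    funext i
    simp [State.query, State.putPoint, State.setExamples, bitVal, hs.point_eq]
  have hR : 0 < roundSize U := by rw [roundSize]; positivity
  obtain ⟨t, ht, ht'⟩ := exec [0, dimSucc] (A := n + 2) (W := W) (by omega) (by omega) predict
    (by decide) (s.query x) (fun B hB => by
      have hB' : B ∈ [0, dimSucc, numEx, base, width, rounds, maxLen, codes] := by
        have : ∀ B ∈ predict.bounds, B ∈ [0, dimSucc, numEx, base, width, rounds, maxLen, codes] := by
          decide
        exact this B hB
      have h4 : 4 * U ≤ 4 * U * roundSize U := Nat.le_mul_of_pos_right _ hR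
      have h5 : roundSize U ≤ 4 * U * roundSize U := Nat.le_mul_of_pos_left _ (by omega)
      simp only [List.mem_cons, List.not_mem_nil, or_false] at hB'
      rcases hB' with rfl | rfl | rfl | rfl | rfl | rfl | rfl | rfl
      · rw [hq _ (by decide), hs.dim_eq]; simp
      · rw [hq _ (by decide), hs.dimSucc_eq]; simp
      · rw [hq _ (by decide), hs.num_eq, if_neg (by decide)]; omega
      · rw [hq _ (by decide), hs.base_eq, if_neg (by decide)]; omega
      · rw [hq _ (by decide), hs.width_eq, if_neg (by decide)]; omega
      · rw [hq _ (by decide), hs.rounds_eq, if_neg (by decide)]; omega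
      · rw [hq _ (by decide), hs.maxLen_eq, if_neg (by decide)]; omega
      · rw [hq _ (by decide), hs.codes_eq, if_neg (by decide)]; omega)
  refine ⟨_, t, ht, ?_, ?_⟩
  · have h1 : predict.depth [0, dimSucc] = 2 := by decide
    have h2 : predict.codepth [0, dimSucc] = 5 := by decide
    rw [h1, h2] at ht'
    exact ht'
  · have := eval_predict (s.query x) (by rw [hq _ (by decide), hs.dim_eq])
      (by rw [hq _ (by decide), hs.dimSucc_eq])
      (by rw [hq _ (by decide), hs.base_eq]; positivity)
      (by rw [hq _ (by decide), hq _ (by decide), hq _ (by decide), hs.codes_eq, hs.base_eq,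
        hs.width_eq, ← pow_mul])
      (by rw [hq _ (by decide), hq _ (by decide), hq _ (by decide), hs.rounds_eq, hs.width_eq,
        hs.maxLen_eq])
    rw [this, hqb, hqr, hqp, hq _ (by decide), hq _ (by decide), hq _ (by decide),
      hq _ (by decide), hq _ (by decide), hs.num_eq, hs.thr_eq, hs.base_eq, hs.width_eq,
      hs.rounds_eq, hs.real_eq]

end RealRAM

/-! ### Resource bounds -/

section Resources

/-- An exponent such that `2 ^ expBound U` exceeds all parameters except the number of examples. -/
def expBound (U : ℕ) : ℕ := 2 * cellSize U + 70 * U + 34 * U * roundSize U + 1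

theorem expBound_le {U : ℕ} (hU : 1 ≤ U) : expBound U ≤ 1000 * U ^ 2 * 4 ^ U := by
  have e : expBound U = 672 * (U ^ 2 * 4 ^ U) + 70 * U + 7 := by
    rw [expBound, cellSize, roundSize, pow_add, pow_mul]
    norm_num
    ring
  have h1 : U ≤ U ^ 2 * 4 ^ U := by
    have : 1 ≤ 4 ^ U := Nat.one_le_pow _ _ (by norm_num)
    nlinarith
  rw [e, mul_assoc]
  omega

theorem two_pow_lt_of_lt_expBound {U l a : ℕ} (hl : 1 ≤ l) (ha : a < expBound U) :
    2 ^ a < l * 2 ^ expBound U :=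
  (Nat.pow_lt_pow_right (by norm_num) ha).trans_le (Nat.le_mul_of_pos_left _ hl)

theorem lt_of_lt_expBound {U l a : ℕ} (hl : 1 ≤ l) (ha : a < expBound U) :
    a < l * 2 ^ expBound U :=
  Nat.lt_two_pow_self.trans (two_pow_lt_of_lt_expBound hl ha)

theorem sampleSize_lt {U l : ℕ} (hl : 1 ≤ l) : sampleSize U l < l * 2 ^ expBound U := by
  rw [sampleSize]
  refine Nat.mul_lt_mul_of_pos_left (Nat.pow_lt_pow_right (by norm_num) ?_) hl
  rw [expBound]
  omega

variable {γ ε : ℝ} {L U l n : ℕ}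

/-- The exponent is `Õ(1 / (ε γ)²)`. -/
theorem expBound_le_softO (hq : 0 < ε * γ) (hq1 : ε * γ ≤ 1) (hL : RealRAM.IsScale (ε * γ) L)
    (hU : U = L + 18) :
    (expBound U : ℝ) ≤ 400000 * 4 ^ 19 * (1 / (ε * γ)) ^ 2
      * (max 1 (Real.logb 2 ((1 / (ε * γ)) ^ 2))) ^ 2 := by
  set q := ε * γ with hqdef
  set Q := (1 / q) ^ 2 with hQ
  set Λ := max 1 (Real.logb 2 Q) with hΛ
  have hΛ1 : 1 ≤ Λ := le_max_left _ _
  have hinv : 1 ≤ 1 / q := by rw [le_div_iff₀ hq]; linarith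
  have hQ1 : 1 ≤ Q := one_le_pow₀ hinv
  have h2L : (2:ℝ) ^ L ≤ 2 * (1 / q) := by
    rcases hL.2 with h | h
    · rw [h, pow_zero]; linarith
    · rw [mul_one_div, le_div_iff₀ hq]; exact h.le
  have h4L : (4:ℝ) ^ L ≤ 4 * Q := by
    have e : (4:ℝ) ^ L = (2 ^ L) ^ 2 := by rw [← pow_mul, mul_comm, pow_mul]; norm_num
    rw [e]
    calc ((2:ℝ) ^ L) ^ 2 ≤ (2 * (1 / q)) ^ 2 := pow_le_pow_left₀ (by positivity) h2L 2
      _ = 4 * Q := by rw [hQ]; ring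
  have hLΛ : (L:ℝ) ≤ 2 * Λ := by
    have h1 : Real.logb 2 ((4:ℝ) ^ L) ≤ Real.logb 2 (4 * Q) :=
      Real.logb_le_logb_of_le (by norm_num) (by positivity) h4L
    have h4 : Real.logb 2 4 = 2 := by
      rw [show (4:ℝ) = 2 ^ (2:ℕ) by norm_num, Real.logb_pow, Real.logb_self_eq_one (by norm_num)]
      norm_num
    rw [Real.logb_pow, Real.logb_mul (by norm_num) (by positivity), h4] at h1
    have : Real.logb 2 Q ≤ Λ := le_max_right _ _
    linarith
  have hUΛ : (U:ℝ) ≤ 20 * Λ := by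
    rw [hU]; push_cast; linarith
  have h4U : (4:ℝ) ^ U ≤ 4 ^ 19 * Q := by
    rw [hU, pow_add]
    have := mul_le_mul_of_nonneg_right h4L (by positivity : (0:ℝ) ≤ 4 ^ 18)
    linarith [(by norm_num : (4:ℝ) * 4 ^ 18 = 4 ^ 19)]
  calc (expBound U : ℝ) ≤ 1000 * (U:ℝ) ^ 2 * 4 ^ U := by
        exact_mod_cast expBound_le (by omega : 1 ≤ U)
    _ ≤ 1000 * (20 * Λ) ^ 2 * (4 ^ 19 * Q) := by gcongr
    _ = 400000 * 4 ^ 19 * Q * Λ ^ 2 := by ring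

theorem log_le (hn : 1 ≤ n) (hl : 2 ^ l < 4 * n) : (l : ℝ) ≤ 3 * max 1 (Real.logb 2 n) := by
  have hn' : (0:ℝ) < n := by exact_mod_cast hn
  have h1 : Real.logb 2 ((2:ℝ) ^ l) ≤ Real.logb 2 (4 * n) :=
    Real.logb_le_logb_of_le (by norm_num) (by positivity) (by exact_mod_cast hl.le)
  have h4 : Real.logb 2 4 = 2 := by
    rw [show (4:ℝ) = 2 ^ (2:ℕ) by norm_num, Real.logb_pow, Real.logb_self_eq_one (by norm_num)]
    norm_num
  rw [Real.logb_pow, Real.logb_mul (by norm_num) hn'.ne', h4,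
    Real.logb_self_eq_one (by norm_num)] at h1
  have h2 : 1 ≤ max 1 (Real.logb 2 n) := le_max_left _ _
  have h3 : Real.logb 2 n ≤ max 1 (Real.logb 2 n) := le_max_right _ _
  linarith

/-- A power of two within a factor of two of `2 * n`. -/
theorem exists_two_pow_between (hn : 1 ≤ n) : ∃ l, 2 * n ≤ 2 ^ l ∧ 2 ^ l < 4 * n := by
  refine ⟨Nat.clog 2 (2 * n), Nat.le_pow_clog (by norm_num) _, ?_⟩
  have h1 := Nat.pow_pred_clog_lt_self (b := 2) (by norm_num) (x := 2 * n) (by omega)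
  have h2 : 0 < Nat.clog 2 (2 * n) := Nat.clog_pos (by norm_num) (by omega)
  have h3 : 2 ^ Nat.clog 2 (2 * n) = 2 * 2 ^ (Nat.clog 2 (2 * n)).pred := by
    rw [← pow_succ', Nat.pred_eq_sub_one, Nat.sub_add_cancel h2]
  omega

theorem softO_ge {C C' t : ℝ} {c c' : ℕ} (hC : C' ≤ C) (hc : c' ≤ c) (ht : 0 ≤ t) (hC' : 0 ≤ C') :
    C' * t * (max 1 (Real.logb 2 t)) ^ c' ≤ softO C c t := by
  rw [softO]
  have h1 : (1:ℝ) ≤ max 1 (Real.logb 2 t) := le_max_left _ _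
  have h2 := pow_le_pow_right₀ h1 hc
  have h3 : 0 ≤ C * t := mul_nonneg (hC'.trans hC) ht
  gcongr

theorem sampleSize_le_exampleBound (hn : 1 ≤ n) (hq : 0 < ε * γ) (hq1 : ε * γ ≤ 1)
    (hL : RealRAM.IsScale (ε * γ) L) (hU : U = L + 18) (hl : 2 ^ l < 4 * n) {C : ℝ}
    (hC : 400000 * 4 ^ 19 ≤ C) {c : ℕ} (hc : 2 ≤ c) :
    (sampleSize U l : ℝ) ≤ exampleBound C c n γ ε := by
  rw [exampleBound, sampleSize]
  have h1 := log_le hn hl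
  have h2 := (expBound_le_softO hq hq1 hL hU).trans
    (softO_ge hC hc (sq_nonneg (1 / (ε * γ))) (by positivity))
  set s := softO C c ((1 / (ε * γ)) ^ 2)
  have hR : 0 < roundSize U := by
    rw [roundSize]
    have : 0 < U := by omega
    positivity
  have h3 : 2 + (2 * cellSize U + 70 * U) ≤ expBound U := by
    rw [expBound]
    have : 34 * U ≤ 34 * U * roundSize U := Nat.le_mul_of_pos_right _ hR
    omega
  have h4 : (2:ℝ) ^ (2 + (2 * cellSize U + 70 * U)) ≤ (2:ℝ) ^ s := by
    rw [← Real.rpow_natCast]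
    refine Real.rpow_le_rpow_of_exponent_le (by norm_num) (le_trans ?_ h2)
    exact_mod_cast h3
  rw [pow_add] at h4
  push_cast
  have h5 : 0 ≤ max 1 (Real.logb 2 n) := le_trans zero_le_one (le_max_left _ _)
  calc (l:ℝ) * 2 ^ (2 * cellSize U + 70 * U)
      ≤ 3 * max 1 (Real.logb 2 n) * 2 ^ (2 * cellSize U + 70 * U) := by gcongr
    _ ≤ max 1 (Real.logb 2 n) * (2 ^ 2 * 2 ^ (2 * cellSize U + 70 * U)) := by
        have : 0 ≤ max 1 (Real.logb 2 n) * 2 ^ (2 * cellSize U + 70 * U) := by positivity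
        linarith
    _ ≤ _ := by gcongr

theorem steps_le_timeBound (hn : 1 ≤ n) (hq : 0 < ε * γ) (hq1 : ε * γ ≤ 1)
    (hL : RealRAM.IsScale (ε * γ) L) (hU : U = L + 18) (hl : 2 ^ l < 4 * n) {C₀ : ℕ} {C : ℝ}
    (hC : 2000000 * 4 ^ 19 ≤ C) (hC₀ : 2187 * C₀ ≤ C) :
    ((C₀ * ((n + 2) ^ 2 * (l * 2 ^ expBound U) ^ 5) : ℕ) : ℝ) ≤ timeBound C 5 n γ ε := by
  have hn' : (1:ℝ) ≤ n := by exact_mod_cast hn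
  have h1 : (l:ℝ) ≤ 3 * max 1 (Real.logb 2 ((n:ℝ) ^ 2)) := by
    refine (log_le hn hl).trans ?_
    have : Real.logb 2 n ≤ Real.logb 2 ((n:ℝ) ^ 2) :=
      Real.logb_le_logb_of_le (by norm_num) (by positivity) (by nlinarith)
    gcongr
  have h2 : (5 * expBound U : ℝ) ≤ softO C 5 ((1 / (ε * γ)) ^ 2) := by
    have h3 := expBound_le_softO hq hq1 hL hU
    refine le_trans ?_ (softO_ge hC (by norm_num : 2 ≤ 5) (sq_nonneg (1 / (ε * γ))) (by positivity))
    linarith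
  set Λ := max 1 (Real.logb 2 ((n:ℝ) ^ 2)) with hΛ
  have hΛ1 : 0 ≤ Λ := le_trans zero_le_one (le_max_left _ _)
  have h4 : (2:ℝ) ^ (5 * expBound U) ≤ (2:ℝ) ^ softO C 5 ((1 / (ε * γ)) ^ 2) := by
    rw [← Real.rpow_natCast]
    refine Real.rpow_le_rpow_of_exponent_le (by norm_num) ?_
    push_cast
    exact h2
  rw [timeBound, softO, ← hΛ]
  push_cast
  have h5 : ((l:ℝ) * 2 ^ expBound U) ^ 5 ≤ (3 * Λ) ^ 5 * 2 ^ (5 * expBound U) := by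
    rw [mul_pow, ← pow_mul, mul_comm (expBound U)]
    gcongr
  have h6 : ((n:ℝ) + 2) ^ 2 ≤ 9 * (n:ℝ) ^ 2 := by nlinarith
  calc (C₀:ℝ) * (((n:ℝ) + 2) ^ 2 * ((l:ℝ) * 2 ^ expBound U) ^ 5)
      ≤ C₀ * (9 * (n:ℝ) ^ 2 * ((3 * Λ) ^ 5 * 2 ^ (5 * expBound U))) := by gcongr
    _ = 2187 * C₀ * (n:ℝ) ^ 2 * Λ ^ 5 * 2 ^ (5 * expBound U) := by ring
    _ ≤ C * (n:ℝ) ^ 2 * Λ ^ 5 * (2:ℝ) ^ softO C 5 ((1 / (ε * γ)) ^ 2) := by gcongr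

theorem learn_steps_le {P Q m W t : ℕ} (hm : m < W) (hL : L < W)
    (ht : t ≤ 27 * L + P * ((n + 2) * W) + m * ((Q + 7) * (n + 2)) + 32) :
    t ≤ (P + Q + 66) * ((n + 2) ^ 2 * W ^ 5) := by
  have h1 : W ≤ (n + 2) * W := Nat.le_mul_of_pos_left _ (by omega)
  have h2 : m * ((Q + 7) * (n + 2)) ≤ W * ((Q + 7) * (n + 2)) := Nat.mul_le_mul_right _ hm.le
  have h3 : W * ((Q + 7) * (n + 2)) = (Q + 7) * ((n + 2) * W) := by ring
  have h4 : (n + 2) * W ≤ (n + 2) ^ 2 * W ^ 5 :=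
    Nat.mul_le_mul (Nat.le_self_pow (by norm_num) _) (Nat.le_self_pow (by norm_num) _)
  refine le_trans ?_ (Nat.mul_le_mul_left _ h4)
  rw [h3] at h2
  generalize (n + 2) * W = X at *
  calc t ≤ P * X + (Q + 7) * X + 59 * X := by omega
    _ = (P + Q + 66) * X := by ring

/-- The two programs compute, on every sample, the hypothesis `prediction` built from the stored
sample, and their running times are bounded by a power of any `W` exceeding the parameters. -/
theorem exists_outputs (hn : 0 < n) (hγ : 0 < γ) (hε : 0 < ε) (hL : RealRAM.IsScale (ε * γ) L)
    (hU : U = L + 18) (hl : 2 * n ≤ 2 ^ l) (hl' : 2 ^ l < 4 * n) {m W C₀ : ℕ}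
    (hm : m = sampleSize U l) (hmW : m < W) (hW : ∀ a < expBound U, a < W ∧ 2 ^ a < W)
    (hC₀ : (RealRAM.Prog.block RealRAM.Prog.parameters).size + RealRAM.Prog.store.size + 66 ≤ C₀)
    (hC₁ : RealRAM.Prog.predict.size ≤ C₀) {T : ℝ}
    (hT : ((C₀ * ((n + 2) ^ 2 * W ^ 5) : ℕ) : ℝ) ≤ T)
    (f : (Fin n → Bool) → ℝ) (S : Fin m → Fin n → Bool) :
    ∃ (b : ℕ → ℕ → ℕ) (y : ℕ → ℝ), StoresSample f S b y ∧
      RealRAM.Outputs RealRAM.learn RealRAM.Prog.predict.compile γ ε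
        (List.ofFn fun i => (S i, f (S i))) T fun x =>
          prediction b y m n (2 ^ (33 * U)) (2 ^ (34 * U)) (roundSize U) (4 * U) γ (bitVal x) := by
  have hexp : expBound U = 2 * cellSize U + 70 * U + 34 * U * roundSize U + 1 := rfl
  have hcell : cellSize U = 4 * U * roundSize U + 3 := rfl
  have hU0 : 0 < U := by omega
  have hR : U ≤ U * roundSize U := Nat.le_mul_of_pos_right _ (by rw [roundSize]; positivity)
  rw [mul_assoc] at hexp hcell
  have e1 : 34 * U * roundSize U = 34 * (U * roundSize U) := mul_assoc _ _ _
  have e2 : 4 * U * roundSize U = 4 * (U * roundSize U) := mul_assoc _ _ _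
  have hLW : L < W := (hW L (by omega)).1
  obtain ⟨s, t, hexec, ht, hs⟩ := RealRAM.exec_learn hn hγ hε hL hU hl hl' hm
    (hW _ (by omega)).1 (hW _ (by omega)).1 f S
  have ht' := (learn_steps_le hmW hLW ht).trans (Nat.mul_le_mul_right _ hC₀)
  refine ⟨s.bitsOf, s.real RealRAM.Mem.lab, hs.sample, s,
    ⟨t, hexec, (Nat.cast_le.mpr ht').trans hT⟩, fun x => ?_⟩
  obtain ⟨s', t', h1, h2, h3⟩ := RealRAM.exec_predict hs hmW (hW _ (by omega)).2
    (hW _ (by omega)).1 (hW _ (by omega)).2 (by omega) x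
  have h2' := h2.trans (Nat.mul_le_mul_right _ hC₁)
  exact ⟨s', ⟨t', h1, (Nat.cast_le.mpr h2').trans hT⟩, h3⟩

end Resources

theorem theorem4 :
    ∃ (learn predict : RealRAM.Cmd) (C : ℝ) (c : ℕ),
      ∀ (n : ℕ) (γ ε : ℝ), 1 ≤ n → 0 < γ → γ ≤ 1 → 0 < ε → ε ≤ 1 →
        ∃ m : ℕ, (m : ℝ) ≤ exampleBound C c n γ ε ∧
          ∀ f : (Fin n → Bool) → ℝ, (∀ x, 0 ≤ f x) → SubmodularFun f →
            ∃ H : (Fin m → Fin n → Bool) → (Fin n → Bool) → ℝ,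
              (∀ S : Fin m → Fin n → Bool,
                RealRAM.Outputs learn predict γ ε (List.ofFn fun i => (S i, f (S i)))
                  (timeBound C c n γ ε) (H S)) ∧
              2 / 3 ≤ uniformProb
                (fun S : Fin m → Fin n → Bool => MultApprox (1 + γ) ε f (H S)) := by
  obtain ⟨C₀, hC₀, hC₁⟩ : ∃ C₀,
      (RealRAM.Prog.block RealRAM.Prog.parameters).size + RealRAM.Prog.store.size + 66 ≤ C₀ ∧
        RealRAM.Prog.predict.size ≤ C₀ := ⟨_, le_max_left _ _, le_max_right _ _⟩
  obtain ⟨C, hC, hC'⟩ : ∃ C : ℝ, 2000000 * 4 ^ 19 ≤ C ∧ (2187 * C₀ : ℝ) ≤ C :=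
    ⟨_, le_max_left _ _, le_max_right _ _⟩
  refine ⟨RealRAM.learn, RealRAM.Prog.predict.compile, C, 5, fun n γ ε hn hγ hγ1 hε hε1 => ?_⟩
  have hq : 0 < ε * γ := mul_pos hε hγ
  have hq1 : ε * γ ≤ 1 := mul_le_one₀ hε1 hγ.le hγ1
  obtain ⟨L, hL⟩ := RealRAM.exists_isScale hq
  obtain ⟨U, hU⟩ : ∃ U, U = L + 18 := ⟨_, rfl⟩
  obtain ⟨l, hl, hl'⟩ := exists_two_pow_between hn
  have hl1 : 1 ≤ l := by
    rcases l with - | l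
    · rw [pow_zero] at hl; omega
    · omega
  obtain ⟨m, hm⟩ : ∃ m, m = sampleSize U l := ⟨_, rfl⟩
  refine ⟨m, ?_, fun f h0 hf => ?_⟩
  · rw [hm]
    exact sampleSize_le_exampleBound hn hq hq1 hL hU hl'
      (le_trans (mul_le_mul_of_nonneg_right (by norm_num) (by positivity)) hC) (by norm_num)
  choose b y hsample hout using exists_outputs hn hγ hε hL hU hl hl' hm
    (hm ▸ sampleSize_lt hl1)
    (fun a ha => ⟨lt_of_lt_expBound hl1 ha, two_pow_lt_of_lt_expBound hl1 ha⟩) hC₀ hC₁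
    (steps_le_timeBound hn hq hq1 hL hU hl' hC hC') f
  exact ⟨_, hout, uniformProb_multApprox hn hf h0 hγ hγ1 hε hε1 hU hL.1 hl hm _ _ hsample⟩
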